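/- Let $K$ be a field and let $\mathcal L$ be a finite distributive lattice that is planar, i.e. isomorphic to a sublattice of a product of two chains (a sublattice of $\mathbb N^2$). Write $\alpha\nsim\beta$ if $\alpha,\beta$ are incomparable; the (unordered) pair $(\alpha,\beta)$ is then called a diamond. Put $f_{(\alpha,\beta)}=x_\alpha x_\beta-x_{\alpha\vee\beta}x_{\alpha\wedge\beta}\in K[\mathcal L]=K[x_\alpha:\alpha\in\mathcal L]$ for each diamond, let $I_{\mathcal L}$ be the ideal generated by these diamond relations, and let $R[\mathcal L]=K[\mathcal L]/I_{\mathcal L}$ be the Hibi ring. The first syzygy of $R[\mathcal L]$ is the kernel of the map $\bigoplus K[\mathcal L]\,g_{(\alpha,\beta)}\to K[\mathcal L]$, $g_{(\alpha,\beta)}\mapsto f_{(\alpha,\beta)}$, where there is one basis vector for each diamond relation; the first Betti number $\beta_1(\mathcal L)$ is its minimal number of generators. Then $$\beta_1(\mathcal L)=n(S)+n(L)+n(B)+n(D),$$ where - $n(S)$, the number of strip type generators, is twice the number of strips, i.e. triples $(\alpha,\beta_1,\beta_2)$ with $\alpha\nsim\beta_1$, $\alpha\nsim\beta_2$, $\alpha\vee\beta_1\ne\alpha\vee\beta_2$,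 $\alpha\wedge\beta_1=\alpha\wedge\beta_2$, $\beta_1\le\beta_2$, $\alpha\wedge\beta_2\le\beta_1\le\alpha\vee\beta_2$, $\beta_2\nsim\alpha\vee\beta_1$, $\beta_2\ge\alpha\wedge\beta_1$ (these generate the sublattices isomorphic to a product of a 2-chain and a 3-chain); - $n(L)$, the number of $L$-type generators, is the number of triples $(\alpha,\beta_1,\beta_2)$ with $\alpha\nsim\beta_1$, $\alpha\nsim\beta_2$, $\alpha\wedge\beta_1\ne\alpha\wedge\beta_2$, $\alpha\vee\beta_1\ne\alpha\vee\beta_2$, $\beta_1\le\beta_2$, $\beta_1\le\alpha\vee\beta_2$, $\beta_1\nsim\alpha\wedge\beta_2$, $\beta_2\nsim\alpha\vee\beta_1$, $\beta_2\ge\alpha\wedge\beta_1$ (these generate the sublattices isomorphic to a product of two 3-chains with one of the two side corners removed); - $n(B)$, the number of box type generators, is twice the number of boxes, a box being given by a triple $(\alpha,\beta_1,\beta_2)$ with $\alpha\nsim\beta_1$, $\alpha\nsim\beta_2$, $\alpha\wedge\beta_1\ne\alpha\wedge\beta_2$, $\alpha\vee\beta_1\ne\alpha\vee\beta_2$, $\beta_1\nsim\beta_2$,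 $\alpha\wedge\beta_2\le\beta_1\le\alpha\vee\beta_2$, $\beta_2\nsim\alpha\vee\beta_1$, $\beta_2\nsim\alpha\wedge\beta_1$, where $(\alpha,\beta_1,\beta_2)$ and $(\beta_2,\beta_1,\alpha)$ give the same box (these generate the sublattices isomorphic to a product of two 3-chains); - $n(D)$, the number of diamond type generators, is the number of pairs of diamonds $(\alpha_1,\beta_1),(\alpha_2,\beta_2)$ that are comparable ($\alpha_1,\beta_1\le\alpha_2$ and $\alpha_1,\beta_1\le\beta_2$) and for which there is no third diamond $(\alpha_3,\beta_3)$ with $\alpha_1\vee\beta_1\le\alpha_3\le\alpha_2\wedge\beta_2$, $\alpha_3\wedge\beta_3\in\{\alpha_1,\beta_1\}$ and $\alpha_3\vee\beta_3\in\{\alpha_2,\beta_2\}$. Moreover, let $JM$ be the set of elements of $\mathcal L$ that are both join irreducible and meet irreducible, let $ht$ be the height in $\mathcal L$, and suppose that every element of $JM$ is incomparable to at most two elements of $JM$, and that no two distinct elements of $JM$ are incomparable to the same two distinct elements of $JM$. Put $$S(m,n)=2\tbinom{m+1}{2}\tbinom{n+1}{3}+2\tbinom{n+1}{2}\tbinom{m+1}{3},\qquad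 L(m,n)=B(m,n)=2\tbinom{m+1}{3}\tbinom{n+1}{3},$$ and, for incomparable $\theta,\theta'\in\mathcal L$ and $F\in\{S,L,B\}$, $F(\theta,\theta')=F\bigl(ht(\theta)-ht(\theta\wedge\theta'),\,ht(\theta')-ht(\theta\wedge\theta')\bigr)$. Then, with $\sum_{i,j}$ over the unordered pairs $\theta_i\nsim\theta_j$ in $JM$, with $\sum_{i,j,k}$ over the triples in $JM$ with $\theta_i<\theta_k$ and $\theta_j\nsim\theta_i,\theta_k$, and with $r=ht(\theta_i\vee\theta_j)-ht(\theta_j)$, $s=ht(\theta_j)-ht(\theta_j\wedge\theta_k)$, $$n(S)=\sum_{i,j}S(\theta_i,\theta_j)-\sum_{i,j,k}S(\theta_i\vee(\theta_j\wedge\theta_k),\theta_j),$$ $$n(L)=\sum_{i,j}L(\theta_i,\theta_j)-\sum_{i,j,k}L(r,s)+\sum_{i,j,k}\bigl(ht(\theta_j\vee\theta_k)-ht(\theta_i\vee\theta_j)\bigr)\bigl(ht(\theta_j\wedge\theta_k)-ht(\theta_i\wedge\theta_j)\bigr)\tbinom{r+1}{2}\tbinom{s+1}{2},$$ $$n(B)=\sum_{i,j}B(\theta_i,\theta_j)-\sum_{i,j,k}B(\theta_i\vee(\theta_j\wedge\theta_k),\theta_j).$$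 -/

import Mathlib

/-! ### Hibi rings, their first syzygy and the first Betti number -/

/-- `α ≁ β`: the elements `α` and `β` are incomparable. -/
abbrev Incomp {L : Type*} [LE L] (α β : L) : Prop := ¬ α ≤ β ∧ ¬ β ≤ α

/-- The diamond relation `f_(α,β) = x_α x_β - x_(α ∨ β) x_(α ∧ β)` in `K[L]`. -/
noncomputable def diamondRel (K : Type*) [Field K] {L : Type*} [Lattice L] (α β : L) :
    MvPolynomial L K :=
  MvPolynomial.X α * MvPolynomial.X β - MvPolynomial.X (α ⊔ β) * MvPolynomial.X (α ⊓ β)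

/-- The set of all diamond relations `f_1, …, f_n`; one for each unordered pair of incomparable
elements. It generates the ideal `I_L` of the Hibi ring `R[L] = K[L] / I_L`. -/
def diamondRels (K : Type*) [Field K] (L : Type*) [Lattice L] : Set (MvPolynomial L K) :=
  {f | ∃ α β : L, Incomp α β ∧ f = diamondRel K α β}

/-- The first syzygy of `R[L]`: the kernel of the `K[L]`-linear map `g_i ↦ f_i` from the free
module with one basis vector `g_i` for each diamond relation `f_i` to `K[L]`. -/
noncomputable def firstSyzygy (K : Type*) [Field K] (L : Type*) [Lattice L] :
    Submodule (MvPolynomial L K) (diamondRels K L →₀ MvPolynomial L K) :=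
  LinearMap.ker (Finsupp.linearCombination (MvPolynomial L K)
    (fun f : diamondRels K L => (f : MvPolynomial L K)))

/-- The first Betti number of `R[L]`: the minimal number of generators of its first syzygy. -/
noncomputable def firstBetti (K : Type*) [Field K] (L : Type*) [Lattice L] : ℕ :=
  (firstSyzygy K L).spanFinrank

/-- A (finite) lattice is planar distributive if it is isomorphic to a sublattice of `ℕ × ℕ`, that
is, of a product of two chains. -/
def IsPlanarLattice (L : Type*) [Lattice L] : Prop :=
  ∃ f : LatticeHom L (ℕ × ℕ), Function.Injective f

/-! ### The types of generators

In each of the first three types, `(α, β₁)` and `(α, β₂)` are two diamonds with the common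
element `α`. -/

/-- A strip: the sublattice generated by `α, β₁, β₂` is the product of a chain with two and a chain
with three elements. -/
def IsStrip {L : Type*} [Lattice L] (α β₁ β₂ : L) : Prop :=
  Incomp α β₁ ∧ Incomp α β₂ ∧ α ⊔ β₁ ≠ α ⊔ β₂ ∧ α ⊓ β₁ = α ⊓ β₂ ∧ β₁ ≤ β₂ ∧
    β₁ ≤ α ⊔ β₂ ∧ α ⊓ β₂ ≤ β₁ ∧ Incomp β₂ (α ⊔ β₁) ∧ α ⊓ β₁ ≤ β₂

/-- An L-shape: the sublattice generated by `α, β₁, β₂` is the product of two chains with three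
elements each, with one of its two side corners removed. -/
def IsLShape {L : Type*} [Lattice L] (α β₁ β₂ : L) : Prop :=
  Incomp α β₁ ∧ Incomp α β₂ ∧ α ⊓ β₁ ≠ α ⊓ β₂ ∧ α ⊔ β₁ ≠ α ⊔ β₂ ∧ β₁ ≤ β₂ ∧
    β₁ ≤ α ⊔ β₂ ∧ Incomp β₁ (α ⊓ β₂) ∧ Incomp β₂ (α ⊔ β₁) ∧ α ⊓ β₁ ≤ β₂

/-- A box: the sublattice generated by `α, β₁, β₂` is the product of two chains with three elements
each; `β₁` is its centre, and `α` and `β₂` are its two side corners. -/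
def IsBox {L : Type*} [Lattice L] (α β₁ β₂ : L) : Prop :=
  Incomp α β₁ ∧ Incomp α β₂ ∧ α ⊓ β₁ ≠ α ⊓ β₂ ∧ α ⊔ β₁ ≠ α ⊔ β₂ ∧ Incomp β₁ β₂ ∧
    β₁ ≤ α ⊔ β₂ ∧ α ⊓ β₂ ≤ β₁ ∧ Incomp β₂ (α ⊔ β₁) ∧ Incomp β₂ (α ⊓ β₁)

/-- The diamonds `(α₁, β₁)` and `(α₂, β₂)` are comparable, the first being the lower one. -/
def DiamondsComparable {L : Type*} [Lattice L] (α₁ β₁ α₂ β₂ : L) : Prop :=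
  α₁ ≤ α₂ ∧ α₁ ≤ β₂ ∧ β₁ ≤ α₂ ∧ β₁ ≤ β₂

/-- A third diamond `(α₃, β₃)` joins the lower diamond `(α₁, β₁)` to the upper diamond `(α₂, β₂)`:
the element `α₃` lies between the two diamonds, `α₃ ∧ β₃` is one of `α₁, β₁`, and `α₃ ∨ β₃` is one
of `α₂, β₂`. -/
def JoinedByThird {L : Type*} [Lattice L] (α₁ β₁ α₂ β₂ : L) : Prop :=
  ∃ α₃ β₃ : L, Incomp α₃ β₃ ∧ α₁ ⊔ β₁ ≤ α₃ ∧ α₃ ≤ α₂ ⊓ β₂ ∧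
    (α₃ ⊓ β₃ = α₁ ∨ α₃ ⊓ β₃ = β₁) ∧ (α₃ ⊔ β₃ = α₂ ∨ α₃ ⊔ β₃ = β₂)

/-- The pairs of diamonds whose diamond type syzygy is a generator of its own: the diamonds are
comparable, and no third diamond joins them. -/
def IsDiamondType {L : Type*} [Lattice L] (α₁ β₁ α₂ β₂ : L) : Prop :=
  Incomp α₁ β₁ ∧ Incomp α₂ β₂ ∧ DiamondsComparable α₁ β₁ α₂ β₂ ∧ ¬ JoinedByThird α₁ β₁ α₂ β₂

/-- `n(S)`: every strip carries the two generators
`S₁ = -x_β₂ g_(α,β₁) + x_β₁ g_(α,β₂) - x_(α∧β₁) g_(β₂,α∨β₁)` and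
`S₂ = x_(α∨β₂) g_(α,β₁) - x_(α∨β₁) g_(α,β₂) + x_α g_(β₂,α∨β₁)`. -/
noncomputable def numStrip (L : Type*) [Lattice L] : ℕ :=
  2 * {t : L × L × L | IsStrip t.1 t.2.1 t.2.2}.ncard

/-- `n(L)`: every L-shape carries the generator
`-x_β₂ g_(α,β₁) + x_β₁ g_(α,β₂) + x_(α∨β₂) g_(β₁,α∧β₂) - x_(α∧β₁) g_(β₂,α∨β₁)`. -/
noncomputable def numLShape (L : Type*) [Lattice L] : ℕ :=
  {t : L × L × L | IsLShape t.1 t.2.1 t.2.2}.ncard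

/-- `n(B)`: every box carries the two generators
`B₁ = -x_β₂ g_(α,β₁) + x_β₁ g_(α,β₂) - x_(α∨β₁) g_(β₂,α∧β₁) - x_(α∧β₂) g_(α∨β₁,β₁∨β₂)` and
`B₂ = -x_β₁ g_(α,β₂) + x_α g_(β₁,β₂) + x_(β₁∨β₂) g_(α,β₁∧β₂) + x_(α∧β₂) g_(α∨β₁,β₁∨β₂)`.
The box of `α, β₁, β₂` is also the box of `β₂, β₁, α`, and it is counted once. -/
noncomputable def numBox (L : Type*) [Lattice L] : ℕ :=
  2 * {p : Sym2 L × L | ∃ α β₁ β₂ : L, IsBox α β₁ β₂ ∧ p = (s(α, β₂), β₁)}.ncard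

/-- `n(D)`: the number of pairs (lower diamond, upper diamond) whose syzygy
`f_(α₂,β₂) g_(α₁,β₁) - f_(α₁,β₁) g_(α₂,β₂)` is a generator of its own. -/
noncomputable def numDiamond (L : Type*) [Lattice L] : ℕ :=
  {p : Sym2 L × Sym2 L | ∃ α₁ β₁ α₂ β₂ : L,
    IsDiamondType α₁ β₁ α₂ β₂ ∧ p = (s(α₁, β₁), s(α₂, β₂))}.ncard

/-! ### The counting formulas over intervals between join-meet irreducibles -/

/-- The number of strip type generators of the `m × n` grid lattice (a product of chains with
`m + 1` and `n + 1` elements). -/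
def gridStrip (m n : ℕ) : ℕ :=
  (m + 1).choose 2 * (2 * (n + 1).choose 3) + (n + 1).choose 2 * (2 * (m + 1).choose 3)

/-- The number of L-type generators of the `m × n` grid lattice. -/
def gridLShape (m n : ℕ) : ℕ := 2 * (m + 1).choose 3 * (n + 1).choose 3

/-- The number of box type generators of the `m × n` grid lattice. -/
def gridBox (m n : ℕ) : ℕ := 2 * (m + 1).choose 3 * (n + 1).choose 3

theorem gridStrip_comm (m n : ℕ) : gridStrip m n = gridStrip n m := by
  unfold gridStrip; ring

theorem gridLShape_comm (m n : ℕ) : gridLShape m n = gridLShape n m := by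
  unfold gridLShape; ring

theorem gridBox_comm (m n : ℕ) : gridBox m n = gridBox n m := by
  unfold gridBox; ring

/-- The height of an element of a finite lattice, as a natural number. -/
noncomputable def ht {L : Type*} [Lattice L] (x : L) : ℕ := (Order.height x).toNat

/-- The set `JM` of join-meet irreducible elements. -/
def JM (L : Type*) [Lattice L] : Set L := {θ | SupIrred θ ∧ InfIrred θ}

/-- For a function `F` of the size of a grid, the value of `F` at the grid
`[θ₁ ∧ θ₂, θ₁ ∨ θ₂]`. -/
noncomputable def onInterval {L : Type*} [Lattice L] (F : ℕ → ℕ → ℕ) (θ₁ θ₂ : L) : ℕ :=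
  F (ht θ₁ - ht (θ₁ ⊓ θ₂)) (ht θ₂ - ht (θ₁ ⊓ θ₂))

/-- `onInterval F`, as a function of the unordered pair, for symmetric `F`. -/
noncomputable def onPair {L : Type*} [Lattice L] (F : ℕ → ℕ → ℕ) (hF : ∀ m n, F m n = F n m) :
    Sym2 L → ℕ :=
  Sym2.lift ⟨fun θ₁ θ₂ => onInterval F θ₁ θ₂, fun θ₁ θ₂ => by
    simp only [onInterval, inf_comm θ₂ θ₁]; exact hF _ _⟩

/-- The unordered pairs of incomparable join-meet irreducibles. -/
noncomputable def jmPairs (L : Type*) [Lattice L] [Finite L] : Finset (Sym2 L) :=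
  (Set.toFinite {p : Sym2 L | ∃ θ₁ ∈ JM L, ∃ θ₂ ∈ JM L, Incomp θ₁ θ₂ ∧ p = s(θ₁, θ₂)}).toFinset

/-- The triples `(θᵢ, θⱼ, θₖ)` of join-meet irreducibles with `θᵢ < θₖ` and `θⱼ` incomparable to
both of them. -/
noncomputable def jmTriples (L : Type*) [Lattice L] [Finite L] : Finset (L × L × L) :=
  (Set.toFinite {t : L × L × L | t.1 ∈ JM L ∧ t.2.1 ∈ JM L ∧ t.2.2 ∈ JM L ∧
    t.1 < t.2.2 ∧ Incomp t.1 t.2.1 ∧ Incomp t.2.1 t.2.2}).toFinset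

/-- The join-meet irreducibles form zigzags: each of them is incomparable to at most two others,
and two of them are never incomparable to the same two. Equivalently for planar `L`, the
incomparability graph of `JM` is a disjoint union of paths. -/
def IsZigzag (L : Type*) [Lattice L] : Prop :=
  (∀ θ ∈ JM L, ∀ a ∈ JM L, ∀ b ∈ JM L, ∀ c ∈ JM L,
    Incomp θ a → Incomp θ b → Incomp θ c → a = b ∨ b = c ∨ a = c) ∧
  (∀ θ ∈ JM L, ∀ θ' ∈ JM L, ∀ a ∈ JM L, ∀ b ∈ JM L, θ ≠ θ' →
    Incomp θ a → Incomp θ' a → Incomp θ b → Incomp θ' b → a = b)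

/-- The formula for `n(S)`:
`∑ n(θᵢ, θⱼ) - ∑ n(θᵢ ∨ (θⱼ ∧ θₖ), θⱼ)`. -/
noncomputable def stripFormula (L : Type*) [Lattice L] [Finite L] : ℤ :=
  (∑ p ∈ jmPairs L, (onPair gridStrip gridStrip_comm p : ℤ)) -
    ∑ t ∈ jmTriples L, (onInterval gridStrip (t.1 ⊔ (t.2.1 ⊓ t.2.2)) t.2.1 : ℤ)

/-- The formula for `n(L)`:
`∑ m(θᵢ, θⱼ) - ∑ m(r, s) + ∑ (ht (θⱼ ∨ θₖ) - ht (θᵢ ∨ θⱼ)) (ht (θⱼ ∧ θₖ) - ht (θᵢ ∧ θⱼ))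
binom(r + 1, 2) binom(s + 1, 2)`,
where `r = ht (θᵢ ∨ θⱼ) - ht θⱼ` and `s = ht θⱼ - ht (θⱼ ∧ θₖ)`. -/
noncomputable def lShapeFormula (L : Type*) [Lattice L] [Finite L] : ℤ :=
  (∑ p ∈ jmPairs L, (onPair gridLShape gridLShape_comm p : ℤ)) -
    (∑ t ∈ jmTriples L,
      (gridLShape (ht (t.1 ⊔ t.2.1) - ht t.2.1) (ht t.2.1 - ht (t.2.1 ⊓ t.2.2)) : ℤ)) +
    ∑ t ∈ jmTriples L,
      (((ht (t.2.1 ⊔ t.2.2) - ht (t.1 ⊔ t.2.1)) * (ht (t.2.1 ⊓ t.2.2) - ht (t.1 ⊓ t.2.1)) *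
        (ht (t.1 ⊔ t.2.1) - ht t.2.1 + 1).choose 2 *
        (ht t.2.1 - ht (t.2.1 ⊓ t.2.2) + 1).choose 2 : ℕ) : ℤ)

/-- The formula for `n(B)`:
`∑ B(θᵢ, θⱼ) - ∑ B(θᵢ ∨ (θⱼ ∧ θₖ), θⱼ)`. -/
noncomputable def boxFormula (L : Type*) [Lattice L] [Finite L] : ℤ :=
  (∑ p ∈ jmPairs L, (onPair gridBox gridBox_comm p : ℤ)) -
    ∑ t ∈ jmTriples L, (onInterval gridBox (t.1 ⊔ (t.2.1 ⊓ t.2.2)) t.2.1 : ℤ)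

/-! In planar coordinates an incomparable pair consists of a left (upper) and a right (lower)
element. The weight `(A - x) * y` drops strictly when such a pair is replaced by its join and meet,
so `x_α x_β` is the leading monomial of `f_(α,β)`.

Generation is an argument in the style of Schreyer (`ker_bd_le`): a submodule of the syzygies is
everything as soon as any two terms `u g_p`, `u' g_q` with the same leading monomial agree modulo it
and modulo lower weight. If the leading monomials share a variable `α`, the other factors `β`, `γ`
are either comparable (a fork, treated by `shapeSyz`) or form an antichain with `α` (treated by
`boxSyz`). If they share none, either some cross pair is incomparable and two forks or antichains do
the job, or the diamonds are comparable and the trivial syzygy does; the latter is redundant when a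
third diamond joins them (`diamondSyz_eq_of_joined`).

Minimality is shown by `K`-linear functionals that kill all multiples of syzygies by variables,
hence live on `ker / 𝔪 ker` (`IsCocycle`). For forks and boxes they read off one leading
coefficient, and the resulting matrix is triangular for the weight. For diamond type they count
certain terms in one multidegree; that they are cocycles is exactly where the absence of a third
diamond enters. So the Betti number is the number of generators: forks are strips of two kinds
(common meet or common join, equinumerous) and L-shapes, each box has two orientations, and the rest
are pairs of diamonds.

For the formulas, every interval `[θ ∧ θ', θ ∨ θ']` is a full grid whose sides are measured by
heights, so its shapes are counted by binomials. A configuration with outer elements `α` left of `γ`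
lies in the interval of `θ`, `θ'` exactly when one of these is in the set `U` of elements of `JM` to
the upper left of `α` and the other in the set `V` to the lower right of `γ`. The zigzag condition
excludes three neighbours and four-cycles, so `(|U|, |V|)` is `(1,1)`, `(1,2)` or `(2,1)`, and pairs
minus triples gives `1`. An L-shape can also straddle two overlapping intervals without lying in
either; these are the last sum in the formula for `n(L)`. -/

section

open MvPolynomial

set_option linter.unusedSimpArgs false

/-! ### Planar coordinates -/

/-- A pair of coordinates embedding a lattice as a sublattice of `ℕ × ℕ`. -/
structure PlanarCoords (L : Type*) [Lattice L] where
  /-- the first coordinate -/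
  cx : L → ℕ
  /-- the second coordinate -/
  cy : L → ℕ
  le_iff : ∀ a b, a ≤ b ↔ cx a ≤ cx b ∧ cy a ≤ cy b
  cx_sup : ∀ a b, cx (a ⊔ b) = max (cx a) (cx b)
  cx_inf : ∀ a b, cx (a ⊓ b) = min (cx a) (cx b)
  cy_sup : ∀ a b, cy (a ⊔ b) = max (cy a) (cy b)
  cy_inf : ∀ a b, cy (a ⊓ b) = min (cy a) (cy b)

theorem IsPlanarLattice.exists_coords {L : Type*} [Lattice L] (h : IsPlanarLattice L) :
    Nonempty (PlanarCoords L) := by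
  obtain ⟨f, hf⟩ := h
  refine ⟨⟨fun a => (f a).1, fun a => (f a).2, fun a b => ?_, ?_, ?_, ?_, ?_⟩⟩
  · rw [← Prod.le_def, ← inf_eq_left, ← inf_eq_left (a := f a), ← map_inf, hf.eq_iff]
  all_goals intro a b; simp

namespace PlanarCoords

variable {L : Type*} [Lattice L] (c : PlanarCoords L)

theorem ext_iff' {a b : L} : a = b ↔ c.cx a = c.cx b ∧ c.cy a = c.cy b := by
  rw [le_antisymm_iff, c.le_iff, c.le_iff]; omega

theorem ext' {a b : L} (hX : c.cx a = c.cx b) (hY : c.cy a = c.cy b) : a = b := c.ext_iff'.2 ⟨hX, hY⟩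

/-- `α` lies to the upper left of `β`. -/
def Left (α β : L) : Prop := c.cx α < c.cx β ∧ c.cy β < c.cy α

theorem incomp_iff {α β : L} : Incomp α β ↔ c.Left α β ∨ c.Left β α := by
  simp only [Incomp, Left, c.le_iff]; omega

variable {c} in
theorem Left.incomp {α β : L} (h : c.Left α β) : Incomp α β := c.incomp_iff.2 (.inl h)

variable {c} in
theorem Left.asymm {α β : L} (h : c.Left α β) : ¬ c.Left β α := by
  unfold Left at *; omega

/-- Exchange of the two coordinates. -/
def swap : PlanarCoords L where
  cx := c.cy
  cy := c.cx
  le_iff a b := by rw [c.le_iff, and_comm]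
  cx_sup := c.cy_sup
  cx_inf := c.cy_inf
  cy_sup := c.cx_sup
  cy_inf := c.cx_inf

theorem swap_left {α β : L} : c.swap.Left α β ↔ c.Left β α := by
  simp only [Left, swap]; omega

end PlanarCoords

theorem Incomp.symm {L : Type*} [LE L] {α β : L} (h : Incomp α β) : Incomp β α := ⟨h.2, h.1⟩

theorem Incomp.ne {L : Type*} [Preorder L] {α β : L} (h : Incomp α β) : α ≠ β :=
  fun e => h.1 e.le

/-! ### A strictly submodular weight -/

namespace PlanarCoords

variable {L : Type*} [Lattice L] [Finite L] (c : PlanarCoords L)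

theorem exists_bound : ∃ A, ∀ x, c.cx x ≤ A := by
  obtain ⟨A, hA⟩ := (Set.finite_range c.cx).bddAbove
  exact ⟨A, fun x => hA ⟨x, rfl⟩⟩

/-- A weight that decreases when an incomparable pair is replaced by its join and its meet. -/
noncomputable def wt (x : L) : ℕ := (c.exists_bound.choose - c.cx x) * c.cy x

/-- The difference of the two sides is `(cx β - cx α) * (cy α - cy β)`, a product of positive
numbers; the bound `A` cancels and only keeps the subtraction in `ℕ` honest. -/
theorem wt_left {α β : L} (h : c.Left α β) :
    c.wt (α ⊔ β) + c.wt (α ⊓ β) < c.wt α + c.wt β := by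
  have hA := c.exists_bound.choose_spec
  unfold wt
  generalize c.exists_bound.choose = A at *
  obtain ⟨h1, h2⟩ := h
  rw [c.cx_sup, c.cx_inf, c.cy_sup, c.cy_inf, max_eq_right h1.le, min_eq_left h1.le,
    max_eq_left h2.le, min_eq_right h2.le]
  obtain ⟨p, hp⟩ := Nat.exists_eq_add_of_le (hA β)
  obtain ⟨q, hq⟩ := Nat.exists_eq_add_of_lt h1
  obtain ⟨r, hr⟩ := Nat.exists_eq_add_of_lt h2
  have e1 : A - c.cx α = p + q + 1 := by omega
  have e2 : A - c.cx β = p := by omega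
  rw [e1, e2, hr]
  nlinarith

theorem wt_incomp {α β : L} (h : Incomp α β) :
    c.wt (α ⊔ β) + c.wt (α ⊓ β) < c.wt α + c.wt β := by
  rcases c.incomp_iff.1 h with h | h
  · exact c.wt_left h
  · rw [sup_comm, inf_comm, add_comm (c.wt α)]; exact c.wt_left h

end PlanarCoords

theorem Finsupp.single_one_add_single_one_eq_iff {ι : Type*} {a b a' b' : ι} :
    (Finsupp.single a 1 + Finsupp.single b 1 : ι →₀ ℕ) =
      Finsupp.single a' 1 + Finsupp.single b' 1 ↔ s(a, b) = s(a', b') := by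
  classical
  rw [← (Multiset.toFinsupp (α := ι)).symm.injective.eq_iff]
  simp only [Multiset.toFinsupp_symm_apply]
  simp only [map_add, Finsupp.toMultiset_single, one_smul, Multiset.singleton_add]
  rw [Sym2.eq_iff, Multiset.cons_eq_cons]
  constructor
  · rintro (⟨rfl, h⟩ | ⟨_, cs, h, h'⟩)
    · simp_all
    · obtain ⟨rfl, rfl⟩ : b = a' ∧ cs = 0 := by
        have := congrArg Multiset.card h
        have hc : cs = 0 := by simpa using this
        subst hc; simpa using h
      right; simpa [eq_comm] using h'
  · rintro (⟨rfl, rfl⟩ | ⟨rfl, rfl⟩)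
    · simp
    · by_cases h : a = b
      · simp [h]
      · exact Or.inr ⟨h, 0, by simp⟩

/-! ### The syzygies over ordered diamonds -/

namespace PlanarCoords

variable {L : Type*} [Lattice L] (c : PlanarCoords L) (K : Type*) [Field K]

/-- The diamonds, as pairs (left corner, right corner). -/
abbrev Dia : Type _ := {p : L × L // c.Left p.1 p.2}

/-- The free module with one basis vector for each diamond. -/
abbrev Free : Type _ := c.Dia →₀ MvPolynomial L K

/-- The map sending the basis vector of a diamond to the diamond relation. -/
noncomputable def bd : c.Free K →ₗ[MvPolynomial L K] MvPolynomial L K :=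
  Finsupp.linearCombination _ fun p : c.Dia => diamondRel K p.1.1 p.1.2

open Classical in
/-- The basis vector of the diamond `(α, β)`, and zero if `α` and `β` are comparable. -/
noncomputable def gen (α β : L) : c.Free K :=
  if h : c.Left α β then Finsupp.single ⟨(α, β), h⟩ 1
  else if h : c.Left β α then Finsupp.single ⟨(β, α), h⟩ 1 else 0

/-- The leading monomial of a diamond relation. -/
noncomputable def src (p : c.Dia) : L →₀ ℕ := Finsupp.single p.1.1 1 + Finsupp.single p.1.2 1

/-- The other monomial of a diamond relation. -/
noncomputable def tgt (p : c.Dia) : L →₀ ℕ :=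
  Finsupp.single (p.1.1 ⊔ p.1.2) 1 + Finsupp.single (p.1.1 ⊓ p.1.2) 1

variable {c K}

theorem gen_of_left {α β : L} (h : c.Left α β) :
    c.gen K α β = Finsupp.single ⟨(α, β), h⟩ 1 := by
  unfold gen; rw [dif_pos h]

theorem gen_of_right {α β : L} (h : c.Left β α) :
    c.gen K α β = Finsupp.single ⟨(β, α), h⟩ 1 := by
  unfold gen; rw [dif_neg h.asymm, dif_pos h]

theorem gen_comm (α β : L) : c.gen K α β = c.gen K β α := by
  by_cases h : c.Left α β
  · rw [gen_of_left h, gen_of_right h]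
  · by_cases h' : c.Left β α
    · rw [gen_of_left h', gen_of_right h']
    · unfold gen; simp only [dif_neg h, dif_neg h']

theorem gen_of_not_incomp {α β : L} (h : ¬ Incomp α β) : c.gen K α β = 0 := by
  rw [c.incomp_iff, not_or] at h
  unfold gen; simp only [dif_neg h.1, dif_neg h.2]

theorem gen_of_le {α β : L} (h : α ≤ β) : c.gen K α β = 0 := gen_of_not_incomp fun h' => h'.1 h

theorem gen_of_ge {α β : L} (h : β ≤ α) : c.gen K α β = 0 := gen_of_not_incomp fun h' => h'.2 h

end PlanarCoords

section
variable {L : Type*} (K : Type*) [Field K]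

theorem diamondRel_comm [Lattice L] (α β : L) : diamondRel K α β = diamondRel K β α := by
  unfold diamondRel; rw [sup_comm, inf_comm]; ring

theorem diamondRel_of_le [Lattice L] {α β : L} (h : α ≤ β) : diamondRel K α β = 0 := by
  unfold diamondRel; rw [sup_eq_right.2 h, inf_eq_left.2 h]; ring

theorem X_mul_X_eq_monomial (α β : L) : (X α * X β : MvPolynomial L K) =
    monomial (Finsupp.single α 1 + Finsupp.single β 1) 1 := by
  simp [X, monomial_mul]

end

namespace PlanarCoords

variable {L : Type*} [Lattice L] {c : PlanarCoords L} {K : Type*} [Field K]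

theorem bd_single (p : c.Dia) (f : MvPolynomial L K) :
    c.bd K (Finsupp.single p f) = f * diamondRel K p.1.1 p.1.2 := by
  simp [bd]

theorem bd_gen (α β : L) : c.bd K (c.gen K α β) = diamondRel K α β := by
  by_cases h : c.Left α β
  · rw [gen_of_left h, bd_single, one_mul]
  · by_cases h' : c.Left β α
    · rw [gen_of_right h', bd_single, one_mul, diamondRel_comm]
    · have h1 : ¬ Incomp α β := by rw [c.incomp_iff]; tauto
      rw [gen_of_not_incomp h1, map_zero]
      by_cases h2 : α ≤ β
      · rw [diamondRel_of_le K h2]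
      · rw [diamondRel_comm, diamondRel_of_le K (by by_contra h3; exact h1 ⟨h2, h3⟩)]

theorem diamondRel_eq (p : c.Dia) : diamondRel K p.1.1 p.1.2 =
    monomial (c.src p) 1 - monomial (c.tgt p) 1 := by
  unfold diamondRel; rw [X_mul_X_eq_monomial, X_mul_X_eq_monomial]; rfl

theorem src_injective : Function.Injective c.src := by
  rintro ⟨⟨a, b⟩, h⟩ ⟨⟨a', b'⟩, h'⟩ e
  rw [src, src, Finsupp.single_one_add_single_one_eq_iff, Sym2.eq_iff] at e
  rcases e with ⟨h1, h2⟩ | ⟨h1, h2⟩ <;> simp only at h1 h2 <;> subst h1 h2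
  · rfl
  · exact absurd h h'.asymm

/-- The two factors of a `src` are incomparable, while a meet lies below a join. Hence a leading
monomial of one relation is never the trailing monomial of another. -/
theorem src_ne_tgt (p q : c.Dia) : c.src p ≠ c.tgt q := by
  intro e
  rw [src, tgt, Finsupp.single_one_add_single_one_eq_iff, Sym2.eq_iff] at e
  have hp := p.2.incomp
  rcases e with ⟨h1, h2⟩ | ⟨h1, h2⟩ <;> rw [h1, h2] at hp
  · exact hp.2 (inf_le_left.trans le_sup_left)
  · exact hp.1 (inf_le_left.trans le_sup_left)

theorem diamondRel_injective :
    Function.Injective fun p : c.Dia => diamondRel K p.1.1 p.1.2 := by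
  intro p q h
  classical
  by_contra hne
  have := congrArg (coeff (c.src p)) h
  simp [diamondRel_eq, coeff_monomial, (src_ne_tgt p _).symm,
    (src_injective.ne (Ne.symm hne))] at this

variable (c K)

/-- The ordered diamonds correspond to the diamond relations. -/
noncomputable def diaEquiv : c.Dia ≃ diamondRels K L :=
  Equiv.ofBijective (fun p => ⟨diamondRel K p.1.1 p.1.2, p.1.1, p.1.2, p.2.incomp, rfl⟩) <| by
    constructor
    · intro p q h
      exact diamondRel_injective (K := K) (congrArg Subtype.val h)
    · rintro ⟨f, α, β, h, rfl⟩
      rcases c.incomp_iff.1 h with h | h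
      · exact ⟨⟨(α, β), h⟩, rfl⟩
      · exact ⟨⟨(β, α), h⟩, Subtype.ext (diamondRel_comm K _ _)⟩

/-- Passes from basis vectors indexed by polynomials to basis vectors indexed by diamonds written
from left to right. -/
theorem firstBetti_eq : firstBetti K L = (LinearMap.ker (c.bd K)).spanFinrank := by
  set φ := Finsupp.domLCongr (M := MvPolynomial L K) (R := MvPolynomial L K) (c.diaEquiv K)
  have h : (Finsupp.linearCombination (MvPolynomial L K)
      (fun f : diamondRels K L => (f : MvPolynomial L K))).comp φ.toLinearMap = c.bd K := by
    refine Finsupp.lhom_ext fun p f => ?_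
    simp only [φ, bd, diaEquiv, LinearMap.comp_apply, LinearEquiv.coe_coe, Finsupp.domLCongr_single,
      Finsupp.linearCombination_single]
    rfl
  have h2 : firstSyzygy K L = (LinearMap.ker (c.bd K)).map φ.toLinearMap := by
    rw [firstSyzygy, ← h, LinearMap.ker_comp, Submodule.map_comap_eq_of_surjective φ.surjective]
  rw [firstBetti, h2, Submodule.spanFinrank_map_eq_of_injective _ φ.injective]

end PlanarCoords

/-! ### Leading terms -/

namespace PlanarCoords

variable {L : Type*} [Lattice L] [Finite L] (c : PlanarCoords L) (K : Type*) [Field K]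

/-- The weight of a monomial. -/
noncomputable def wtM : (L →₀ ℕ) →+ ℕ := Finsupp.weight c.wt

variable {c} in
@[simp] theorem wtM_single (x : L) : c.wtM (Finsupp.single x 1) = c.wt x := by
  simp [wtM, Finsupp.weight_single]

theorem wtM_tgt_lt_src (p : c.Dia) : c.wtM (c.tgt p) < c.wtM (c.src p) := by
  simp only [src, tgt, map_add, wtM_single]
  exact c.wt_left p.2

/-- The `K`-span of the terms of weight less than `k` in the free module. -/
noncomputable def low (k : ℕ) : Submodule K (c.Free K) :=
  Submodule.span K {m | ∃ (u : L →₀ ℕ) (p : c.Dia), c.wtM (u + c.src p) < k ∧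
    m = Finsupp.single p (monomial u 1)}

/-- The `K`-span of the monomials of weight less than `k`. -/
noncomputable def lowPoly (k : ℕ) : Submodule K (MvPolynomial L K) :=
  Submodule.span K {f | ∃ w : L →₀ ℕ, c.wtM w < k ∧ f = monomial w 1}

variable {c K}

theorem low_mono {k l : ℕ} (h : k ≤ l) : c.low K k ≤ c.low K l := by
  refine Submodule.span_mono ?_
  rintro _ ⟨u, p, hu, rfl⟩
  exact ⟨u, p, hu.trans_le h, rfl⟩

theorem single_mem_low {k : ℕ} {u : L →₀ ℕ} {p : c.Dia} (h : c.wtM (u + c.src p) < k) :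
    Finsupp.single p (monomial u 1) ∈ c.low K k :=
  Submodule.subset_span ⟨u, p, h, rfl⟩

theorem exists_mem_low (m : c.Free K) : ∃ k, m ∈ c.low K k := by
  induction m using Finsupp.induction_linear with
  | zero => exact ⟨0, zero_mem _⟩
  | add f g hf hg =>
    obtain ⟨k, hk⟩ := hf
    obtain ⟨l, hl⟩ := hg
    exact ⟨max k l, add_mem (low_mono (le_max_left _ _) hk) (low_mono (le_max_right _ _) hl)⟩
  | single p f =>
    induction f using MvPolynomial.induction_on' with
    | monomial u a =>
      refine ⟨c.wtM (u + c.src p) + 1, ?_⟩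
      have : Finsupp.single p (monomial u a : MvPolynomial L K) =
          a • Finsupp.single p (monomial u 1) := by
        rw [Finsupp.smul_single, smul_monomial, smul_eq_mul, mul_one]
      rw [this]
      exact Submodule.smul_mem _ _ (single_mem_low (Nat.lt_succ_self _))
    | add f g hf hg =>
      obtain ⟨k, hk⟩ := hf
      obtain ⟨l, hl⟩ := hg
      rw [Finsupp.single_add]
      exact ⟨max k l, add_mem (low_mono (le_max_left _ _) hk) (low_mono (le_max_right _ _) hl)⟩

theorem monomial_smul_mem_low {k : ℕ} {m : c.Free K} (h : m ∈ c.low K k) (u : L →₀ ℕ) :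
    (monomial u 1 : MvPolynomial L K) • m ∈ c.low K (c.wtM u + k) := by
  induction h using Submodule.span_induction with
  | mem m h =>
    obtain ⟨v, p, hv, rfl⟩ := h
    rw [Finsupp.smul_single, smul_eq_mul, monomial_mul, one_mul]
    refine single_mem_low ?_
    rw [add_assoc, map_add]; omega
  | zero => rw [smul_zero]; exact zero_mem _
  | add x y _ _ hx hy => rw [smul_add]; exact add_mem hx hy
  | smul a x _ hx => rw [smul_comm]; exact Submodule.smul_mem _ _ hx

variable (c K) in
open Classical in
/-- A section of the leading terms: a monomial goes to a term with this leading monomial, if there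
is one. -/
noncomputable def pick (w : L →₀ ℕ) : c.Free K :=
  if h : ∃ p : c.Dia, c.src p ≤ w then
    Finsupp.single h.choose (monomial (w - c.src h.choose) 1) else 0

/-- If, up to terms of lower weight, any two terms with the same leading monomial agree modulo `N`,
then `N` contains all syzygies. -/
theorem ker_bd_le (N : Submodule (MvPolynomial L K) (c.Free K)) (hN : N ≤ LinearMap.ker (c.bd K))
    (H : ∀ (p q : c.Dia) (w : L →₀ ℕ), c.src p ≤ w → c.src q ≤ w →
      (Finsupp.single p (monomial (w - c.src p) 1) - Finsupp.single q (monomial (w - c.src q) 1) :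
        c.Free K) ∈ N.restrictScalars K ⊔ c.low K (c.wtM w)) :
    LinearMap.ker (c.bd K) ≤ N := by
  -- `bd = P - Q` splits each relation into its leading and trailing monomial, and `R` lifts a
  -- monomial to some term with that leading monomial. The choice in `R` is arbitrary; `H` says that
  -- it does not matter modulo `N` and lower weight.
  set R : MvPolynomial L K →ₗ[K] c.Free K := (basisMonomials L K).constr K (c.pick K) with hR
  have R_mono (w : L →₀ ℕ) : R (monomial w 1) = c.pick K w := by
    have := (basisMonomials L K).constr_basis K (c.pick K) w
    rwa [coe_basisMonomials] at this
  set P : c.Free K →ₗ[MvPolynomial L K] MvPolynomial L K :=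
    Finsupp.linearCombination _ fun p : c.Dia => monomial (c.src p) 1
  set Q : c.Free K →ₗ[MvPolynomial L K] MvPolynomial L K :=
    Finsupp.linearCombination _ fun p : c.Dia => monomial (c.tgt p) 1
  have P_single (p : c.Dia) (u : L →₀ ℕ) :
      P (Finsupp.single p (monomial u 1)) = monomial (u + c.src p) 1 := by
    simp [P, monomial_mul]
  have Q_single (p : c.Dia) (u : L →₀ ℕ) :
      Q (Finsupp.single p (monomial u 1)) = monomial (u + c.tgt p) 1 := by
    simp [Q, monomial_mul]
  have hPQ : c.bd K = P - Q := by
    refine Finsupp.lhom_ext fun p f => ?_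
    simp only [bd_single, diamondRel_eq, LinearMap.sub_apply, P, Q,
      Finsupp.linearCombination_single, smul_eq_mul, mul_sub]
  have R_low (k : ℕ) : c.lowPoly K k ≤ (c.low K k).comap R := by
    refine Submodule.span_le.2 ?_
    rintro _ ⟨w, hw, rfl⟩
    simp only [Submodule.comap_coe, Set.mem_preimage, SetLike.mem_coe, R_mono, pick]
    split_ifs with h
    · refine single_mem_low ?_
      rwa [tsub_add_cancel_of_le h.choose_spec]
    · exact zero_mem _
  have Q_low (k : ℕ) : c.low K (k + 1) ≤ (c.lowPoly K k).comap (Q.restrictScalars K) := by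
    refine Submodule.span_le.2 ?_
    rintro _ ⟨u, p, hu, rfl⟩
    simp only [Submodule.comap_coe, Set.mem_preimage, SetLike.mem_coe,
      LinearMap.coe_restrictScalars, Q_single]
    refine Submodule.subset_span ⟨_, ?_, rfl⟩
    have := c.wtM_tgt_lt_src p
    rw [map_add] at hu ⊢; omega
  -- `R ∘ P` replaces a term by another one with the same leading monomial, so `H` controls the
  -- difference.
  have key (k : ℕ) : c.low K (k + 1) ≤ (N.restrictScalars K ⊔ c.low K k).comap
      (LinearMap.id - R.comp (P.restrictScalars K)) := by
    refine Submodule.span_le.2 ?_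
    rintro _ ⟨u, p, hu, rfl⟩
    simp only [Submodule.comap_coe, Set.mem_preimage, SetLike.mem_coe, LinearMap.sub_apply,
      LinearMap.id_apply, LinearMap.comp_apply, LinearMap.coe_restrictScalars, P_single, R_mono]
    have hex : ∃ q : c.Dia, c.src q ≤ u + c.src p := ⟨p, le_add_self⟩
    rw [pick, dif_pos hex]
    have := H p hex.choose (u + c.src p) le_add_self hex.choose_spec
    rw [add_tsub_cancel_right] at this
    exact sup_le_sup_left (low_mono (Nat.le_of_lt_succ hu)) (N.restrictScalars K) this
  have main (k : ℕ) : ∀ m ∈ LinearMap.ker (c.bd K), m ∈ c.low K k → m ∈ N := by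
    induction k with
    | zero =>
      intro m _ hm
      have : c.low K 0 = ⊥ := by
        rw [low, Submodule.span_eq_bot]
        rintro _ ⟨u, p, hu, -⟩
        exact absurd hu (Nat.not_lt_zero _)
      rw [this, Submodule.mem_bot] at hm
      rw [hm]; exact zero_mem _
    | succ k ih =>
      intro m hm hk
      have h1 := key k hk
      -- On a syzygy the leading parts equal the trailing parts, whose weight is smaller.
      have h2 : R (P m) ∈ c.low K k := by
        have : P m = Q m := by
          rw [LinearMap.mem_ker, hPQ, LinearMap.sub_apply, sub_eq_zero] at hm
          exact hm
        rw [this]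
        exact R_low k (Q_low k hk)
      have h3 : m ∈ N.restrictScalars K ⊔ c.low K k := by
        have h4 : m - R (P m) ∈ N.restrictScalars K ⊔ c.low K k := h1
        have := add_mem h4 (Submodule.mem_sup_right (S := N.restrictScalars K) h2)
        rwa [sub_add_cancel] at this
      obtain ⟨n, hn, l, hl, rfl⟩ := Submodule.mem_sup.1 h3
      have hn' : n ∈ N := hn
      refine add_mem hn' (ih l ?_ hl)
      have := sub_mem hm (hN hn')
      rwa [add_sub_cancel_left] at this
  intro m hm
  obtain ⟨k, hk⟩ := exists_mem_low m
  exact main k m hm hk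

end PlanarCoords

/-! ### The strip, L-shape, box and diamond type syzygies -/

namespace PlanarCoords

section
variable {L : Type*} [Lattice L] (c : PlanarCoords L) (K : Type*) [Field K]

/-- The syzygy of two diamonds `(α, β)` and `(α, γ)` with `β ≤ γ`. -/
noncomputable def shapeSyz (α β γ : L) : c.Free K :=
  (X γ : MvPolynomial L K) • c.gen K α β - (X β : MvPolynomial L K) • c.gen K α γ +
    ((X (α ⊓ β) : MvPolynomial L K) • c.gen K γ (α ⊔ β) -
    (X (α ⊔ γ) : MvPolynomial L K) • c.gen K β (α ⊓ γ))

/-- The syzygy of the diamonds `(α, β)` and `(α, γ)` of an antichain with `β` in the middle. -/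
noncomputable def boxSyz (α β γ : L) : c.Free K :=
  (X γ : MvPolynomial L K) • c.gen K α β - (X β : MvPolynomial L K) • c.gen K α γ +
    ((X (α ⊔ β) : MvPolynomial L K) • c.gen K γ (α ⊓ β) +
    (X (α ⊓ γ) : MvPolynomial L K) • c.gen K (α ⊔ β) (β ⊔ γ))

/-- The trivial syzygy between two diamond relations. -/
noncomputable def diamondSyz (α β γ δ : L) : c.Free K :=
  diamondRel K γ δ • c.gen K α β - diamondRel K α β • c.gen K γ δ

variable {c K}

theorem bd_diamondSyz (α β γ δ : L) : c.bd K (c.diamondSyz K α β γ δ) = 0 := by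
  simp only [diamondSyz, map_sub, map_smul, bd_gen, smul_eq_mul]; ring

theorem bd_boxSyz {α β γ : L} (h1 : β ≤ α ⊔ γ) (h2 : α ⊓ γ ≤ β) :
    c.bd K (c.boxSyz K α β γ) = 0 := by
  have e1 : γ ⊔ α ⊓ β = β ⊔ γ := by
    rw [c.le_iff] at h1 h2
    refine c.ext' ?_ ?_ <;> simp only [c.cx_sup, c.cx_inf, c.cy_sup, c.cy_inf] at * <;> omega
  have e2 : γ ⊓ (α ⊓ β) = α ⊓ γ := by
    rw [c.le_iff] at h1 h2
    refine c.ext' ?_ ?_ <;> simp only [c.cx_sup, c.cx_inf, c.cy_sup, c.cy_inf] at * <;> omega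
  have e3 : (α ⊔ β) ⊓ (β ⊔ γ) = β := by
    rw [c.le_iff] at h1 h2
    refine c.ext' ?_ ?_ <;> simp only [c.cx_sup, c.cx_inf, c.cy_sup, c.cy_inf] at * <;> omega
  have e4 : (α ⊔ β) ⊔ (β ⊔ γ) = α ⊔ γ := by
    rw [c.le_iff] at h1 h2
    refine c.ext' ?_ ?_ <;> simp only [c.cx_sup, c.cx_inf, c.cy_sup, c.cy_inf] at * <;> omega
  simp only [boxSyz, map_sub, map_add, map_smul, bd_gen, smul_eq_mul, diamondRel]
  rw [e1, e2, e3, e4]; ring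

theorem bd_shapeSyz {α β γ : L} (h : β ≤ γ) : c.bd K (c.shapeSyz K α β γ) = 0 := by
  have e1 : γ ⊔ (α ⊔ β) = α ⊔ γ := by
    rw [c.le_iff] at h
    refine c.ext' ?_ ?_ <;> simp only [c.cx_sup, c.cx_inf, c.cy_sup, c.cy_inf] at * <;> omega
  have e2 : γ ⊓ (α ⊔ β) = β ⊔ α ⊓ γ := by
    rw [c.le_iff] at h
    refine c.ext' ?_ ?_ <;> simp only [c.cx_sup, c.cx_inf, c.cy_sup, c.cy_inf] at * <;> omega
  have e3 : β ⊓ (α ⊓ γ) = α ⊓ β := by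
    rw [c.le_iff] at h
    refine c.ext' ?_ ?_ <;> simp only [c.cx_sup, c.cx_inf, c.cy_sup, c.cy_inf] at * <;> omega
  simp only [shapeSyz, map_sub, map_add, map_smul, bd_gen, smul_eq_mul, diamondRel]
  rw [e1, e2, e3]; ring

/-- In the degenerate cases the terms vanish or cancel in pairs. This allows identities between
shape syzygies to be used without checking that each of them belongs to a genuine fork. -/
theorem shapeSyz_eq_zero {α β γ : L} (h : β ≤ γ)
    (h' : ¬ (Incomp α β ∧ Incomp α γ ∧ β ≠ γ)) : c.shapeSyz K α β γ = 0 := by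
  unfold shapeSyz
  by_cases hβγ : β = γ
  · subst hβγ
    rw [gen_of_le (le_sup_right : β ≤ α ⊔ β), gen_of_ge (inf_le_right : α ⊓ β ≤ β)]
    simp
  by_cases h1 : β ≤ α
  · rw [gen_of_ge h1, sup_eq_left.2 h1, inf_eq_right.2 h1, gen_of_le (le_inf h1 h),
      gen_comm γ α]
    simp
  by_cases h2 : α ≤ β
  · rw [gen_of_le h2, gen_of_le (h2.trans h), sup_eq_right.2 h2, inf_eq_left.2 (h2.trans h),
      gen_of_ge h, gen_of_ge h2]
    simp
  by_cases h3 : α ≤ γ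
  · rw [gen_of_le h3, inf_eq_left.2 h3, sup_eq_right.2 h3, gen_of_ge (sup_le h3 h), gen_comm β α]
    simp
  by_cases h4 : γ ≤ α
  · exact absurd (h.trans h4) h1
  exact absurd ⟨⟨h2, h1⟩, ⟨h3, h4⟩, hβγ⟩ h'

/-- If a third diamond `(σ, ρ)` joins the diamonds `(α, β)` and `(γ, δ)`, then the trivial syzygy
between these is a combination of the shape syzygies. -/
theorem diamondSyz_eq_of_joined {α β γ δ σ ρ : L} (hm : σ ⊓ ρ = α) (hj : σ ⊔ ρ = γ) (hβ : β ≤ σ)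
    (hδ : σ ≤ δ) : c.diamondSyz K α β γ δ =
      (X (α ⊓ β) : MvPolynomial L K) • c.shapeSyz K (ρ ⊔ β) σ δ +
      (X (γ ⊔ δ) : MvPolynomial L K) • c.shapeSyz K (ρ ⊓ δ) β σ -
      ((X δ : MvPolynomial L K) • c.shapeSyz K ρ β σ +
        (X β : MvPolynomial L K) • c.shapeSyz K ρ σ δ -
        (X σ : MvPolynomial L K) • c.shapeSyz K ρ β δ) := by
  subst hm hj
  rw [c.le_iff] at hβ hδ
  have e1 : σ ⊓ ρ ⊓ β = ρ ⊓ β := by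
    refine c.ext' ?_ ?_ <;> simp only [c.cx_sup, c.cx_inf, c.cy_sup, c.cy_inf] at * <;> omega
  have e2 : σ ⊔ ρ ⊔ δ = ρ ⊔ δ := by
    refine c.ext' ?_ ?_ <;> simp only [c.cx_sup, c.cx_inf, c.cy_sup, c.cy_inf] at * <;> omega
  have e3 : (ρ ⊔ β) ⊓ σ = σ ⊓ ρ ⊔ β := by
    refine c.ext' ?_ ?_ <;> simp only [c.cx_sup, c.cx_inf, c.cy_sup, c.cy_inf] at * <;> omega
  have e4 : ρ ⊔ β ⊔ σ = σ ⊔ ρ := by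
    refine c.ext' ?_ ?_ <;> simp only [c.cx_sup, c.cx_inf, c.cy_sup, c.cy_inf] at * <;> omega
  have e5 : ρ ⊔ β ⊔ δ = ρ ⊔ δ := by
    refine c.ext' ?_ ?_ <;> simp only [c.cx_sup, c.cx_inf, c.cy_sup, c.cy_inf] at * <;> omega
  have e6 : ρ ⊓ δ ⊓ β = ρ ⊓ β := by
    refine c.ext' ?_ ?_ <;> simp only [c.cx_sup, c.cx_inf, c.cy_sup, c.cy_inf] at * <;> omega
  have e7 : ρ ⊓ δ ⊔ σ = (σ ⊔ ρ) ⊓ δ := by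
    refine c.ext' ?_ ?_ <;> simp only [c.cx_sup, c.cx_inf, c.cy_sup, c.cy_inf] at * <;> omega
  have e8 : ρ ⊓ δ ⊓ σ = σ ⊓ ρ := by
    refine c.ext' ?_ ?_ <;> simp only [c.cx_sup, c.cx_inf, c.cy_sup, c.cy_inf] at * <;> omega
  have e9 : ρ ⊓ δ ⊔ β = (ρ ⊔ β) ⊓ δ := by
    refine c.ext' ?_ ?_ <;> simp only [c.cx_sup, c.cx_inf, c.cy_sup, c.cy_inf] at * <;> omega
  -- In the subtracted bracket the leading terms cancel as in a Koszul relation among `x_β, x_σ,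
  -- x_δ`. What remains of it combines with the first two shape syzygies to the trivial syzygy, once
  -- the lattice identities above have matched the elements.
  simp only [diamondSyz, shapeSyz, diamondRel]
  rw [e1, e2, e3, e4, e5, e6, e7, e8, e9, inf_comm ρ σ, sup_comm ρ σ, gen_comm δ (σ ⊔ ρ),
    gen_comm β (σ ⊓ ρ), gen_comm σ (ρ ⊔ β), gen_comm δ (ρ ⊔ β), gen_comm σ (ρ ⊓ δ),
    gen_comm β (ρ ⊓ δ)]
  module

end

section
variable {L : Type*} [Lattice L] [Finite L] {c : PlanarCoords L} {K : Type*} [Field K]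

theorem monomial_smul_gen_mem_low {k : ℕ} {u : L →₀ ℕ} {α β : L}
    (h : c.wtM u + c.wt α + c.wt β < k) :
    (monomial u 1 : MvPolynomial L K) • c.gen K α β ∈ c.low K k := by
  by_cases h1 : c.Left α β
  · rw [gen_of_left h1, Finsupp.smul_single, smul_eq_mul, mul_one]
    refine single_mem_low ?_
    simp only [src, map_add, wtM_single]; omega
  · by_cases h2 : c.Left β α
    · rw [gen_of_right h2, Finsupp.smul_single, smul_eq_mul, mul_one]
      refine single_mem_low ?_
      simp only [src, map_add, wtM_single]; omega
    · rw [gen_of_not_incomp (by rw [c.incomp_iff]; tauto), smul_zero]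
      exact zero_mem _

theorem X_smul_gen_mem_low {k : ℕ} {x α β : L} (h : c.wt x + c.wt α + c.wt β < k) :
    (X x : MvPolynomial L K) • c.gen K α β ∈ c.low K k :=
  monomial_smul_gen_mem_low (by rwa [wtM_single])

/-- The lower terms of the shape syzygy have lower weight. -/
theorem shapeSyz_lower {α β γ : L} (h1 : Incomp α β) (h2 : Incomp α γ) :
    (X (α ⊓ β) : MvPolynomial L K) • c.gen K γ (α ⊔ β) -
      (X (α ⊔ γ) : MvPolynomial L K) • c.gen K β (α ⊓ γ) ∈
      c.low K (c.wt α + c.wt β + c.wt γ) := by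
  have := c.wt_incomp h1
  have := c.wt_incomp h2
  exact sub_mem (X_smul_gen_mem_low (by omega)) (X_smul_gen_mem_low (by omega))

/-- The lower terms of the box syzygy have lower weight. -/
theorem boxSyz_lower {α β γ : L} (h1 : Incomp α β) (h3 : Incomp β γ)
    (h4 : β ≤ α ⊔ γ) (h5 : α ⊓ γ ≤ β) :
    (X (α ⊔ β) : MvPolynomial L K) • c.gen K γ (α ⊓ β) +
      (X (α ⊓ γ) : MvPolynomial L K) • c.gen K (α ⊔ β) (β ⊔ γ) ∈
      c.low K (c.wt α + c.wt β + c.wt γ) := by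
  have i1 := c.wt_incomp h1
  refine add_mem (X_smul_gen_mem_low (by omega)) (X_smul_gen_mem_low ?_)
  have e1 : γ ⊔ α ⊓ β = β ⊔ γ := by
    rw [c.le_iff] at h4 h5
    refine c.ext' ?_ ?_ <;> simp only [c.cx_sup, c.cx_inf, c.cy_sup, c.cy_inf] at * <;> omega
  have e2 : γ ⊓ (α ⊓ β) = α ⊓ γ := by
    rw [c.le_iff] at h4 h5
    refine c.ext' ?_ ?_ <;> simp only [c.cx_sup, c.cx_inf, c.cy_sup, c.cy_inf] at * <;> omega
  have h6 : Incomp γ (α ⊓ β) := by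
    simp only [Incomp, c.le_iff, c.cx_sup, c.cx_inf, c.cy_sup, c.cy_inf] at *; omega
  have i2 := c.wt_incomp h6
  rw [e1, e2] at i2
  omega

end

end PlanarCoords

/-! ### The candidate generators and their span -/

/-- Two diamonds `(α, β)` and `(α, γ)` with `β < γ`. -/
def IsFork {L : Type*} [Lattice L] (α β γ : L) : Prop := Incomp α β ∧ Incomp α γ ∧ β < γ

namespace PlanarCoords

section
variable {L : Type*} [Lattice L] (c : PlanarCoords L)

/-- In the plane an antichain is linearly ordered from left to right. The defining conditions of a
box reduce to an antichain with `β` in the middle, read in either direction. -/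
theorem isBox_iff {α β γ : L} :
    IsBox α β γ ↔ (c.Left α β ∧ c.Left β γ) ∨ (c.Left γ β ∧ c.Left β α) := by
  constructor
  · rintro ⟨h1, -, -, -, h3, h4, h5, -, -⟩
    rw [c.incomp_iff] at h1 h3
    simp only [Left, c.le_iff, c.cx_sup, c.cx_inf, c.cy_sup, c.cy_inf] at *
    omega
  · rintro (⟨⟨h1, h2⟩, h3, h4⟩ | ⟨⟨h1, h2⟩, h3, h4⟩) <;>
    refine ⟨?_, ?_, ?_, ?_, ?_, ?_, ?_, ?_, ?_⟩ <;>
    simp only [Incomp, ne_eq, c.ext_iff', c.le_iff, c.cx_sup, c.cx_inf, c.cy_sup, c.cy_inf] <;>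
    omega

/-- The three alternatives are: `β`, `γ`, or `α` is the middle element. In the last one both
orientations of the box are recorded, because both syzygies are needed. -/
theorem isBox_of_antichain {α β γ : L} (h1 : c.Left α β ∨ c.Left β α)
    (h2 : c.Left α γ ∨ c.Left γ α) (h3 : c.Left β γ ∨ c.Left γ β) :
    IsBox α β γ ∨ IsBox α γ β ∨ (IsBox β α γ ∧ IsBox γ α β) := by
  simp only [c.isBox_iff]
  rcases h1 with h1 | h1 <;> rcases h2 with h2 | h2 <;> rcases h3 with h3 | h3 <;>
  simp only [Left] at * <;> omega

variable (K : Type*) [Field K]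

/-- The index set of the minimal generators: the forks, the boxes with an orientation, and the
pairs of diamonds of diamond type. -/
abbrev GenIdx : Type _ :=
  {t : L × L × L // IsFork t.1 t.2.1 t.2.2} ⊕ {t : L × L × L // IsBox t.1 t.2.1 t.2.2} ⊕
  {t : L × L × L × L // IsDiamondType t.1 t.2.1 t.2.2.1 t.2.2.2 ∧ c.Left t.1 t.2.1 ∧
    c.Left t.2.2.1 t.2.2.2}

/-- The minimal generators of the first syzygy. -/
noncomputable def genSyz : c.GenIdx → c.Free K
  | .inl t => c.shapeSyz K t.1.1 t.1.2.1 t.1.2.2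
  | .inr (.inl t) => c.boxSyz K t.1.1 t.1.2.1 t.1.2.2
  | .inr (.inr t) => c.diamondSyz K t.1.1 t.1.2.1 t.1.2.2.1 t.1.2.2.2

/-- The submodule generated by the minimal generators. -/
noncomputable def genSpan : Submodule (MvPolynomial L K) (c.Free K) :=
  Submodule.span _ (Set.range (c.genSyz K))

variable {c K}

theorem bd_genSyz (t : c.GenIdx) : c.bd K (c.genSyz K t) = 0 := by
  rcases t with t | t | t
  · exact bd_shapeSyz t.2.2.2.le
  · exact bd_boxSyz t.2.2.2.2.2.2.1 t.2.2.2.2.2.2.2.1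
  · exact bd_diamondSyz _ _ _ _

theorem genSpan_le_ker : c.genSpan K ≤ LinearMap.ker (c.bd K) := by
  refine Submodule.span_le.2 ?_
  rintro _ ⟨t, rfl⟩
  exact bd_genSyz t

theorem shapeSyz_mem {α β γ : L} (h : β ≤ γ) : c.shapeSyz K α β γ ∈ c.genSpan K := by
  by_cases h' : Incomp α β ∧ Incomp α γ ∧ β ≠ γ
  · exact Submodule.subset_span ⟨.inl ⟨(α, β, γ), h'.1, h'.2.1, lt_of_le_of_ne h h'.2.2⟩, rfl⟩
  · rw [shapeSyz_eq_zero h h']; exact zero_mem _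

theorem boxSyz_mem {α β γ : L} (h : IsBox α β γ) : c.boxSyz K α β γ ∈ c.genSpan K :=
  Submodule.subset_span ⟨.inr (.inl ⟨(α, β, γ), h⟩), rfl⟩

theorem diamondSyz_swap_left (α β γ δ : L) :
    c.diamondSyz K β α γ δ = c.diamondSyz K α β γ δ := by
  simp only [diamondSyz, gen_comm β α, diamondRel_comm K β α]

theorem diamondSyz_swap_right (α β γ δ : L) :
    c.diamondSyz K α β δ γ = c.diamondSyz K α β γ δ := by
  simp only [diamondSyz, gen_comm δ γ, diamondRel_comm K δ γ]

theorem diamondSyz_mem_of_joined {α β γ δ σ ρ : L} (hm : σ ⊓ ρ = α) (hj : σ ⊔ ρ = γ) (hβ : β ≤ σ)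
    (hδ : σ ≤ δ) : c.diamondSyz K α β γ δ ∈ c.genSpan K := by
  rw [diamondSyz_eq_of_joined hm hj hβ hδ]
  refine sub_mem (add_mem ?_ ?_) (sub_mem (add_mem ?_ ?_) ?_) <;>
  exact Submodule.smul_mem _ _ (shapeSyz_mem (by first | exact hδ | exact hβ | exact hβ.trans hδ))

theorem isDiamondType_swap_left {α β γ δ : L} (h : IsDiamondType α β γ δ) :
    IsDiamondType β α γ δ := by
  obtain ⟨h1, h2, ⟨h3, h4, h5, h6⟩, h7⟩ := h
  refine ⟨h1.symm, h2, ⟨h5, h6, h3, h4⟩, fun h => h7 ?_⟩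
  obtain ⟨s, r, g1, g2, g3, g4, g5⟩ := h
  exact ⟨s, r, g1, by rwa [sup_comm], g3, g4.symm, g5⟩

theorem isDiamondType_swap_right {α β γ δ : L} (h : IsDiamondType α β γ δ) :
    IsDiamondType α β δ γ := by
  obtain ⟨h1, h2, ⟨h3, h4, h5, h6⟩, h7⟩ := h
  refine ⟨h1, h2.symm, ⟨h4, h3, h6, h5⟩, fun h => h7 ?_⟩
  obtain ⟨s, r, g1, g2, g3, g4, g5⟩ := h
  exact ⟨s, r, g1, g2, by rwa [inf_comm], g4, g5.symm⟩

/-- Either a third diamond makes the syzygy a combination of shape syzygies, or it is itself a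
generator, up to the order within each diamond. -/
theorem diamondSyz_mem {α β γ δ : L} (h1 : Incomp α β) (h2 : Incomp γ δ)
    (h3 : DiamondsComparable α β γ δ) : c.diamondSyz K α β γ δ ∈ c.genSpan K := by
  by_cases hJ : JoinedByThird α β γ δ
  · obtain ⟨s, r, -, g2, g3, g4, g5⟩ := hJ
    have l1 := le_sup_left.trans g2
    have l2 := le_sup_right.trans g2
    have u1 := g3.trans inf_le_left
    have u2 := g3.trans inf_le_right
    rcases g4 with g4 | g4 <;> rcases g5 with g5 | g5
    · exact diamondSyz_mem_of_joined g4 g5 l2 u2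
    · rw [← diamondSyz_swap_right]
      exact diamondSyz_mem_of_joined g4 g5 l2 u1
    · rw [← diamondSyz_swap_left]
      exact diamondSyz_mem_of_joined g4 g5 l1 u2
    · rw [← diamondSyz_swap_left, ← diamondSyz_swap_right]
      exact diamondSyz_mem_of_joined g4 g5 l1 u1
  · have hD : IsDiamondType α β γ δ := ⟨h1, h2, h3, hJ⟩
    have mem {α β γ δ : L} (h : IsDiamondType α β γ δ) (hl : c.Left α β) (hl' : c.Left γ δ) :
        c.diamondSyz K α β γ δ ∈ c.genSpan K :=
      Submodule.subset_span ⟨.inr (.inr ⟨(α, β, γ, δ), h, hl, hl'⟩), rfl⟩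
    rcases c.incomp_iff.1 h1 with l | l <;> rcases c.incomp_iff.1 h2 with l' | l'
    · exact mem hD l l'
    · rw [← diamondSyz_swap_right]
      exact mem (isDiamondType_swap_right hD) l l'
    · rw [← diamondSyz_swap_left]
      exact mem (isDiamondType_swap_left hD) l l'
    · rw [← diamondSyz_swap_left, ← diamondSyz_swap_right]
      exact mem (isDiamondType_swap_right (isDiamondType_swap_left hD)) l l'

end

/-! ### Comparing terms with the same leading monomial -/

section
variable {L : Type*} [Lattice L] [Finite L] (c : PlanarCoords L) (K : Type*) [Field K]

/-- The elements of the free module that agree with an element of the span of the generators up to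
terms of weight less than `k`. -/
noncomputable def genSpanLow (k : ℕ) : Submodule K (c.Free K) :=
  (c.genSpan K).restrictScalars K ⊔ c.low K k

variable {c K}

theorem mem_genSpanLow_of_add {k : ℕ} {m l : c.Free K} (h : m + l ∈ c.genSpan K)
    (hl : l ∈ c.low K k) : m ∈ c.genSpanLow K k := by
  have := sub_mem (Submodule.mem_sup_left (T := c.low K k)
    (show m + l ∈ (c.genSpan K).restrictScalars K from h)) (Submodule.mem_sup_right hl)
  rwa [add_sub_cancel_right] at this

theorem monomial_smul_mem_genSpanLow {k : ℕ} {m : c.Free K} (h : m ∈ c.genSpanLow K k)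
    (u : L →₀ ℕ) : (monomial u 1 : MvPolynomial L K) • m ∈ c.genSpanLow K (c.wtM u + k) := by
  obtain ⟨n, hn, l, hl, rfl⟩ := Submodule.mem_sup.1 h
  rw [smul_add]
  exact Submodule.add_mem_sup (Submodule.smul_mem (c.genSpan K) _ hn)
    (monomial_smul_mem_low hl u)

theorem X_smul_mem_genSpanLow {k : ℕ} {m : c.Free K} (h : m ∈ c.genSpanLow K k) (x : L) :
    (X x : MvPolynomial L K) • m ∈ c.genSpanLow K (c.wt x + k) := by
  have := monomial_smul_mem_genSpanLow h (Finsupp.single x 1)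
  rwa [wtM_single] at this

/-- The case of leading monomials with the common factor `α`: the displayed difference is the
leading part of a shape syzygy or of box syzygies. -/
theorem fork_mem_genSpanLow {α β γ : L} (h1 : Incomp α β) (h2 : Incomp α γ) :
    (X γ : MvPolynomial L K) • c.gen K α β - (X β : MvPolynomial L K) • c.gen K α γ ∈
      c.genSpanLow K (c.wt α + c.wt β + c.wt γ) := by
  have box {α β γ : L} (h1 : Incomp α β) (h3 : Incomp β γ) (h : IsBox α β γ) :
      (X γ : MvPolynomial L K) • c.gen K α β - (X β : MvPolynomial L K) • c.gen K α γ ∈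
      c.genSpanLow K (c.wt α + c.wt β + c.wt γ) :=
    mem_genSpanLow_of_add (boxSyz_mem h) (boxSyz_lower h1 h3 h.2.2.2.2.2.1 h.2.2.2.2.2.2.1)
  by_cases hβγ : β ≤ γ
  · exact mem_genSpanLow_of_add (shapeSyz_mem hβγ) (shapeSyz_lower h1 h2)
  by_cases hγβ : γ ≤ β
  · have := mem_genSpanLow_of_add (c := c) (K := K) (shapeSyz_mem hγβ) (shapeSyz_lower h2 h1)
    rw [← neg_mem_iff, neg_sub, add_right_comm]
    exact this
  have h3 : Incomp β γ := ⟨hβγ, hγβ⟩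
  rcases c.isBox_of_antichain (c.incomp_iff.1 h1) (c.incomp_iff.1 h2) (c.incomp_iff.1 h3) with h | h | ⟨h, h'⟩
  · exact box h1 h3 h
  · rw [← neg_mem_iff, neg_sub, add_right_comm]
    exact box h2 h3.symm h
  -- Here `α` is the middle of the antichain, and the pair is the difference of the two orientations
  -- of the box. This is why three pairs of diamonds in an antichain need only two generators.
  · have b1 := box h1.symm h2 h
    have b2 := box h2.symm h1 h'
    have e1 : c.wt β + c.wt α + c.wt γ = c.wt α + c.wt β + c.wt γ := by ring
    have e2 : c.wt γ + c.wt α + c.wt β = c.wt α + c.wt β + c.wt γ := by ring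
    rw [e1] at b1
    rw [e2] at b2
    convert sub_mem b1 b2 using 1
    rw [gen_comm β α, gen_comm γ α, gen_comm γ β]; abel

/-- The case of leading monomials without a prescribed common factor. An incomparable cross pair
gives an intermediate diamond; otherwise the trivial syzygy is used. -/
theorem diamonds_mem_genSpanLow {α β γ δ : L} (h1 : Incomp α β) (h2 : Incomp γ δ) :
    (X γ * X δ : MvPolynomial L K) • c.gen K α β - (X α * X β : MvPolynomial L K) • c.gen K γ δ ∈
      c.genSpanLow K (c.wt α + c.wt β + (c.wt γ + c.wt δ)) := by
  -- if `α` and `γ` are incomparable, pass through the diamond `(α, γ)`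
  have cross {α β γ δ : L} (h1 : Incomp α β) (h2 : Incomp γ δ) (h3 : Incomp α γ) :
      (X γ * X δ : MvPolynomial L K) • c.gen K α β -
        (X α * X β : MvPolynomial L K) • c.gen K γ δ ∈
        c.genSpanLow K (c.wt α + c.wt β + (c.wt γ + c.wt δ)) := by
    have m1 := X_smul_mem_genSpanLow (fork_mem_genSpanLow (c := c) (K := K) h1 h3) δ
    have m2 := X_smul_mem_genSpanLow (fork_mem_genSpanLow (c := c) (K := K) h2 h3.symm) β
    have e1 : c.wt δ + (c.wt α + c.wt β + c.wt γ) = c.wt α + c.wt β + (c.wt γ + c.wt δ) := by ring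
    have e2 : c.wt β + (c.wt γ + c.wt δ + c.wt α) = c.wt α + c.wt β + (c.wt γ + c.wt δ) := by ring
    rw [e1] at m1
    rw [e2] at m2
    convert sub_mem m1 m2 using 1
    rw [gen_comm γ α]
    module
  have low {α β γ δ : L} (h1 : Incomp α β) (h2 : Incomp γ δ)
      (h : DiamondsComparable α β γ δ) :
      (X γ * X δ : MvPolynomial L K) • c.gen K α β -
        (X α * X β : MvPolynomial L K) • c.gen K γ δ ∈
        c.genSpanLow K (c.wt α + c.wt β + (c.wt γ + c.wt δ)) := by
    have i1 := c.wt_incomp h1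
    have i2 := c.wt_incomp h2
    -- The trivial syzygy expands into four terms; the two carrying trailing monomials have lower
    -- weight.
    refine mem_genSpanLow_of_add (l := (X (α ⊔ β) * X (α ⊓ β) : MvPolynomial L K) • c.gen K γ δ -
      (X (γ ⊔ δ) * X (γ ⊓ δ) : MvPolynomial L K) • c.gen K α β) ?_ ?_
    · convert diamondSyz_mem h1 h2 h using 1
      unfold diamondSyz diamondRel
      module
    · rw [X_mul_X_eq_monomial, X_mul_X_eq_monomial]
      refine sub_mem (monomial_smul_gen_mem_low ?_) (monomial_smul_gen_mem_low ?_) <;>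
      simp only [map_add, wtM_single] <;> omega
  by_cases a1 : Incomp α γ
  · exact cross h1 h2 a1
  by_cases a2 : Incomp α δ
  · have := cross h1 h2.symm a2
    rwa [gen_comm δ γ, mul_comm (X δ), add_comm (c.wt δ)] at this
  by_cases a3 : Incomp β γ
  · have := cross h1.symm h2 a3
    rwa [gen_comm β α, mul_comm (X β), add_comm (c.wt β)] at this
  by_cases a4 : Incomp β δ
  · have := cross h1.symm h2.symm a4
    rwa [gen_comm β α, mul_comm (X β), add_comm (c.wt β), gen_comm δ γ, mul_comm (X δ),
      add_comm (c.wt δ)] at this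
  -- With all four cross pairs comparable, no element of one diamond can lie between the two of the
  -- other, so one diamond is wholly below the other.
  have hor : DiamondsComparable α β γ δ ∨ DiamondsComparable γ δ α β := by
    have key {x y : L} (h : ¬ Incomp x y) : ¬ x ≤ y → y ≤ x := fun h' => by
      by_contra h''; exact h ⟨h', h''⟩
    by_cases h : α ≤ γ
    · have hδ : α ≤ δ := by
        by_contra h'; exact h2.2 ((key a2 h').trans h)
      refine .inl ⟨h, hδ, ?_, ?_⟩ <;> by_contra h'
      · exact h1.1 (h.trans (key a3 h'))
      · exact h1.1 (hδ.trans (key a4 h'))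
    · have h := key a1 h
      have hβ : γ ≤ β := key a3 fun h' => h1.2 (h'.trans h)
      refine .inr ⟨h, hβ, key a2 fun h' => h2.1 (h.trans h'), key a4 fun h' => h2.1 (hβ.trans h')⟩
  rcases hor with h | h
  · exact low h1 h2 h
  · rw [← neg_mem_iff, neg_sub, add_comm (c.wt α + c.wt β)]
    exact low h2 h1 h

end

end PlanarCoords

/-! ### The generators span the syzygy module -/

namespace PlanarCoords

variable {L : Type*} [Lattice L] {c : PlanarCoords L} {K : Type*} [Field K]

theorem single_eq_monomial_smul_gen (p : c.Dia) (u : L →₀ ℕ) :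
    (Finsupp.single p (monomial u 1) : c.Free K) =
      (monomial u 1 : MvPolynomial L K) • c.gen K p.1.1 p.1.2 := by
  rw [gen_of_left p.2, Finsupp.smul_single, smul_eq_mul, mul_one]

variable [Finite L]

theorem fork_terms_mem {α β γ : L} (h1 : Incomp α β) (h2 : Incomp α γ) {w : L →₀ ℕ}
    (hw : Finsupp.single α 1 + Finsupp.single β 1 + Finsupp.single γ 1 ≤ w) :
    (monomial (w - (Finsupp.single α 1 + Finsupp.single β 1)) 1 : MvPolynomial L K) •
        c.gen K α β -
      (monomial (w - (Finsupp.single α 1 + Finsupp.single γ 1)) 1 : MvPolynomial L K) •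
        c.gen K α γ ∈ c.genSpanLow K (c.wtM w) := by
  obtain ⟨u, rfl⟩ := exists_add_of_le hw
  have e1 : Finsupp.single α 1 + Finsupp.single β 1 + Finsupp.single γ 1 + u -
      (Finsupp.single α 1 + Finsupp.single β 1) = u + Finsupp.single γ 1 := by
    rw [add_assoc _ (Finsupp.single γ 1), add_tsub_cancel_left, add_comm]
  have e2 : Finsupp.single α 1 + Finsupp.single β 1 + Finsupp.single γ 1 + u -
      (Finsupp.single α 1 + Finsupp.single γ 1) = u + Finsupp.single β 1 := by
    rw [add_right_comm (Finsupp.single α 1), add_assoc _ (Finsupp.single β 1),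
      add_tsub_cancel_left, add_comm]
  have := monomial_smul_mem_genSpanLow (fork_mem_genSpanLow (c := c) (K := K) h1 h2) u
  have e3 : c.wtM (Finsupp.single α 1 + Finsupp.single β 1 + Finsupp.single γ 1 + u) =
      c.wtM u + (c.wt α + c.wt β + c.wt γ) := by
    simp only [map_add, wtM_single]; ring
  rw [e1, e2, e3]
  convert this using 1
  rw [smul_sub, smul_smul, smul_smul, X, X, monomial_mul, monomial_mul, one_mul]

theorem diamonds_terms_mem {α β γ δ : L} (h1 : Incomp α β) (h2 : Incomp γ δ) {w : L →₀ ℕ}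
    (hw : Finsupp.single α 1 + Finsupp.single β 1 +
      (Finsupp.single γ 1 + Finsupp.single δ 1) ≤ w) :
    (monomial (w - (Finsupp.single α 1 + Finsupp.single β 1)) 1 : MvPolynomial L K) •
        c.gen K α β -
      (monomial (w - (Finsupp.single γ 1 + Finsupp.single δ 1)) 1 : MvPolynomial L K) •
        c.gen K γ δ ∈ c.genSpanLow K (c.wtM w) := by
  obtain ⟨u, rfl⟩ := exists_add_of_le hw
  have e1 (a b : L →₀ ℕ) : a + b + u - a = u + b := by
    rw [add_assoc, add_tsub_cancel_left, add_comm]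
  have e2 (a b : L →₀ ℕ) : a + b + u - b = u + a := by rw [add_comm a, e1]
  have := monomial_smul_mem_genSpanLow (diamonds_mem_genSpanLow (c := c) (K := K) h1 h2) u
  have e3 : c.wtM (Finsupp.single α 1 + Finsupp.single β 1 +
      (Finsupp.single γ 1 + Finsupp.single δ 1) + u) =
      c.wtM u + (c.wt α + c.wt β + (c.wt γ + c.wt δ)) := by
    simp only [map_add, wtM_single]; ring
  rw [e1, e2, e3]
  convert this using 1
  rw [smul_sub, smul_smul, smul_smul, X_mul_X_eq_monomial, X_mul_X_eq_monomial, monomial_mul,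
    monomial_mul, one_mul]

theorem three_le {ι : Type*} {a b d : ι} (hab : a ≠ b) (had : a ≠ d) (hbd : b ≠ d) {w : ι →₀ ℕ}
    (h1 : 1 ≤ w a) (h2 : 1 ≤ w b) (h3 : 1 ≤ w d) :
    Finsupp.single a 1 + Finsupp.single b 1 + Finsupp.single d 1 ≤ w := by
  classical
  intro x
  simp only [Finsupp.add_apply, Finsupp.single_apply]
  split_ifs <;> subst_vars <;> first | omega | contradiction

variable (c K)

/-- The cases of the criterion `ker_bd_le` are the ways in which two diamonds can share elements:
both, exactly one (in four positions), or none. -/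
theorem ker_bd_eq : LinearMap.ker (c.bd K) = c.genSpan K := by
  classical
  refine le_antisymm (ker_bd_le _ genSpan_le_ker ?_) genSpan_le_ker
  rintro ⟨⟨α, β⟩, h1⟩ ⟨⟨γ, δ⟩, h2⟩ w hp hq
  change _ ∈ c.genSpanLow K _
  rw [single_eq_monomial_smul_gen, single_eq_monomial_smul_gen]
  simp only [src] at *
  have i1 : Incomp α β := h1.incomp
  have i2 : Incomp γ δ := h2.incomp
  have wα : 1 ≤ w α := by have := hp α; simp at this; omega
  have wβ : 1 ≤ w β := by have := hp β; simp at this; omega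
  have wγ : 1 ≤ w γ := by have := hq γ; simp at this; omega
  have wδ : 1 ≤ w δ := by have := hq δ; simp at this; omega
  by_cases a1 : α = γ
  · subst a1
    by_cases a2 : β = δ
    · subst a2; rw [sub_self]; exact zero_mem _
    · exact fork_terms_mem i1 i2 (three_le i1.ne i2.ne a2 wα wβ wδ)
  by_cases a2 : α = δ
  · subst a2
    have hne : β ≠ γ := by rintro rfl; exact h1.asymm h2
    have := fork_terms_mem (c := c) (K := K) i1 i2.symm (three_le i1.ne i2.symm.ne hne wα wβ wγ)
    rwa [gen_comm α γ, add_comm (Finsupp.single α 1) (Finsupp.single γ 1)] at this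
  by_cases a3 : β = γ
  · subst a3
    have := fork_terms_mem (c := c) (K := K) i1.symm i2 (three_le i1.symm.ne i2.ne a2 wβ wα wδ)
    rwa [gen_comm β α, add_comm (Finsupp.single β 1) (Finsupp.single α 1)] at this
  by_cases a4 : β = δ
  · subst a4
    have := fork_terms_mem (c := c) (K := K) i1.symm i2.symm
      (three_le i1.symm.ne i2.symm.ne a1 wβ wα wγ)
    rwa [gen_comm β α, gen_comm β γ, add_comm (Finsupp.single β 1) (Finsupp.single α 1),
      add_comm (Finsupp.single β 1) (Finsupp.single γ 1)] at this
  refine diamonds_terms_mem i1 i2 fun x => ?_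
  have := i1.ne
  have := i2.ne
  simp only [Finsupp.add_apply, Finsupp.single_apply]
  split_ifs <;> subst_vars <;> first | omega | contradiction

end PlanarCoords

/-! ### Functionals on the minimal generators of the syzygy module -/

namespace PlanarCoords

variable {L : Type*} [Lattice L] {c : PlanarCoords L} {K : Type*} [Field K]

/-- The `K`-linear functional on the free module with prescribed values on the terms. -/
noncomputable def functional (ψ : (L →₀ ℕ) → c.Dia → K) : c.Free K →ₗ[K] K :=
  Finsupp.lsum K fun p => (basisMonomials L K).constr K fun u => ψ u p

theorem functional_single (ψ : (L →₀ ℕ) → c.Dia → K) (p : c.Dia) (u : L →₀ ℕ) :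
    functional ψ (Finsupp.single p (monomial u 1)) = ψ u p := by
  have := (basisMonomials L K).constr_basis K (fun u => ψ u p) u
  rw [coe_basisMonomials] at this
  rw [functional, Finsupp.lsum_single, this]

theorem linearMap_ext {V : Type*} [AddCommGroup V] [Module K V] {f g : c.Free K →ₗ[K] V}
    (h : ∀ p u, f (Finsupp.single p (monomial u 1)) = g (Finsupp.single p (monomial u 1))) :
    f = g := by
  refine Finsupp.lhom_ext' fun p => (basisMonomials L K).ext fun u => ?_
  rw [coe_basisMonomials]
  exact h p u

/-- Multiples of `ψ` by a variable are coboundaries. -/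
def IsCocycle (ψ : (L →₀ ℕ) → c.Dia → K) : Prop :=
  ∀ v : L, ∃ μ : (L →₀ ℕ) → K, ∀ u p,
    ψ (Finsupp.single v 1 + u) p = μ (u + c.src p) - μ (u + c.tgt p)

/-- The potential `μ` extends to a linear form on polynomials, and `m ↦ ψ(x_v m)` is this form
composed with `bd`, which is zero on syzygies. -/
theorem IsCocycle.functional_X_smul {ψ : (L →₀ ℕ) → c.Dia → K} (h : IsCocycle ψ) {m : c.Free K}
    (hm : m ∈ LinearMap.ker (c.bd K)) (v : L) :
    functional ψ ((X v : MvPolynomial L K) • m) = 0 := by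
  obtain ⟨μ, hμ⟩ := h v
  set Λ : MvPolynomial L K →ₗ[K] K := (basisMonomials L K).constr K μ
  have hΛ (w : L →₀ ℕ) : Λ (monomial w 1) = μ w := by
    have := (basisMonomials L K).constr_basis K μ w
    rwa [coe_basisMonomials] at this
  have : (functional ψ).comp (((Module.toModuleEnd K (c.Free K)) (X v : MvPolynomial L K))) =
      Λ.comp ((c.bd K).restrictScalars K) := by
    refine linearMap_ext fun p u => ?_
    simp only [LinearMap.comp_apply, LinearMap.coe_restrictScalars, bd_single, diamondRel_eq,
      mul_sub, monomial_mul, mul_one, map_sub, hΛ, ← hμ, Module.toModuleEnd_apply]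
    rw [DistribSMul.toLinearMap_apply, Finsupp.smul_single, smul_eq_mul, X, monomial_mul, one_mul,
      functional_single]
  have h2 := LinearMap.congr_fun this m
  simp only [LinearMap.comp_apply, LinearMap.coe_restrictScalars, LinearMap.mem_ker.1 hm,
    map_zero] at h2
  exact h2

theorem IsCocycle.functional_smul {ψ : (L →₀ ℕ) → c.Dia → K} (h : IsCocycle ψ) {m : c.Free K}
    (hm : m ∈ LinearMap.ker (c.bd K)) (f : MvPolynomial L K) :
    functional ψ (f • m) = constantCoeff f * functional ψ m := by
  induction f using MvPolynomial.induction_on with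
  | C a => rw [constantCoeff_C, C_eq_smul_one, smul_assoc, one_smul, map_smul, smul_eq_mul]
  | add f g hf hg => rw [add_smul, map_add, hf, hg, map_add, add_mul]
  | mul_X f v _ =>
    rw [mul_comm f, mul_smul, h.functional_X_smul (Submodule.smul_mem _ f hm)]
    simp

/-- A family of syzygies that is triangular with respect to functionals vanishing on the multiples
of the variables has at most as many members as any generating set. -/
theorem card_le_spanFinrank {ι : Type*} [Finite ι] (hfg : (LinearMap.ker (c.bd K)).FG)
    (z : ι → c.Free K) (hz : ∀ t, z t ∈ LinearMap.ker (c.bd K))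
    (ψ : ι → (L →₀ ℕ) → c.Dia → K) (hψ : ∀ t, IsCocycle (ψ t)) (W : ι → ℕ)
    (hself : ∀ t, functional (ψ t) (z t) ≠ 0)
    (htri : ∀ t t', functional (ψ t) (z t') ≠ 0 → t = t' ∨ W t < W t') :
    Nat.card ι ≤ (LinearMap.ker (c.bd K)).spanFinrank := by
  have := Fintype.ofFinite ι
  obtain ⟨s, hs, hspan⟩ := hfg.exists_span_finset_card_eq_spanFinrank
  set Ψ : c.Free K →ₗ[K] (ι → K) := LinearMap.pi fun t => functional (ψ t)
  -- Polynomial coefficients act through their constant terms, so the images of a generating set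
  -- over `K[L]` span the image of the kernel over `K`.
  have hmem (m : c.Free K) (hm : m ∈ LinearMap.ker (c.bd K)) :
      Ψ m ∈ Submodule.span K (Ψ '' (s : Set (c.Free K))) := by
    rw [← hspan] at hm
    induction hm using Submodule.span_induction with
    | mem x hx => exact Submodule.subset_span ⟨x, hx, rfl⟩
    | zero => rw [map_zero]; exact zero_mem _
    | add x y _ _ hx hy => rw [map_add]; exact add_mem hx hy
    | smul a x hx hx' =>
      rw [hspan] at hx
      have : Ψ (a • x) = constantCoeff a • Ψ x := by
        ext t
        exact (hψ t).functional_smul hx a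
      rw [this]
      exact Submodule.smul_mem _ _ hx'
  have hli : LinearIndependent K fun t => Ψ (z t) := by
    rw [Fintype.linearIndependent_iff]
    intro g hg
    by_contra! hne
    -- At an index of largest weight in the support, triangularity leaves only the diagonal entry.
    obtain ⟨t, ht, hmax⟩ := Set.exists_max_image {t | g t ≠ 0} W (Set.toFinite _) hne
    have h1 := congrFun hg t
    rw [Finset.sum_apply, Finset.sum_eq_single t] at h1
    · simp only [Pi.smul_apply, smul_eq_mul, Pi.zero_apply, mul_eq_zero] at h1
      exact h1.elim ht (hself t)
    · intro t' _ htt'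
      by_cases h0 : g t' = 0
      · simp [h0]
      · have : functional (ψ t) (z t') = 0 := by
          by_contra h2
          rcases htri t t' h2 with h3 | h3
          · exact htt' h3.symm
          · exact absurd (hmax t' h0) (not_le.2 h3)
        change g t' * functional (ψ t) (z t') = 0
        rw [this, mul_zero]
    · intro h; exact absurd (Finset.mem_univ t) h
  rw [← hs, Nat.card_eq_fintype_card, ← finrank_span_eq_card hli]
  classical
  have h1 : Submodule.span K (Set.range fun t => Ψ (z t)) ≤
      Submodule.span K (Ψ '' (s : Set (c.Free K))) := by
    refine Submodule.span_le.2 ?_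
    rintro _ ⟨t, rfl⟩
    exact hmem _ (hz t)
  rw [← Finset.coe_image] at h1
  refine (Submodule.finrank_mono h1).trans ((finrank_span_finset_le_card _).trans ?_)
  exact Finset.card_image_le

end PlanarCoords

/-! ### Functionals for forks and boxes -/

namespace PlanarCoords

section
variable {L : Type*} [Lattice L] {c : PlanarCoords L} {K : Type*} [Field K]

theorem functional_monomial_smul_gen {ψ : (L →₀ ℕ) → c.Dia → K} {u : L →₀ ℕ} {α β : L} {x : K}
    (h : ∀ q : c.Dia, s(q.1.1, q.1.2) = s(α, β) → ψ u q = x) (h0 : ¬ Incomp α β → x = 0) :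
    functional ψ ((monomial u 1 : MvPolynomial L K) • c.gen K α β) = x := by
  by_cases h1 : c.Left α β
  · rw [gen_of_left h1, Finsupp.smul_single, smul_eq_mul, mul_one, functional_single]
    exact h _ rfl
  · by_cases h2 : c.Left β α
    · rw [gen_of_right h2, Finsupp.smul_single, smul_eq_mul, mul_one, functional_single]
      exact h _ Sym2.eq_swap
    · have h3 : ¬ Incomp α β := by rw [c.incomp_iff]; tauto
      rw [gen_of_not_incomp h3, smul_zero, map_zero, h0 h3]

theorem src_eq_iff {q : c.Dia} {α β : L} :
    c.src q = Finsupp.single α 1 + Finsupp.single β 1 ↔ s(q.1.1, q.1.2) = s(α, β) :=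
  Finsupp.single_one_add_single_one_eq_iff

variable (c K)

open Classical in
/-- The functional reading off the coefficient of `x_γ` at the diamond `(α, β)`. -/
noncomputable def forkFun (α β γ : L) (u : L →₀ ℕ) (q : c.Dia) : K :=
  if u = Finsupp.single γ 1 ∧ s(q.1.1, q.1.2) = s(α, β) then 1 else 0

variable {c K}

/-- On multiples of `x_γ` the functional reads the constant coefficient at `g_(α,β)`. That is the
coefficient of `x_α x_β` in the image under `bd`, since this monomial is a leading monomial and
never a trailing one. Other variables cannot divide `x_γ`. -/
theorem forkFun_isCocycle {α β : L} (h : Incomp α β) (γ : L) :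
    IsCocycle (c.forkFun K α β γ) := by
  classical
  intro v
  by_cases hv : v = γ
  · subst hv
    refine ⟨fun w => if w = Finsupp.single α 1 + Finsupp.single β 1 then 1 else 0, fun u q => ?_⟩
    have hdeg (x y z t : L) (e : u + (Finsupp.single x 1 + Finsupp.single y 1) =
        Finsupp.single z 1 + Finsupp.single t 1) : u = 0 := by
      have := congrArg Finsupp.degree e
      simp only [map_add, Finsupp.degree_single] at this
      exact (Finsupp.degree_eq_zero_iff u).1 (by omega)
    have htgt : ¬ u + c.tgt q = Finsupp.single α 1 + Finsupp.single β 1 := by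
      intro e
      have := hdeg _ _ _ _ e
      subst this
      rw [zero_add, tgt, Finsupp.single_one_add_single_one_eq_iff, Sym2.eq_iff] at e
      rcases e with ⟨e1, e2⟩ | ⟨e1, e2⟩ <;> rw [← e1, ← e2] at h
      · exact h.2 (inf_le_left.trans le_sup_left)
      · exact h.1 (inf_le_left.trans le_sup_left)
    have hiff : (u + c.src q = Finsupp.single α 1 + Finsupp.single β 1) ↔
        (u = 0 ∧ s(q.1.1, q.1.2) = s(α, β)) := by
      constructor
      · intro e
        have := hdeg _ _ _ _ e
        subst this
        rw [zero_add, src_eq_iff] at e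
        exact ⟨rfl, e⟩
      · rintro ⟨rfl, e⟩
        rw [zero_add, src_eq_iff, e]
    simp only [forkFun, add_eq_left, if_neg htgt, hiff, sub_zero]
  · refine ⟨0, fun u q => ?_⟩
    have : ¬ Finsupp.single v 1 + u = Finsupp.single γ 1 := by
      intro e
      have := DFunLike.congr_fun e v
      simp [Ne.symm hv] at this
    simp [forkFun, this]

open Classical in
theorem forkFun_X_smul_gen {α β : L} (h : Incomp α β) (γ x a b : L) :
    functional (c.forkFun K α β γ) ((X x : MvPolynomial L K) • c.gen K a b) =
      if x = γ ∧ s(a, b) = s(α, β) then 1 else 0 := by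
  refine functional_monomial_smul_gen (fun q hq => ?_) fun h' => if_neg ?_
  · simp only [forkFun, hq, Finsupp.single_left_inj one_ne_zero]
  · rintro ⟨-, e⟩
    rw [Sym2.eq_iff] at e
    rcases e with ⟨rfl, rfl⟩ | ⟨rfl, rfl⟩
    exacts [h' h, h' h.symm]

theorem forkFun_of_degree_ne {α β γ a b : L} {u : L →₀ ℕ} (h : u.degree ≠ 1) :
    functional (c.forkFun K α β γ) ((monomial u 1 : MvPolynomial L K) • c.gen K a b) = 0 := by
  refine functional_monomial_smul_gen (fun q _ => if_neg ?_) fun _ => rfl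
  rintro ⟨rfl, -⟩
  exact h (by simp)

theorem diamondSyz_eq_monomials (α β γ δ : L) : c.diamondSyz K α β γ δ =
    (monomial (Finsupp.single γ 1 + Finsupp.single δ 1) 1 : MvPolynomial L K) • c.gen K α β -
    (monomial (Finsupp.single (γ ⊔ δ) 1 + Finsupp.single (γ ⊓ δ) 1) 1 : MvPolynomial L K) •
      c.gen K α β -
    ((monomial (Finsupp.single α 1 + Finsupp.single β 1) 1 : MvPolynomial L K) • c.gen K γ δ -
    (monomial (Finsupp.single (α ⊔ β) 1 + Finsupp.single (α ⊓ β) 1) 1 : MvPolynomial L K) •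
      c.gen K γ δ) := by
  simp only [diamondSyz, diamondRel, X_mul_X_eq_monomial, sub_smul]

theorem forkFun_diamondSyz (α β γ a b a' b' : L) :
    functional (c.forkFun K α β γ) (c.diamondSyz K a b a' b') = 0 := by
  rw [diamondSyz_eq_monomials]
  simp only [map_sub]
  rw [forkFun_of_degree_ne, forkFun_of_degree_ne, forkFun_of_degree_ne, forkFun_of_degree_ne]
  · simp
  all_goals simp

end

section
variable {L : Type*} [Lattice L] [Finite L] {c : PlanarCoords L} {K : Type*} [Field K]

/-- The only term that the functional sees, `x_γ g_(α,β)`, has weight `wt α + wt β + wt γ`, too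
large for `low k`. -/
theorem forkFun_low {α β γ : L} {k : ℕ} (hk : k ≤ c.wt α + c.wt β + c.wt γ) {l : c.Free K}
    (hl : l ∈ c.low K k) : functional (c.forkFun K α β γ) l = 0 := by
  classical
  induction hl using Submodule.span_induction with
  | mem m h =>
    obtain ⟨u, q, hu, rfl⟩ := h
    rw [functional_single, forkFun, if_neg]
    rintro ⟨rfl, e⟩
    rw [src_eq_iff.2 e] at hu
    simp only [map_add, wtM_single] at hu
    omega
  | zero => rw [map_zero]
  | add x y _ _ hx hy => rw [map_add, hx, hy, add_zero]
  | smul a x _ hx => rw [map_smul, hx, smul_zero]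

/-- The common shape of the leading terms of the fork and box syzygies. -/
theorem forkFun_leading {α β γ a b d : L} (h : Incomp α β)
    (hW : c.wt a + c.wt b + c.wt d ≤ c.wt α + c.wt β + c.wt γ) {l : c.Free K}
    (hl : l ∈ c.low K (c.wt a + c.wt b + c.wt d))
    (hne : functional (c.forkFun K α β γ) ((X d : MvPolynomial L K) • c.gen K a b -
      (X b : MvPolynomial L K) • c.gen K a d + l) ≠ 0) :
    (d = γ ∧ s(a, b) = s(α, β)) ∨ (b = γ ∧ s(a, d) = s(α, β)) := by
  classical
  by_contra hcon
  rw [not_or] at hcon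
  rw [map_add, map_sub, forkFun_low hW hl, forkFun_X_smul_gen h, forkFun_X_smul_gen h,
    if_neg hcon.1, if_neg hcon.2] at hne
  simp at hne

theorem forkFun_self {α β γ : L} (h : Incomp α β) (hβγ : β ≠ γ) {l : c.Free K}
    (hl : l ∈ c.low K (c.wt α + c.wt β + c.wt γ)) :
    functional (c.forkFun K α β γ) ((X γ : MvPolynomial L K) • c.gen K α β -
      (X β : MvPolynomial L K) • c.gen K α γ + l) = 1 := by
  classical
  rw [map_add, map_sub, forkFun_low le_rfl hl, forkFun_X_smul_gen h, forkFun_X_smul_gen h,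
    if_pos ⟨rfl, rfl⟩, if_neg fun h' => hβγ h'.1]
  simp

end

/-- A fork or box is determined by the support of its distinguished term. -/
theorem fork_or_box_unique {L : Type*} [Lattice L] (c : PlanarCoords L) {α β γ a b d : L}
    (h : IsFork α β γ ∨ IsBox α β γ) (h' : IsFork a b d ∨ IsBox a b d)
    (he : (d = γ ∧ s(a, b) = s(α, β)) ∨ (b = γ ∧ s(a, d) = s(α, β))) :
    (α, β, γ) = (a, b, d) := by
  rw [c.isBox_iff] at h h'
  simp only [IsFork, c.incomp_iff, lt_iff_le_not_ge, c.le_iff] at h h'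
  rw [Sym2.eq_iff, Sym2.eq_iff] at he
  obtain ⟨rfl, ⟨rfl, rfl⟩ | ⟨rfl, rfl⟩⟩ | ⟨rfl, ⟨rfl, rfl⟩ | ⟨rfl, rfl⟩⟩ := he
  · rfl
  all_goals
    exfalso
    rcases h with ⟨h1, h2, h3⟩ | ⟨h1, h2⟩ | ⟨h1, h2⟩ <;>
    rcases h' with ⟨g1, g2, g3⟩ | ⟨g1, g2⟩ | ⟨g1, g2⟩ <;>
    simp only [Left] at * <;> omega

end PlanarCoords

/-! ### The functionals of diamond type -/

theorem Finsupp.exists_of_mapDomain_ne_zero {ι κ : Type*} {f : ι → κ} {w : ι →₀ ℕ} {i : κ}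
    (h : w.mapDomain f i ≠ 0) : ∃ x, w x ≠ 0 ∧ f x = i := by
  classical
  have := Finsupp.mapDomain_support (Finsupp.mem_support_iff.2 h)
  obtain ⟨x, hx, rfl⟩ := Finset.mem_image.1 this
  exact ⟨x, Finsupp.mem_support_iff.1 hx, rfl⟩

theorem Finsupp.single_add_single_le {ι : Type*} {a b : ι} (hab : a ≠ b) {w : ι →₀ ℕ}
    (h1 : w a ≠ 0) (h2 : w b ≠ 0) : Finsupp.single a 1 + Finsupp.single b 1 ≤ w := by
  classical
  intro x
  simp only [Finsupp.add_apply, Finsupp.single_apply]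
  split_ifs <;> subst_vars <;> first | omega | contradiction

theorem Finsupp.two_le_mapDomain {ι κ : Type*} {f : ι → κ} {w : ι →₀ ℕ} {x y : ι} {i : κ}
    (h : Finsupp.single x 1 + Finsupp.single y 1 ≤ w) (hx : f x = i) (hy : f y = i) :
    2 ≤ w.mapDomain f i := by
  classical
  have := Finsupp.mapDomain_mono (f := f) h i
  simp only [Finsupp.mapDomain_add, Finsupp.mapDomain_single, Finsupp.add_apply,
    Finsupp.single_apply, hx, hy, if_true] at this
  omega

namespace PlanarCoords

variable {L : Type*} [Lattice L] (c : PlanarCoords L)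

/-- Equality of the multidegrees of two monomials. -/
def SameDeg (w w' : L →₀ ℕ) : Prop :=
  w.mapDomain c.cx = w'.mapDomain c.cx ∧ w.mapDomain c.cy = w'.mapDomain c.cy

/-- The product of the four elements of two diamonds. -/
noncomputable def quad (α β γ δ : L) : L →₀ ℕ :=
  Finsupp.single α 1 + Finsupp.single β 1 + (Finsupp.single γ 1 + Finsupp.single δ 1)

/-- A pair of diamonds of diamond type, in their left to right order. -/
def IsLeftDiamondType (α β γ δ : L) : Prop :=
  IsDiamondType α β γ δ ∧ c.Left α β ∧ c.Left γ δ

variable {c}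

theorem IsLeftDiamondType.order {α β γ δ : L} (h : c.IsLeftDiamondType α β γ δ) :
    c.cx α < c.cx β ∧ c.cx β ≤ c.cx γ ∧ c.cx γ < c.cx δ ∧
    c.cy β < c.cy α ∧ c.cy α ≤ c.cy δ ∧ c.cy δ < c.cy γ := by
  obtain ⟨⟨-, -, ⟨-, h2, h3, -⟩, -⟩, ⟨h5, h6⟩, h7, h8⟩ := h
  rw [c.le_iff] at h2 h3
  omega

theorem IsLeftDiamondType.swap {α β γ δ : L} (h : c.IsLeftDiamondType α β γ δ) :
    c.swap.IsLeftDiamondType β α δ γ :=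
  ⟨isDiamondType_swap_right (isDiamondType_swap_left h.1), c.swap_left.2 h.2.1,
    c.swap_left.2 h.2.2⟩

theorem SameDeg.swap {w w' : L →₀ ℕ} (h : c.SameDeg w w') : c.swap.SameDeg w w' := ⟨h.2, h.1⟩

/-- Join and meet of a diamond permute its coordinates, so `bd` is homogeneous for the multidegree
given by all first and all second coordinates. -/
theorem sameDeg_src_tgt (q : c.Dia) : c.SameDeg (c.src q) (c.tgt q) := by
  obtain ⟨⟨a, b⟩, h1, h2⟩ := q
  simp only at h1 h2
  simp only [SameDeg, src, tgt, Finsupp.mapDomain_add, Finsupp.mapDomain_single, c.cx_sup,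
    c.cx_inf, c.cy_sup, c.cy_inf, max_eq_right h1.le, min_eq_left h1.le, max_eq_left h2.le,
    min_eq_right h2.le]
  exact ⟨add_comm _ _, trivial⟩

theorem SameDeg.add_left {w w' : L →₀ ℕ} (h : c.SameDeg w w') (u : L →₀ ℕ) :
    c.SameDeg (u + w) (u + w') := by
  simp only [SameDeg, Finsupp.mapDomain_add, h.1, h.2, and_self]

theorem SameDeg.symm {w w' : L →₀ ℕ} (h : c.SameDeg w w') : c.SameDeg w' w := ⟨h.1.symm, h.2.symm⟩

theorem SameDeg.trans {w w' w'' : L →₀ ℕ} (h : c.SameDeg w w') (h' : c.SameDeg w' w'') :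
    c.SameDeg w w'' := ⟨h.1.trans h'.1, h.2.trans h'.2⟩

theorem SameDeg.degree_eq {w w' : L →₀ ℕ} (h : c.SameDeg w w') : w.degree = w'.degree := by
  rw [← Finsupp.degree_mapDomain c.cx w, h.1, Finsupp.degree_mapDomain]

theorem SameDeg.cx_apply {w : L →₀ ℕ} {α β γ δ : L} (h : c.SameDeg w (quad α β γ δ)) (i : ℕ) :
    w.mapDomain c.cx i = (if c.cx α = i then 1 else 0) + (if c.cx β = i then 1 else 0) +
      ((if c.cx γ = i then 1 else 0) + (if c.cx δ = i then 1 else 0)) := by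
  rw [h.1, quad]
  simp only [Finsupp.mapDomain_add, Finsupp.mapDomain_single, Finsupp.add_apply,
    Finsupp.single_apply]

theorem SameDeg.cy_apply {w : L →₀ ℕ} {α β γ δ : L} (h : c.SameDeg w (quad α β γ δ)) (i : ℕ) :
    w.mapDomain c.cy i = (if c.cy α = i then 1 else 0) + (if c.cy β = i then 1 else 0) +
      ((if c.cy γ = i then 1 else 0) + (if c.cy δ = i then 1 else 0)) := by
  rw [h.2, quad]
  simp only [Finsupp.mapDomain_add, Finsupp.mapDomain_single, Finsupp.add_apply,
    Finsupp.single_apply]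

theorem SameDeg.cx_mem {w : L →₀ ℕ} {α β γ δ : L} (h : c.SameDeg w (quad α β γ δ)) {x : L}
    (hx : w x ≠ 0) : c.cx x = c.cx α ∨ c.cx x = c.cx β ∨ c.cx x = c.cx γ ∨ c.cx x = c.cx δ := by
  have h1 : Finsupp.single x 1 ≤ w := by
    rw [Finsupp.single_le_iff]; omega
  have h2 := Finsupp.mapDomain_mono (f := c.cx) h1 (c.cx x)
  rw [h.cx_apply, Finsupp.mapDomain_single, Finsupp.single_eq_same] at h2
  by_contra hcon
  simp only [not_or] at hcon
  rw [if_neg (Ne.symm hcon.1), if_neg (Ne.symm hcon.2.1), if_neg (Ne.symm hcon.2.2.1),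
    if_neg (Ne.symm hcon.2.2.2)] at h2
  omega

theorem SameDeg.cy_mem {w : L →₀ ℕ} {α β γ δ : L} (h : c.SameDeg w (quad α β γ δ)) {x : L}
    (hx : w x ≠ 0) : c.cy x = c.cy α ∨ c.cy x = c.cy β ∨ c.cy x = c.cy γ ∨ c.cy x = c.cy δ := by
  have := h.swap.cx_mem (c := c.swap) hx
  exact this

/-- No monomial in the fibre of a pair of diamonds of diamond type has a factor at the upper left
corner. -/
theorem IsLeftDiamondType.upper_left {α β γ δ : L} (h : c.IsLeftDiamondType α β γ δ)
    {w : L →₀ ℕ} (hw : c.SameDeg w (quad α β γ δ)) {r : L} (hr : w r ≠ 0)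
    (hrx : c.cx r = c.cx α) : c.cy r ≠ c.cy γ := by
  intro hry
  obtain ⟨o1, o2, o3, o4, o5, o6⟩ := h.order
  -- With `r` at the upper left corner, an element `s` at `(cx γ, cy α)` would form the forbidden
  -- third diamond with it: the meet is `α` and the join is `γ`.
  have hs : ∀ s, c.cx s = c.cx γ → c.cy s ≠ c.cy α := by
    intro s hsx hsy
    refine h.1.2.2.2 ⟨s, r, ?_, ?_, ?_, .inl ?_, .inl ?_⟩
    · simp only [Incomp, c.le_iff]; omega
    · simp only [c.le_iff, c.cx_sup, c.cy_sup]; omega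
    · simp only [c.le_iff, c.cx_inf, c.cy_inf]; omega
    · refine c.ext' ?_ ?_ <;> simp only [c.cx_inf, c.cy_inf] <;> omega
    · refine c.ext' ?_ ?_ <;> simp only [c.cx_sup, c.cy_sup] <;> omega
  have h23 : c.cx β < c.cx γ := by
    refine lt_of_le_of_ne o2 fun e => hs (α ⊔ β) ?_ ?_ <;>
    simp only [c.cx_sup, c.cy_sup] <;> omega
  have h23' : c.cy α < c.cy δ := by
    refine lt_of_le_of_ne o5 fun e => hs (γ ⊓ δ) ?_ ?_ <;>
    simp only [c.cx_inf, c.cy_inf] <;> omega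
  -- The top row is already used up by `r`. A factor this far to the right and in a row up to that
  -- of `α` would produce the excluded point as `(z ⊔ (α ⊔ β)) ⊓ (γ ⊓ δ)`.
  have key : ∀ z, w z ≠ 0 → c.cx γ ≤ c.cx z → c.cy z = c.cy δ := by
    intro z hz hzx
    have hne : r ≠ z := by rintro rfl; omega
    have h4 : c.cy z ≠ c.cy γ := by
      intro hzy
      have := Finsupp.two_le_mapDomain (Finsupp.single_add_single_le hne hr hz) hry hzy
      rw [hw.cy_apply] at this
      split_ifs at this <;> omega
    by_contra h3
    refine hs ((z ⊔ (α ⊔ β)) ⊓ (γ ⊓ δ)) ?_ ?_ <;>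
    simp only [c.cx_sup, c.cy_sup, c.cx_inf, c.cy_inf] <;>
    rcases hw.cy_mem hz with e | e | e | e <;> omega
  obtain ⟨z, hz, hzx⟩ := Finsupp.exists_of_mapDomain_ne_zero (f := c.cx) (w := w) (i := c.cx γ)
    (by rw [hw.cx_apply]; simp)
  obtain ⟨z', hz', hzx'⟩ := Finsupp.exists_of_mapDomain_ne_zero (f := c.cx) (w := w) (i := c.cx δ)
    (by rw [hw.cx_apply]; simp)
  have hne : z ≠ z' := by rintro rfl; omega
  -- The columns of `γ` and `δ` thus supply two factors in the row of `δ`, which the multidegree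
  -- contains only once.
  have := Finsupp.two_le_mapDomain (Finsupp.single_add_single_le hne hz hz') (key z hz (by omega))
    (key z' hz' (by omega))
  rw [hw.cy_apply] at this
  split_ifs at this <;> omega

/-- The mirror image of `upper_left` under the exchange of coordinates. -/
theorem IsLeftDiamondType.lower_right {α β γ δ : L} (h : c.IsLeftDiamondType α β γ δ)
    {w : L →₀ ℕ} (hw : c.SameDeg w (quad α β γ δ)) {r : L} (hr : w r ≠ 0)
    (hry : c.cy r = c.cy β) : c.cx r ≠ c.cx δ := by
  have hw' : c.SameDeg w (quad β α δ γ) := by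
    rwa [quad, add_comm (Finsupp.single β 1), add_comm (Finsupp.single δ 1)]
  exact h.swap.upper_left hw'.swap hr hry

/-- The multidegree gives the multisets of coordinates. Comparability of the diamonds fixes their
sorted order, `α, β, γ, δ` for the first and `β, α, δ, γ` for the second, so the coordinates can be
assigned back. -/
theorem quad_injective {α β γ δ α' β' γ' δ' : L} (h : c.IsLeftDiamondType α β γ δ)
    (h' : c.IsLeftDiamondType α' β' γ' δ') (e : c.SameDeg (quad α β γ δ) (quad α' β' γ' δ')) :
    α = α' ∧ β = β' ∧ γ = γ' ∧ δ = δ' := by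
  obtain ⟨o1, o2, o3, o4, o5, o6⟩ := h.order
  obtain ⟨p1, p2, p3, p4, p5, p6⟩ := h'.order
  have toM (f : L → ℕ) (α β γ δ : L) : Finsupp.toMultiset ((quad α β γ δ).mapDomain f) =
      ([f α, f β, f γ, f δ] : Multiset ℕ) := by
    simp only [quad, Finsupp.mapDomain_add, Finsupp.mapDomain_single, map_add,
      Finsupp.toMultiset_single, one_smul]
    rfl
  have ex : [c.cx α, c.cx β, c.cx γ, c.cx δ] = [c.cx α', c.cx β', c.cx γ', c.cx δ'] := by
    have h1 := congrArg Finsupp.toMultiset e.1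
    rw [toM, toM, Multiset.coe_eq_coe] at h1
    refine List.Perm.eq_of_pairwise' (r := (· ≤ ·)) ?_ ?_ h1 <;>
    simp only [List.pairwise_cons, List.mem_cons, List.not_mem_nil, or_false, forall_eq_or_imp,
      forall_eq, List.Pairwise.nil, and_true, IsEmpty.forall_iff, implies_true] <;> omega
  have ey : [c.cy β, c.cy α, c.cy δ, c.cy γ] = [c.cy β', c.cy α', c.cy δ', c.cy γ'] := by
    have h1 := congrArg Finsupp.toMultiset e.2
    rw [toM, toM, Multiset.coe_eq_coe] at h1
    have sw (a b d e : ℕ) : [b, a, e, d].Perm [a, b, d, e] :=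
      (List.Perm.swap a b _).trans (((List.Perm.swap d e []).cons b).cons a)
    refine List.Perm.eq_of_pairwise' (r := (· ≤ ·)) ?_ ?_
      ((sw _ _ _ _).trans (h1.trans (sw _ _ _ _).symm)) <;>
    simp only [List.pairwise_cons, List.mem_cons, List.not_mem_nil, or_false, forall_eq_or_imp,
      forall_eq, List.Pairwise.nil, and_true, IsEmpty.forall_iff, implies_true] <;> omega
  simp only [List.cons.injEq, and_true] at ex ey
  exact ⟨c.ext' ex.1 ey.2.1, c.ext' ex.2.1 ey.1, c.ext' ex.2.2.1 ey.2.2.2,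
    c.ext' ex.2.2.2 ey.2.2.1⟩

variable (c) (K : Type*) [Field K]

open Classical in
/-- The functional of a pair of diamonds of diamond type: it counts the terms in the fibre at which
the lower end of the fibre enters while the upper end is absent. -/
noncomputable def diamondFun (α β γ δ : L) (u : L →₀ ℕ) (q : c.Dia) : K :=
  if c.SameDeg (u + c.src q) (quad α β γ δ) ∧ q.1.1 ⊓ q.1.2 = α ⊓ β ∧ u (γ ⊔ δ) = 0 then 1 else 0

end PlanarCoords

/-! ### The diamond type functionals are cocycles -/

namespace PlanarCoords

variable {L : Type*} [Lattice L] {c : PlanarCoords L} {K : Type*} [Field K]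

/-- A diamond with meet `α ⊓ β` already has one factor in the leftmost column and one in the bottom
row, and the multidegree allows no second. -/
theorem IsLeftDiamondType.fun_eq_zero_of_lower {α β γ δ : L} (h : c.IsLeftDiamondType α β γ δ)
    {v : L} (hv : c.cx v = c.cx α ∨ c.cy v = c.cy β) (u : L →₀ ℕ) (q : c.Dia) :
    c.diamondFun K α β γ δ (Finsupp.single v 1 + u) q = 0 := by
  classical
  obtain ⟨o1, o2, o3, o4, o5, o6⟩ := h.order
  rw [diamondFun, if_neg]
  rintro ⟨hw, hp, -⟩
  obtain ⟨⟨x, y⟩, l1, l2⟩ := q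
  simp only at hp l1 l2
  have hx := congrArg c.cx hp
  have hy := congrArg c.cy hp
  rw [c.cx_inf, c.cx_inf] at hx
  rw [c.cy_inf, c.cy_inf] at hy
  have e : Finsupp.single v 1 + u + c.src ⟨(x, y), l1, l2⟩ =
      u + (Finsupp.single v 1 + Finsupp.single x 1 + Finsupp.single y 1) := by
    rw [src]; abel
  rw [e] at hw
  rcases hv with hv | hv
  · have := Finsupp.two_le_mapDomain (f := c.cx) (i := c.cx α)
      ((le_self_add (b := Finsupp.single y 1)).trans le_add_self : Finsupp.single v 1 +
        Finsupp.single x 1 ≤ u + (Finsupp.single v 1 + Finsupp.single x 1 + Finsupp.single y 1))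
      hv (by omega)
    rw [hw.cx_apply] at this
    split_ifs at this <;> omega
  · have h1 : Finsupp.single v 1 + Finsupp.single y 1 ≤
        u + (Finsupp.single v 1 + Finsupp.single x 1 + Finsupp.single y 1) := by
      rw [add_right_comm (Finsupp.single v 1)]
      exact le_self_add.trans le_add_self
    have := Finsupp.two_le_mapDomain (f := c.cy) (i := c.cy β) h1 hv (by omega)
    rw [hw.cy_apply] at this
    split_ifs at this <;> omega

/-- Let `x` be the left element of the diamond and `z` a factor in the rightmost column. The corner
lemmas and the absence of `γ ⊔ δ` keep `v`, `x`, `z` off the bottom and top rows, so three factors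
compete for the two places in the rows of `α` and `δ`. -/
theorem IsLeftDiamondType.fun_eq_zero_of_middle {α β γ δ : L} (h : c.IsLeftDiamondType α β γ δ)
    {v : L} (hv1 : c.cx v ≠ c.cx α) (hv2 : c.cy v ≠ c.cy β) (hv3 : c.cx v ≠ c.cx δ)
    (hv4 : c.cy v ≠ c.cy γ) (u : L →₀ ℕ) (q : c.Dia) :
    c.diamondFun K α β γ δ (Finsupp.single v 1 + u) q = 0 := by
  classical
  obtain ⟨o1, o2, o3, o4, o5, o6⟩ := h.order
  rw [diamondFun, if_neg]
  rintro ⟨hw, hp, ht⟩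
  obtain ⟨⟨x, y⟩, l1, l2⟩ := q
  simp only at hp l1 l2
  have hpx := congrArg c.cx hp
  have hpy := congrArg c.cy hp
  rw [c.cx_inf, c.cx_inf] at hpx
  rw [c.cy_inf, c.cy_inf] at hpy
  set w := Finsupp.single v 1 + u + c.src ⟨(x, y), l1, l2⟩ with hwdef
  have wv : w v ≠ 0 := by simp [hwdef]
  have wx : w x ≠ 0 := by simp [hwdef, src]
  obtain ⟨z, wz, hz⟩ := Finsupp.exists_of_mapDomain_ne_zero (f := c.cx) (w := w) (i := c.cx δ)
    (by rw [hw.cx_apply]; simp)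
  have hx4 := h.upper_left hw wx (by omega)
  have hz1 : c.cy z ≠ c.cy β := fun e => h.lower_right hw wz e hz
  have hz4 : c.cy z ≠ c.cy γ := by
    intro e
    have hzt : z = γ ⊔ δ := by
      refine c.ext' ?_ ?_ <;> simp only [c.cx_sup, c.cy_sup] <;> omega
    rw [hwdef, Finsupp.add_apply, hzt, ht, zero_add, ← hzt] at wz
    have : z = x ∨ z = y := by
      by_contra hcon
      rw [not_or] at hcon
      apply wz
      simp [src, hcon.1, hcon.2]
    rcases this with rfl | rfl <;> omega
  have hvx : v ≠ x := by rintro rfl; omega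
  have hvz : v ≠ z := by rintro rfl; omega
  have hxz : x ≠ z := by rintro rfl; omega
  have hle := three_le hvx hvz hxz (by omega) (by omega : 1 ≤ w x) (by omega)
  have hle' := Finsupp.mapDomain_mono (f := c.cy) hle
  have k1 := hle' (c.cy α)
  have k2 := hle' (c.cy δ)
  rw [hw.cy_apply] at k1 k2
  simp only [Finsupp.mapDomain_add, Finsupp.mapDomain_single, Finsupp.add_apply,
    Finsupp.single_apply] at k1 k2
  have mv := hw.cy_mem wv
  have mx := hw.cy_mem wx
  have mz := hw.cy_mem wz
  have mv' : c.cy v = c.cy α ∨ c.cy v = c.cy δ := by omega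
  have mx' : c.cy x = c.cy α ∨ c.cy x = c.cy δ := by omega
  have mz' : c.cy z = c.cy α ∨ c.cy z = c.cy δ := by omega
  rw [if_neg (by omega : ¬ c.cy β = c.cy α), if_neg (by omega : ¬ c.cy γ = c.cy α)] at k1
  rw [if_neg (by omega : ¬ c.cy β = c.cy δ), if_neg (by omega : ¬ c.cy γ = c.cy δ)] at k2
  rcases mv' with e1 | e1 <;> rcases mx' with e2 | e2 <;> rcases mz' with e3 | e3 <;>
    rw [e1, e2, e3] at k1 k2 <;> split_ifs at k1 k2 <;> omega

theorem IsLeftDiamondType.fun_coboundary_of_upper {α β γ δ : L}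
    (h : c.IsLeftDiamondType α β γ δ) {v : L} (hv : c.cx v = c.cx δ ∨ c.cy v = c.cy γ)
    (hvt : v ≠ γ ⊔ δ) : ∃ μ : (L →₀ ℕ) → K, ∀ u p,
      c.diamondFun K α β γ δ (Finsupp.single v 1 + u) p = μ (u + c.src p) - μ (u + c.tgt p) := by
  classical
  obtain ⟨o1, o2, o3, o4, o5, o6⟩ := h.order
  -- Now `v` uses up the last column or row, so `γ ⊔ δ` cannot occur, and the functional only asks
  -- whether passing from `src` to `tgt` creates the factor `α ⊓ β`. Minus the indicator of this
  -- factor is therefore a potential.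
  refine ⟨fun w => if c.SameDeg (Finsupp.single v 1 + w) (quad α β γ δ) ∧ w (α ⊓ β) ≠ 0 then -1
    else 0, fun u q => ?_⟩
  have hst : c.SameDeg (Finsupp.single v 1 + (u + c.src q)) (quad α β γ δ) ↔
      c.SameDeg (Finsupp.single v 1 + (u + c.tgt q)) (quad α β γ δ) := by
    have := ((sameDeg_src_tgt q).add_left u).add_left (Finsupp.single v 1)
    exact ⟨fun h => this.symm.trans h, fun h => this.trans h⟩
  by_cases hw : c.SameDeg (Finsupp.single v 1 + (u + c.src q)) (quad α β γ δ)
  swap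
  · have hw' := mt hst.2 hw
    simp only [diamondFun, add_assoc, hw, hw', false_and, if_false, sub_zero]
  simp only [diamondFun, add_assoc, hw, hst.1 hw, true_and]
  obtain ⟨⟨x, y⟩, l1, l2⟩ := q
  simp only at l1 l2
  set w := Finsupp.single v 1 + (u + c.src ⟨(x, y), l1, l2⟩) with hwdef
  have wx : w x ≠ 0 := by simp [hwdef, src]
  have wy : w y ≠ 0 := by simp [hwdef, src]
  have mx := hw.cx_mem wx
  have my := hw.cx_mem wy
  have nx := hw.cy_mem wx
  have ny := hw.cy_mem wy
  have hpx : c.cx (α ⊓ β) = c.cx α := by rw [c.cx_inf]; omega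
  have hpy : c.cy (α ⊓ β) = c.cy β := by rw [c.cy_inf]; omega
  have hsrc : c.src ⟨(x, y), l1, l2⟩ (α ⊓ β) = 0 := by
    have h1 : x ≠ α ⊓ β := by rintro rfl; omega
    have h2 : y ≠ α ⊓ β := by rintro rfl; omega
    simp [src, h1.symm, h2.symm]
  have hsup : x ⊔ y ≠ α ⊓ β := by
    intro e
    have := congrArg c.cx e
    rw [c.cx_sup, hpx] at this
    omega
  have htgt : c.tgt ⟨(x, y), l1, l2⟩ (α ⊓ β) ≠ 0 ↔ x ⊓ y = α ⊓ β := by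
    simp [tgt, Finsupp.single_apply, hsup]
  have hut : (Finsupp.single v 1 + u : L →₀ ℕ) (γ ⊔ δ) = 0 := by
    by_contra hne
    rw [Finsupp.add_apply, Finsupp.single_apply, if_neg hvt, zero_add] at hne
    have h1 : Finsupp.single (γ ⊔ δ) 1 ≤ u := by rw [Finsupp.single_le_iff]; omega
    have h2 : Finsupp.single v 1 + Finsupp.single (γ ⊔ δ) 1 ≤ w :=
      add_le_add_right (h1.trans le_self_add) _
    rcases hv with hv | hv
    · have := Finsupp.two_le_mapDomain (f := c.cx) h2 hv (by rw [c.cx_sup]; omega)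
      rw [hw.cx_apply] at this
      split_ifs at this <;> omega
    · have := Finsupp.two_le_mapDomain (f := c.cy) h2 hv (by rw [c.cy_sup]; omega)
      rw [hw.cy_apply] at this
      split_ifs at this <;> omega
  have hup : x ⊓ y = α ⊓ β → u (α ⊓ β) = 0 := by
    intro e
    by_contra hne
    have h1 : Finsupp.single (α ⊓ β) 1 ≤ u := by rw [Finsupp.single_le_iff]; omega
    have h2 : Finsupp.single (α ⊓ β) 1 + Finsupp.single x 1 ≤ w :=
      (add_le_add h1 le_self_add).trans le_add_self
    have e' := congrArg c.cx e
    rw [c.cx_inf, hpx] at e'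
    have := Finsupp.two_le_mapDomain (f := c.cx) h2 hpx (by omega)
    rw [hw.cx_apply] at this
    split_ifs at this <;> omega
  rw [hut]
  simp only [and_true, Finsupp.add_apply, hsrc, add_zero]
  by_cases e : x ⊓ y = α ⊓ β
  · have := htgt.2 e
    simp [e, hup e, this]
  · have : c.tgt ⟨(x, y), l1, l2⟩ (α ⊓ β) = 0 := by
      by_contra h'; exact e (htgt.1 h')
    simp [e, this]

/-- The cases for `v` are the four outer lines of the configuration and its interior. For `v = γ ⊔
δ` the value is zero by the last condition in `diamondFun`. -/
theorem diamondFun_isCocycle {α β γ δ : L} (h : c.IsLeftDiamondType α β γ δ) :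
    IsCocycle (c.diamondFun K α β γ δ) := by
  classical
  intro v
  by_cases h1 : c.cx v = c.cx α ∨ c.cy v = c.cy β
  · exact ⟨0, fun u q => by simpa using h.fun_eq_zero_of_lower h1 u q⟩
  by_cases h2 : v = γ ⊔ δ
  · refine ⟨0, fun u q => ?_⟩
    rw [diamondFun, if_neg]
    · simp
    · rintro ⟨-, -, h3⟩
      simp [h2] at h3
  by_cases h3 : c.cx v = c.cx δ ∨ c.cy v = c.cy γ
  · exact h.fun_coboundary_of_upper h3 h2
  rw [not_or] at h1 h3
  exact ⟨0, fun u q => by simpa using h.fun_eq_zero_of_middle h1.1 h1.2 h3.1 h3.2 u q⟩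

theorem diamondFun_of_degree_ne {α β γ δ a b : L} {u : L →₀ ℕ} (hu : u.degree ≠ 2) :
    functional (c.diamondFun K α β γ δ) ((monomial u 1 : MvPolynomial L K) • c.gen K a b) = 0 := by
  refine functional_monomial_smul_gen (fun q _ => if_neg ?_) fun _ => rfl
  rintro ⟨h, -⟩
  have := h.degree_eq
  simp only [quad, src, map_add, Finsupp.degree_single] at this
  omega

theorem diamondFun_X_smul_gen (α β γ δ x a b : L) :
    functional (c.diamondFun K α β γ δ) ((X x : MvPolynomial L K) • c.gen K a b) = 0 :=
  diamondFun_of_degree_ne (by simp)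

theorem diamondFun_diamondSyz {α β γ δ a b a' b' : L} (h : c.IsLeftDiamondType α β γ δ)
    (h' : c.IsLeftDiamondType a b a' b')
    (hne : functional (c.diamondFun K α β γ δ) (c.diamondSyz K a b a' b') ≠ 0) :
    (α, β, γ, δ) = (a, b, a', b') := by
  by_contra hcon
  apply hne
  have key : ¬ c.SameDeg (quad a b a' b') (quad α β γ δ) := by
    intro e
    obtain ⟨rfl, rfl, rfl, rfl⟩ := quad_injective h' h e
    exact hcon rfl
  have s1 := sameDeg_src_tgt (c := c) ⟨(a, b), h'.2.1⟩
  have s2 := sameDeg_src_tgt (c := c) ⟨(a', b'), h'.2.2⟩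
  rw [diamondSyz_eq_monomials, gen_of_left h'.2.1, gen_of_left h'.2.2]
  simp only [map_sub, Finsupp.smul_single, smul_eq_mul, mul_one, functional_single, diamondFun]
  rw [if_neg, if_neg, if_neg, if_neg]
  · simp
  · rintro ⟨e, -⟩
    refine key (SameDeg.trans ?_ e)
    rw [add_comm]
    have := s1.add_left (c.src ⟨(a', b'), h'.2.2⟩)
    rwa [add_comm] at this
  · rintro ⟨e, -⟩
    exact key e
  · rintro ⟨e, -⟩
    refine key (SameDeg.trans ?_ e)
    rw [add_comm]
    exact s2.add_left (c.src ⟨(a, b), h'.2.1⟩)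
  · rintro ⟨e, -⟩
    rw [add_comm] at e
    exact key e

/-- Of the four terms only `x_γ x_δ g_(α,β)` counts: one of the others contains `γ ⊔ δ`, and two
belong to a diamond with the wrong meet. -/
theorem diamondFun_self {α β γ δ : L} (h : c.IsLeftDiamondType α β γ δ) :
    functional (c.diamondFun K α β γ δ) (c.diamondSyz K α β γ δ) = 1 := by
  obtain ⟨o1, o2, o3, o4, o5, o6⟩ := h.order
  have hp : γ ⊓ δ ≠ α ⊓ β := by
    intro e
    have := congrArg c.cx e
    rw [c.cx_inf, c.cx_inf] at this
    omega
  have n1 : γ ≠ γ ⊔ δ := by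
    intro e
    have := congrArg c.cx e
    rw [c.cx_sup] at this
    omega
  have n2 : δ ≠ γ ⊔ δ := by
    intro e
    have := congrArg c.cy e
    rw [c.cy_sup] at this
    omega
  rw [diamondSyz_eq_monomials, gen_of_left h.2.1, gen_of_left h.2.2]
  simp only [map_sub, Finsupp.smul_single, smul_eq_mul, mul_one, functional_single, diamondFun]
  rw [if_pos, if_neg, if_neg, if_neg]
  · simp
  · rintro ⟨-, e, -⟩; exact hp e
  · rintro ⟨-, e, -⟩; exact hp e
  · rintro ⟨-, -, e⟩
    simp at e
  · refine ⟨?_, rfl, ?_⟩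
    · rw [add_comm]; exact ⟨rfl, rfl⟩
    · simp [n1.symm, n2.symm]

end PlanarCoords

/-! ### The first Betti number -/

namespace PlanarCoords

section
variable {L : Type*} [Lattice L] (c : PlanarCoords L)

theorem not_isBox_of_isFork {α β γ : L} (h : IsFork α β γ) : ¬ IsBox α β γ :=
  fun h' => h'.2.2.2.2.1.1 h.2.2.le

/-- The generating family gives the upper bound and the triangular family of functionals the lower
one. The cubic types and the diamond type do not interact, because their coefficients have degrees
`1` and `2`. -/
theorem spanFinrank_ker_bd (K : Type*) [Field K] [Finite L] :
    (LinearMap.ker (c.bd K)).spanFinrank = Nat.card c.GenIdx := by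
  refine le_antisymm ?_ ?_
  · rw [ker_bd_eq, genSpan]
    refine (Submodule.spanFinrank_span_le_ncard_of_finite (Set.finite_range _)).trans ?_
    rw [← Set.image_univ, ← Set.ncard_univ]
    exact Set.ncard_image_le Set.finite_univ
  · have hfg : (LinearMap.ker (c.bd K)).FG := by
      rw [ker_bd_eq]; exact Submodule.fg_span (Set.finite_range _)
    have hform (t : L × L × L) (h : IsFork t.1 t.2.1 t.2.2 ∨ IsBox t.1 t.2.1 t.2.2) :
        t.2.1 ≠ t.2.2 ∧ Incomp t.1 t.2.1 :=
      h.elim (fun h => ⟨h.2.2.ne, h.1⟩) fun h => ⟨h.2.2.2.2.1.ne, h.1⟩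
    have hshape {t : L × L × L} (h : IsFork t.1 t.2.1 t.2.2) :=
      shapeSyz_lower (c := c) (K := K) h.1 h.2.1
    have hbox {t : L × L × L} (h : IsBox t.1 t.2.1 t.2.2) :=
      boxSyz_lower (c := c) (K := K) h.1 h.2.2.2.2.1 h.2.2.2.2.2.1 h.2.2.2.2.2.2.1
    refine card_le_spanFinrank hfg (c.genSyz K) (fun t => bd_genSyz t)
      (fun
        | .inl t => c.forkFun K t.1.1 t.1.2.1 t.1.2.2
        | .inr (.inl t) => c.forkFun K t.1.1 t.1.2.1 t.1.2.2
        | .inr (.inr t) => c.diamondFun K t.1.1 t.1.2.1 t.1.2.2.1 t.1.2.2.2) ?_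
      (fun
        | .inl t => c.wt t.1.1 + c.wt t.1.2.1 + c.wt t.1.2.2
        | .inr (.inl t) => c.wt t.1.1 + c.wt t.1.2.1 + c.wt t.1.2.2
        | .inr (.inr _) => 0) ?_ ?_
    · rintro (t | t | t)
      · exact forkFun_isCocycle t.2.1 _
      · exact forkFun_isCocycle t.2.1 _
      · exact diamondFun_isCocycle t.2
    · rintro (t | t | t)
      · refine ne_of_eq_of_ne (forkFun_self t.2.1 t.2.2.2.ne (hshape t.2)) one_ne_zero
      · refine ne_of_eq_of_ne (forkFun_self t.2.1 t.2.2.2.2.2.1.ne (hbox t.2)) one_ne_zero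
      · refine ne_of_eq_of_ne (diamondFun_self t.2) one_ne_zero
    · rintro (t | t | t) (t' | t' | t') hne <;> simp only [genSyz] at hne ⊢
      · refine or_iff_not_imp_right.2 fun hW => ?_
        have := c.fork_or_box_unique (.inl t.2) (.inl t'.2)
          (forkFun_leading t.2.1 (not_lt.1 hW) (hshape t'.2) hne)
        exact congrArg _ (Subtype.ext this)
      · refine or_iff_not_imp_right.2 fun hW => ?_
        have := c.fork_or_box_unique (.inl t.2) (.inr t'.2)
          (forkFun_leading t.2.1 (not_lt.1 hW) (hbox t'.2) hne)
        obtain ⟨⟨a, b, d⟩, h⟩ := t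
        obtain ⟨⟨a', b', d'⟩, h'⟩ := t'
        simp only [Prod.mk.injEq] at this
        obtain ⟨rfl, rfl, rfl⟩ := this
        exact absurd h' (not_isBox_of_isFork h)
      · exact absurd (forkFun_diamondSyz _ _ _ _ _ _ _) hne
      · refine or_iff_not_imp_right.2 fun hW => ?_
        have := c.fork_or_box_unique (.inr t.2) (.inl t'.2)
          (forkFun_leading t.2.1 (not_lt.1 hW) (hshape t'.2) hne)
        obtain ⟨⟨a, b, d⟩, h⟩ := t
        obtain ⟨⟨a', b', d'⟩, h'⟩ := t'
        simp only [Prod.mk.injEq] at this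
        obtain ⟨rfl, rfl, rfl⟩ := this
        exact absurd h (not_isBox_of_isFork h')
      · refine or_iff_not_imp_right.2 fun hW => ?_
        have := c.fork_or_box_unique (.inr t.2) (.inr t'.2)
          (forkFun_leading t.2.1 (not_lt.1 hW) (hbox t'.2) hne)
        exact congrArg (Sum.inr ∘ Sum.inl) (Subtype.ext this)
      · exact absurd (forkFun_diamondSyz _ _ _ _ _ _ _) hne
      · refine absurd ?_ hne
        simp only [shapeSyz, map_add, map_sub, diamondFun_X_smul_gen, sub_zero, add_zero]
      · refine absurd ?_ hne
        simp only [boxSyz, map_add, map_sub, diamondFun_X_smul_gen, sub_zero, add_zero]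
      · exact .inl (congrArg (Sum.inr ∘ Sum.inr)
          (Subtype.ext (diamondFun_diamondSyz t.2 t'.2 hne)))

end

/-! ### Counting the generators -/

section
variable {L : Type*} [Lattice L]

/-- For `β < γ` with equal meets the joins differ, by cancellation in a distributive lattice; the
other conditions then follow. -/
theorem isStrip_iff (c : PlanarCoords L) {α β γ : L} : IsStrip α β γ ↔ IsFork α β γ ∧ α ⊓ β = α ⊓ γ := by
  constructor
  · rintro ⟨h1, h2, h3, h4, h5, -⟩
    exact ⟨⟨h1, h2, lt_of_le_of_ne h5 fun e => h3 (e ▸ rfl)⟩, h4⟩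
  · rintro ⟨⟨h1, h2, h3⟩, h4⟩
    have h5 : α ⊔ β ≠ α ⊔ γ := by
      intro h5
      refine h3.ne (c.ext' ?_ ?_)
      · have e1 := congrArg c.cx h4
        have e2 := congrArg c.cx h5
        rw [c.cx_sup, c.cx_sup] at e2
        rw [c.cx_inf, c.cx_inf] at e1
        omega
      · have e1 := congrArg c.cy h4
        have e2 := congrArg c.cy h5
        rw [c.cy_sup, c.cy_sup] at e2
        rw [c.cy_inf, c.cy_inf] at e1
        omega
    refine ⟨h1, h2, h5, h4, h3.le, h3.le.trans le_sup_right, h4 ▸ inf_le_right, ⟨fun h => ?_,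
      fun h => h2.1 (le_sup_left.trans h)⟩, inf_le_right.trans h3.le⟩
    exact h5 (le_antisymm (sup_le_sup_left h3.le _) (sup_le le_sup_left h))

theorem isLShape_iff {α β γ : L} :
    IsLShape α β γ ↔ IsFork α β γ ∧ α ⊓ β ≠ α ⊓ γ ∧ α ⊔ β ≠ α ⊔ γ := by
  constructor
  · rintro ⟨h1, h2, h3, h4, h5, -⟩
    exact ⟨⟨h1, h2, lt_of_le_of_ne h5 fun e => h3 (e ▸ rfl)⟩, h3, h4⟩
  · rintro ⟨⟨h1, h2, h3⟩, h4, h5⟩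
    refine ⟨h1, h2, h4, h5, h3.le, h3.le.trans le_sup_right,
      ⟨fun h => h1.2 (h.trans inf_le_left), fun h => ?_⟩,
      ⟨fun h => ?_, fun h => h2.1 (le_sup_left.trans h)⟩, inf_le_right.trans h3.le⟩
    · exact h4 (le_antisymm (inf_le_inf_left _ h3.le) (le_inf inf_le_left h))
    · exact h5 (le_antisymm (sup_le_sup_left h3.le _) (sup_le le_sup_left h))

/-- Every product of a 2-chain and a 3-chain contains one fork with a common join and one with a
common meet. The map takes the first, `(α, β, γ)`, to the second, `(β, α ⊓ γ, α)`. -/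
theorem ncard_isStrip_dual (c : PlanarCoords L) :
    {t : L × L × L | IsFork t.1 t.2.1 t.2.2 ∧ t.1 ⊔ t.2.1 = t.1 ⊔ t.2.2}.ncard =
      {t : L × L × L | IsFork t.1 t.2.1 t.2.2 ∧ t.1 ⊓ t.2.1 = t.1 ⊓ t.2.2}.ncard := by
  refine Set.ncard_congr (fun t _ => (t.2.1, t.1 ⊓ t.2.2, t.1)) ?_ ?_ ?_
  · rintro ⟨α, β, γ⟩ ⟨⟨h1, h2, h3⟩, h4⟩
    simp only at h1 h2 h3 h4
    have h5 : α ⊓ γ ⊓ β = α ⊓ β := by rw [inf_assoc, inf_eq_right.2 h3.le]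
    refine ⟨⟨⟨fun h => h1.2 (h.trans inf_le_left), fun h => ?_⟩, h1.symm, inf_lt_left.2 h2.1⟩, ?_⟩
    · have h : α ⊓ γ ≤ β := h
      refine h3.ne (c.ext' ?_ ?_)
      · have e1 := congrArg c.cx h4
        rw [c.le_iff, c.cx_inf, c.cy_inf] at h
        rw [c.cx_sup, c.cx_sup] at e1
        have := (c.le_iff _ _).1 h3.le
        omega
      · have e1 := congrArg c.cy h4
        rw [c.le_iff, c.cx_inf, c.cy_inf] at h
        rw [c.cy_sup, c.cy_sup] at e1
        have := (c.le_iff _ _).1 h3.le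
        omega
    · change β ⊓ (α ⊓ γ) = β ⊓ α
      rw [inf_comm β, h5, inf_comm]
  · rintro ⟨α, β, γ⟩ ⟨α', β', γ'⟩ ⟨-, h⟩ ⟨-, h'⟩ e
    simp only [Prod.mk.injEq] at e h h' ⊢
    obtain ⟨rfl, e, rfl⟩ := e
    have h2 : α ⊔ γ = α ⊔ γ' := h.symm.trans h'
    refine ⟨rfl, rfl, c.ext' ?_ ?_⟩
    · have e1 := congrArg c.cx e
      have e2 := congrArg c.cx h2
      rw [c.cx_inf, c.cx_inf] at e1
      rw [c.cx_sup, c.cx_sup] at e2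
      omega
    · have e1 := congrArg c.cy e
      have e2 := congrArg c.cy h2
      rw [c.cy_inf, c.cy_inf] at e1
      rw [c.cy_sup, c.cy_sup] at e2
      omega
  · rintro ⟨α, β, γ⟩ ⟨⟨h1, h2, h3⟩, h4⟩
    simp only at h1 h2 h3 h4
    have hβ : γ ⊓ (α ⊔ β) = β := by
      have k1 := congrArg c.cx h4
      have k2 := congrArg c.cy h4
      have k3 := (c.le_iff _ _).1 h3.le
      rw [c.cx_inf, c.cx_inf] at k1
      rw [c.cy_inf, c.cy_inf] at k2
      refine c.ext' ?_ ?_ <;> simp only [c.cx_inf, c.cx_sup, c.cy_inf, c.cy_sup] <;> omega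
    refine ⟨(γ, α, α ⊔ β), ⟨⟨h2.symm, ⟨fun h => ?_, fun h => h2.1 (le_sup_left.trans h)⟩,
      left_lt_sup.2 h1.2⟩, ?_⟩, ?_⟩
    · rw [inf_eq_left.2 h] at hβ
      exact h3.ne hβ.symm
    · change γ ⊔ α = γ ⊔ (α ⊔ β)
      rw [sup_comm α, ← sup_assoc, sup_eq_left.2 h3.le]
    · simp only [hβ]

/-- A fork has equal meets, equal joins or neither. The first two kinds are equinumerous, which is
the factor two in `numStrip`; the third kind are the L-shapes. -/
theorem ncard_isFork [Finite L] (c : PlanarCoords L) :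
    {t : L × L × L | IsFork t.1 t.2.1 t.2.2}.ncard = numStrip L + numLShape L := by
  have h1 : {t : L × L × L | IsFork t.1 t.2.1 t.2.2} =
      ({t | IsFork t.1 t.2.1 t.2.2 ∧ t.1 ⊓ t.2.1 = t.1 ⊓ t.2.2} ∪
      {t | IsFork t.1 t.2.1 t.2.2 ∧ t.1 ⊔ t.2.1 = t.1 ⊔ t.2.2}) ∪
      {t | IsLShape t.1 t.2.1 t.2.2} := by
    ext t
    simp only [Set.mem_union, Set.mem_ofPred_eq, isLShape_iff]
    tauto
  have h2 : {t : L × L × L | IsStrip t.1 t.2.1 t.2.2} =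
      {t | IsFork t.1 t.2.1 t.2.2 ∧ t.1 ⊓ t.2.1 = t.1 ⊓ t.2.2} := by
    ext t; exact c.isStrip_iff
  rw [h1, Set.ncard_union_eq _ (Set.toFinite _) (Set.toFinite _),
    Set.ncard_union_eq _ (Set.toFinite _) (Set.toFinite _), c.ncard_isStrip_dual, ← h2, numStrip,
    numLShape, two_mul]
  · rw [← h2, Set.disjoint_left]
    rintro t ht ⟨-, ht'⟩
    exact ht.2.2.1 ht'
  · rw [Set.disjoint_left]
    rintro t (⟨-, ht⟩ | ⟨-, ht⟩) ht'
    · exact (isLShape_iff.1 ht').2.1 ht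
    · exact (isLShape_iff.1 ht').2.2 ht

/-- The antichain of a box can be read from left to right or from right to left, which is the factor
two in `numBox`. -/
theorem ncard_isBox [Finite L] (c : PlanarCoords L) :
    {t : L × L × L | IsBox t.1 t.2.1 t.2.2}.ncard = numBox L := by
  have hl : {p : Sym2 L × L | ∃ α β₁ β₂ : L, IsBox α β₁ β₂ ∧ p = (s(α, β₂), β₁)} =
      (fun t : L × L × L => (s(t.1, t.2.2), t.2.1)) ''
        {t | c.Left t.1 t.2.1 ∧ c.Left t.2.1 t.2.2} := by
    ext p
    simp only [Set.mem_ofPred_eq, Set.mem_image, Prod.exists, c.isBox_iff]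
    constructor
    · rintro ⟨α, β, γ, h | h, rfl⟩
      · exact ⟨α, β, γ, h, rfl⟩
      · exact ⟨γ, β, α, h, by rw [Sym2.eq_swap]⟩
    · rintro ⟨α, β, γ, h, rfl⟩
      exact ⟨α, β, γ, .inl h, rfl⟩
  have hinj : Set.InjOn (fun t : L × L × L => (s(t.1, t.2.2), t.2.1))
      {t | c.Left t.1 t.2.1 ∧ c.Left t.2.1 t.2.2} := by
    rintro ⟨α, β, γ⟩ ⟨h1, h2⟩ ⟨α', β', γ'⟩ ⟨h3, h4⟩ e
    simp only [Prod.mk.injEq, Sym2.eq_iff] at e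
    obtain ⟨⟨rfl, rfl⟩ | ⟨rfl, rfl⟩, rfl⟩ := e
    · rfl
    · exact absurd h1 h4.asymm
  have hrev : {t : L × L × L | c.Left t.2.2 t.2.1 ∧ c.Left t.2.1 t.1} =
      (fun t : L × L × L => (t.2.2, t.2.1, t.1)) ''
        {t | c.Left t.1 t.2.1 ∧ c.Left t.2.1 t.2.2} := by
    ext ⟨α, β, γ⟩
    simp only [Set.mem_ofPred_eq, Set.mem_image, Prod.exists, Prod.mk.injEq]
    constructor
    · intro h; exact ⟨γ, β, α, h, rfl, rfl, rfl⟩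
    · rintro ⟨_, _, _, h, rfl, rfl, rfl⟩; exact h
  have hsplit : {t : L × L × L | IsBox t.1 t.2.1 t.2.2} =
      {t | c.Left t.1 t.2.1 ∧ c.Left t.2.1 t.2.2} ∪
      {t | c.Left t.2.2 t.2.1 ∧ c.Left t.2.1 t.1} := by
    ext t; exact c.isBox_iff
  rw [numBox, hl, hinj.ncard_image, hsplit,
    Set.ncard_union_eq _ (Set.toFinite _) (Set.toFinite _), hrev, Set.ncard_image_of_injective,
    two_mul]
  · rintro ⟨α, β, γ⟩ ⟨α', β', γ'⟩ e
    simp only [Prod.mk.injEq] at e ⊢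
    tauto
  · rw [Set.disjoint_left]
    rintro t ⟨h, -⟩ ⟨-, h'⟩
    exact h.asymm h'

theorem ncard_isLeftDiamondType (c : PlanarCoords L) :
    {t : L × L × L × L | IsDiamondType t.1 t.2.1 t.2.2.1 t.2.2.2 ∧ c.Left t.1 t.2.1 ∧
      c.Left t.2.2.1 t.2.2.2}.ncard = numDiamond L := by
  have himg : {p : Sym2 L × Sym2 L | ∃ α₁ β₁ α₂ β₂ : L,
      IsDiamondType α₁ β₁ α₂ β₂ ∧ p = (s(α₁, β₁), s(α₂, β₂))} =
      (fun t : L × L × L × L => (s(t.1, t.2.1), s(t.2.2.1, t.2.2.2))) ''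
      {t | IsDiamondType t.1 t.2.1 t.2.2.1 t.2.2.2 ∧ c.Left t.1 t.2.1 ∧
        c.Left t.2.2.1 t.2.2.2} := by
    ext p
    simp only [Set.mem_ofPred_eq, Set.mem_image, Prod.exists]
    constructor
    · rintro ⟨α, β, γ, δ, h, rfl⟩
      rcases c.incomp_iff.1 h.1 with l | l <;> rcases c.incomp_iff.1 h.2.1 with l' | l'
      · exact ⟨α, β, γ, δ, ⟨h, l, l'⟩, rfl⟩
      · exact ⟨α, β, δ, γ, ⟨isDiamondType_swap_right h, l, l'⟩, by rw [Sym2.eq_swap (a := δ)]⟩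
      · exact ⟨β, α, γ, δ, ⟨isDiamondType_swap_left h, l, l'⟩, by rw [Sym2.eq_swap (a := β)]⟩
      · exact ⟨β, α, δ, γ, ⟨isDiamondType_swap_right (isDiamondType_swap_left h), l, l'⟩, by
          rw [Sym2.eq_swap (a := β), Sym2.eq_swap (a := δ)]⟩
    · rintro ⟨α, β, γ, δ, h, rfl⟩
      exact ⟨α, β, γ, δ, h.1, rfl⟩
  rw [numDiamond, himg, Set.InjOn.ncard_image]
  rintro ⟨α, β, γ, δ⟩ ⟨-, h1, h2⟩ ⟨α', β', γ', δ'⟩ ⟨-, h3, h4⟩ e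
  simp only [Prod.mk.injEq, Sym2.eq_iff] at e
  obtain ⟨⟨rfl, rfl⟩ | ⟨rfl, rfl⟩, ⟨rfl, rfl⟩ | ⟨rfl, rfl⟩⟩ := e
  · rfl
  · exact absurd h2 h4.asymm
  · exact absurd h1 h3.asymm
  · exact absurd h1 h3.asymm

/-- The first Betti number is the number of generators of the four types. -/
theorem firstBetti_eq_count [Finite L] (c : PlanarCoords L) (K : Type*) [Field K] :
    firstBetti K L = numStrip L + numLShape L + numBox L + numDiamond L := by
  rw [c.firstBetti_eq K, c.spanFinrank_ker_bd K, GenIdx, Nat.card_sum, Nat.card_sum,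
    ← c.ncard_isFork, ← c.ncard_isBox, ← c.ncard_isLeftDiamondType, ← add_assoc]
  simp only [← Nat.card_coe_set_eq, Set.coe_ofPred]

end

end PlanarCoords

end

/-! ### Heights in finite modular lattices -/

/-- Makes heights finite, so that `ht` loses nothing in passing to `ℕ`. -/
theorem Order.height_le_ncard_Iio {P : Type*} [PartialOrder P] [Finite P] (x : P) :
    Order.height x ≤ (Set.Iio x).ncard := by
  induction x using WellFoundedLT.induction with
  | ind x ih =>
    rw [Order.height_eq_iSup_lt_height]
    refine iSup₂_le fun z hz => ?_
    refine (add_le_add_left (ih z hz) 1).trans ?_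
    have h : (Set.Iio z).ncard < (Set.Iio x).ncard :=
      Set.ncard_lt_ncard (Set.Iio_ssubset_Iio hz) (Set.toFinite _)
    exact_mod_cast h

theorem Order.height_ne_top {P : Type*} [PartialOrder P] [Finite P] (x : P) :
    Order.height x ≠ ⊤ :=
  ne_top_of_le_ne_top (ENat.natCast_ne_top _) (Order.height_le_ncard_Iio x)

theorem ht_mono {L : Type*} [Lattice L] [Finite L] {x y : L} (h : x ≤ y) : ht x ≤ ht y :=
  ENat.toNat_le_toNat (Order.height_mono h) (Order.height_ne_top y)

section
variable {L : Type*} [Lattice L] [IsModularLattice L] [Finite L]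

/-- The Jordan–Dedekind argument: two distinct lower covers of `y` join to `y`, so by modularity
both cover their meet, and by induction both have height one more than it. -/
theorem Order.height_eq_of_covBy_of_covBy (y : L) :
    ∀ x z : L, x ⋖ y → z ⋖ y → Order.height x = Order.height z := by
  induction y using WellFoundedLT.induction with
  | ind y ih =>
    have key : ∀ y' < y, ∀ x, x ⋖ y' → Order.height y' = Order.height x + 1 := by
      intro y' hy' x hx
      refine le_antisymm ?_ (Order.height_add_one_le hx.lt)
      rw [Order.height_eq_iSup_lt_height]
      refine iSup₂_le fun z hz => ?_
      obtain ⟨z', hzz', hz'⟩ := exists_le_covBy_of_lt hz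
      rw [ih y' hy' x z' hx hz']
      gcongr
    intro x z hx hz
    by_cases hxz : x = z
    · rw [hxz]
    have hsup : x ⊔ z = y := by
      refine le_antisymm (sup_le hx.le hz.le) ?_
      by_contra hlt
      have h1 : x ⊔ z < y := lt_of_le_not_ge (sup_le hx.le hz.le) hlt
      have h2 : x ⊔ z = x := by
        by_contra hne
        exact hx.2 (lt_of_le_of_ne le_sup_left (Ne.symm hne)) h1
      have h3 : x ⊔ z = z := by
        by_contra hne
        exact hz.2 (lt_of_le_of_ne le_sup_right (Ne.symm hne)) h1
      exact hxz (h2.symm.trans h3)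
    rw [key x hx.lt (x ⊓ z) (inf_covBy_of_covBy_sup_right (by rwa [hsup])),
      key z hz.lt (x ⊓ z) (inf_covBy_of_covBy_sup_left (by rwa [hsup]))]

theorem Order.height_covBy {x y : L} (h : x ⋖ y) : Order.height y = Order.height x + 1 := by
  refine le_antisymm ?_ (Order.height_add_one_le h.lt)
  rw [Order.height_eq_iSup_lt_height]
  refine iSup₂_le fun z hz => ?_
  obtain ⟨z', hzz', hz'⟩ := exists_le_covBy_of_lt hz
  rw [Order.height_eq_of_covBy_of_covBy y x z' h hz']
  gcongr

theorem ht_covBy {x y : L} (h : x ⋖ y) : ht y = ht x + 1 := by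
  unfold ht
  rw [Order.height_covBy h, ENat.toNat_add (Order.height_ne_top x) (by simp)]
  rfl

/-- The number of elements of an interval that is a chain. -/
theorem ncard_Icc_of_chain {u x : L} (h : u ≤ x)
    (hc : ∀ y z, u ≤ y → y ≤ x → u ≤ z → z ≤ x → y ≤ z ∨ z ≤ y) :
    (Set.Icc u x).ncard = ht x - ht u + 1 := by
  suffices (Set.Icc u x).ncard + ht u = ht x + 1 by
    have := ht_mono h
    omega
  induction x using WellFoundedLT.induction with
  | ind x ih =>
    rcases h.eq_or_lt with rfl | hlt
    · simp [add_comm]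
    · obtain ⟨y, huy, hy⟩ := exists_le_covBy_of_lt hlt
      have h1 : Set.Icc u x = insert x (Set.Icc u y) := by
        ext z
        simp only [Set.mem_Icc, Set.mem_insert_iff]
        constructor
        · rintro ⟨h1, h2⟩
          rcases hc y z huy hy.le h1 h2 with h3 | h3
          · rcases hy.eq_or_eq h3 h2 with rfl | rfl
            · exact .inr ⟨h1, le_rfl⟩
            · exact .inl rfl
          · exact .inr ⟨h1, h3⟩
        · rintro (rfl | ⟨h1, h2⟩)
          · exact ⟨h, le_rfl⟩
          · exact ⟨h1, h2.trans hy.le⟩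
      have h2 := ih y hy.lt huy fun z z' h1 h2 h3 h4 => hc z z' h1 (h2.trans hy.le) h3
        (h4.trans hy.le)
      have h3 : x ∉ Set.Icc u y := fun h => hy.lt.not_ge h.2
      rw [h1, Set.ncard_insert_of_notMem h3 (Set.toFinite _), ht_covBy hy]
      omega

end

/-! ### Increasing pairs and triples -/

/-- The increasing pairs of elements of a finite set of numbers. -/
def incPairs (s : Finset ℕ) : Finset (ℕ × ℕ) := {p ∈ s ×ˢ s | p.1 < p.2}

/-- The increasing triples of elements of a finite set of numbers. -/
def incTriples (s : Finset ℕ) : Finset (ℕ × ℕ × ℕ) :=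
  {p ∈ s ×ˢ s ×ˢ s | p.1 < p.2.1 ∧ p.2.1 < p.2.2}

theorem mem_incPairs {s : Finset ℕ} {a b : ℕ} :
    (a, b) ∈ incPairs s ↔ a ∈ s ∧ b ∈ s ∧ a < b := by
  simp [incPairs, and_assoc]

theorem mem_incTriples {s : Finset ℕ} {a b d : ℕ} :
    (a, b, d) ∈ incTriples s ↔ a ∈ s ∧ b ∈ s ∧ d ∈ s ∧ a < b ∧ b < d := by
  simp [incTriples, and_assoc]

theorem card_incPairs (s : Finset ℕ) : (incPairs s).card = s.card.choose 2 := by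
  induction s using Finset.induction_on_max with
  | empty => rfl
  | insert m s hm ih =>
    have hms : m ∉ s := fun h => lt_irrefl _ (hm m h)
    have h1 : incPairs (insert m s) = incPairs s ∪ s.image fun a => (a, m) := by
      ext ⟨a, b⟩
      simp only [Finset.mem_union, mem_incPairs, Finset.mem_insert, Finset.mem_image,
        Prod.mk.injEq]
      constructor
      · rintro ⟨rfl | ha, rfl | hb, hab⟩
        · omega
        · have := hm b hb; omega
        · exact .inr ⟨a, ha, rfl, rfl⟩
        · exact .inl ⟨ha, hb, hab⟩
      · rintro (⟨ha, hb, hab⟩ | ⟨_, ha, rfl, rfl⟩)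
        · exact ⟨.inr ha, .inr hb, hab⟩
        · exact ⟨.inr ha, .inl rfl, hm _ ha⟩
    rw [h1, Finset.card_union_of_disjoint, ih, Finset.card_image_of_injective,
      Finset.card_insert_of_notMem hms, Nat.choose_succ_succ' _ 1, Nat.choose_one_right, add_comm]
    · intro a b h; simpa using h
    · rw [Finset.disjoint_left]
      rintro ⟨a, b⟩ h1 h2
      simp only [mem_incPairs, Finset.mem_image, Prod.mk.injEq] at h1 h2
      obtain ⟨_, _, _, rfl⟩ := h2
      exact hms h1.2.1

theorem card_incTriples (s : Finset ℕ) : (incTriples s).card = s.card.choose 3 := by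
  induction s using Finset.induction_on_max with
  | empty => rfl
  | insert m s hm ih =>
    have hms : m ∉ s := fun h => lt_irrefl _ (hm m h)
    have h1 : incTriples (insert m s) =
        incTriples s ∪ (incPairs s).image fun p => (p.1, p.2, m) := by
      ext ⟨a, b, d⟩
      simp only [Finset.mem_union, mem_incTriples, Finset.mem_insert, Finset.mem_image,
        Prod.mk.injEq, Prod.exists, mem_incPairs]
      constructor
      · rintro ⟨ha, hb, hd, hab, hbd⟩
        have hb' : b ∈ s := by
          rcases hb with rfl | hb
          · rcases hd with rfl | hd
            · omega
            · have := hm d hd; omega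
          · exact hb
        have ha' : a ∈ s := by
          rcases ha with rfl | ha
          · have := hm b hb'; omega
          · exact ha
        rcases hd with rfl | hd
        · exact .inr ⟨a, b, ⟨ha', hb', hab⟩, rfl, rfl, rfl⟩
        · exact .inl ⟨ha', hb', hd, hab, hbd⟩
      · rintro (⟨ha, hb, hd, h⟩ | ⟨_, _, ⟨ha, hb, hab⟩, rfl, rfl, rfl⟩)
        · exact ⟨.inr ha, .inr hb, .inr hd, h⟩
        · exact ⟨.inr ha, .inr hb, .inl rfl, hab, hm _ hb⟩
    rw [h1, Finset.card_union_of_disjoint, ih, Finset.card_image_of_injective, card_incPairs,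
      Finset.card_insert_of_notMem hms, Nat.choose_succ_succ' _ 2, add_comm]
    · rintro ⟨a, b⟩ ⟨a', b'⟩ h; simpa using h
    · rw [Finset.disjoint_left]
      rintro ⟨a, b, d⟩ h1 h2
      simp only [mem_incTriples, Finset.mem_image, Prod.mk.injEq] at h1 h2
      obtain ⟨_, _, _, _, rfl⟩ := h2
      exact hms h1.2.2.1

/-! ### Grids in planar lattices -/

/-- The triples of points in a set. -/
def triplesIn {L : Type*} (R : Set L) (P : L → L → L → Prop) : Set (L × L × L) :=
  {t | P t.1 t.2.1 t.2.2 ∧ t.1 ∈ R ∧ t.2.1 ∈ R ∧ t.2.2 ∈ R}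

theorem ncard_triplesIn_or {L : Type*} [Finite L] {P Q S : L → L → L → Prop}
    (hS : ∀ α β γ, S α β γ ↔ P α β γ ∨ Q α β γ)
    (hPQ : ∀ α β γ, P α β γ → ¬ Q α β γ) (R : Set L) :
    (triplesIn R S).ncard = (triplesIn R P).ncard + (triplesIn R Q).ncard := by
  rw [← Set.ncard_union_eq _ (Set.toFinite _) (Set.toFinite _)]
  · congr 1
    ext t
    simp only [triplesIn, Set.mem_union, Set.mem_ofPred_eq, hS]
    tauto
  · rw [Set.disjoint_left]
    exact fun t h1 h2 => hPQ _ _ _ h1.1 h2.1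

namespace PlanarCoords

section
variable {L : Type*} [Lattice L] (c : PlanarCoords L)

theorem mem_uIcc {x y z : L} (h : c.Left x y) : z ∈ Set.uIcc x y ↔
    (c.cx x ≤ c.cx z ∧ c.cx z ≤ c.cx y) ∧ c.cy y ≤ c.cy z ∧ c.cy z ≤ c.cy x := by
  obtain ⟨h1, h2⟩ := h
  rw [Set.uIcc, Set.mem_Icc, c.le_iff, c.le_iff, c.cx_inf, c.cy_inf, c.cx_sup, c.cy_sup,
    min_eq_left h1.le, min_eq_right h2.le, max_eq_right h1.le, max_eq_left h2.le]
  tauto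

/-- `R` is the set of all points with first coordinate in `X` and second coordinate in `Y`, and
all these points belong to the lattice. -/
structure IsGrid (R : Set L) (X Y : Finset ℕ) : Prop where
  mem_iff : ∀ z, z ∈ R ↔ c.cx z ∈ X ∧ c.cy z ∈ Y
  exists_of_mem : ∀ a ∈ X, ∀ b ∈ Y, ∃ z, c.cx z = a ∧ c.cy z = b

variable {c} in
theorem IsGrid.swap {R : Set L} {X Y : Finset ℕ} (h : c.IsGrid R X Y) : c.swap.IsGrid R Y X :=
  ⟨fun z => (h.mem_iff z).trans and_comm, fun a ha b hb =>
    (h.exists_of_mem b hb a ha).imp fun _ hz => hz.symm⟩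

/-- Strips whose element `α` lies to the left. -/
def LeftStrip (α β γ : L) : Prop :=
  (c.cx α < c.cx β ∧ c.cx β < c.cx γ) ∧ c.cy β = c.cy γ ∧ c.cy γ < c.cy α

/-- Boxes whose element `α` lies to the left. -/
def LeftBox (α β γ : L) : Prop :=
  (c.cx α < c.cx β ∧ c.cx β < c.cx γ) ∧ c.cy γ < c.cy β ∧ c.cy β < c.cy α

/-- L-shapes whose element `α` lies to the left. -/
def LeftLShape (α β γ : L) : Prop :=
  (c.cx α < c.cx β ∧ c.cx β < c.cx γ) ∧ c.cy β < c.cy γ ∧ c.cy γ < c.cy α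

theorem isStrip_iff_left {α β γ : L} :
    IsStrip α β γ ↔ c.LeftStrip α β γ ∨ c.swap.LeftStrip α β γ := by
  rw [c.isStrip_iff, IsFork, c.incomp_iff, c.incomp_iff, lt_iff_le_not_ge, c.le_iff, c.le_iff,
    c.ext_iff', c.cx_inf, c.cx_inf, c.cy_inf, c.cy_inf]
  simp only [Left, LeftStrip, swap]
  constructor
  · rintro ⟨⟨h1 | h1, h2 | h2, h3⟩, h4⟩ <;> omega
  · rintro (h | h)
    · exact ⟨⟨.inl (by omega), .inl (by omega), by omega⟩, by omega⟩
    · exact ⟨⟨.inr (by omega), .inr (by omega), by omega⟩, by omega⟩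

theorem isBox_iff_left {α β γ : L} :
    IsBox α β γ ↔ c.LeftBox α β γ ∨ c.swap.LeftBox α β γ := by
  rw [c.isBox_iff]
  simp only [Left, LeftBox, swap]
  constructor <;> rintro (h | h) <;> [left; right; left; right] <;> omega

theorem isLShape_iff_left {α β γ : L} :
    IsLShape α β γ ↔ c.LeftLShape α β γ ∨ c.swap.LeftLShape α β γ := by
  rw [isLShape_iff, IsFork, c.incomp_iff, c.incomp_iff, lt_iff_le_not_ge, c.le_iff, c.le_iff,
    Ne, Ne, c.ext_iff', c.ext_iff', c.cx_inf, c.cx_inf, c.cy_inf, c.cy_inf, c.cx_sup, c.cx_sup,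
    c.cy_sup, c.cy_sup]
  simp only [Left, LeftLShape, swap]
  constructor
  · rintro ⟨⟨h1 | h1, h2 | h2, h3⟩, h4, h5⟩ <;> omega
  · rintro (h | h)
    · exact ⟨⟨.inl (by omega), .inl (by omega), by omega⟩, by omega, by omega⟩
    · exact ⟨⟨.inr (by omega), .inr (by omega), by omega⟩, by omega, by omega⟩

variable {c} {R : Set L} {X Y : Finset ℕ}

/-- A strip with `α` on the left amounts to three columns and two rows; in a grid every choice is
realised. -/
theorem IsGrid.ncard_leftStrip (h : c.IsGrid R X Y) :
    (triplesIn R c.LeftStrip).ncard = X.card.choose 3 * Y.card.choose 2 := by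
  rw [← card_incTriples, ← card_incPairs, ← Finset.card_product, ← Set.ncard_coe_finset]
  refine Set.ncard_congr (fun t _ => ((c.cx t.1, c.cx t.2.1, c.cx t.2.2),
    (c.cy t.2.1, c.cy t.1))) ?_ ?_ ?_
  · rintro ⟨α, β, γ⟩ ⟨h1, h2, h3, h4⟩
    change c.LeftStrip α β γ at h1
    simp only [h.mem_iff] at h2 h3 h4
    unfold LeftStrip at h1
    rw [SetLike.mem_coe, Finset.mem_product, mem_incTriples, mem_incPairs]
    exact ⟨⟨h2.1, h3.1, h4.1, h1.1⟩, h3.2, h2.2, h1.2.1.trans_lt h1.2.2⟩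
  · rintro ⟨α, β, γ⟩ ⟨α', β', γ'⟩ ⟨h1, -⟩ ⟨h2, -⟩ e
    simp only [Prod.mk.injEq, LeftStrip] at e h1 h2 ⊢
    exact ⟨c.ext' e.1.1 e.2.2, c.ext' e.1.2.1 e.2.1, c.ext' e.1.2.2 (by omega)⟩
  · rintro ⟨⟨x, y, z⟩, u, v⟩ ht
    rw [SetLike.mem_coe, Finset.mem_product, mem_incTriples, mem_incPairs] at ht
    obtain ⟨⟨hx, hy, hz, hxy, hyz⟩, hu, hv, huv⟩ := ht
    obtain ⟨α, rfl, rfl⟩ := h.exists_of_mem x hx v hv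
    obtain ⟨β, rfl, rfl⟩ := h.exists_of_mem y hy u hu
    obtain ⟨γ, rfl, h1⟩ := h.exists_of_mem z hz _ hu
    refine ⟨(α, β, γ), ⟨⟨⟨hxy, hyz⟩, h1.symm, h1.trans_lt huv⟩, (h.mem_iff _).2 ⟨hx, hv⟩,
      (h.mem_iff _).2 ⟨hy, hu⟩, (h.mem_iff _).2 ⟨hz, by rwa [h1]⟩⟩, rfl⟩

theorem IsGrid.ncard_leftBox (h : c.IsGrid R X Y) :
    (triplesIn R c.LeftBox).ncard = X.card.choose 3 * Y.card.choose 3 := by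
  rw [← card_incTriples, ← card_incTriples, ← Finset.card_product, ← Set.ncard_coe_finset]
  refine Set.ncard_congr (fun t _ => ((c.cx t.1, c.cx t.2.1, c.cx t.2.2),
    (c.cy t.2.2, c.cy t.2.1, c.cy t.1))) ?_ ?_ ?_
  · rintro ⟨α, β, γ⟩ ⟨h1, h2, h3, h4⟩
    simp only [h.mem_iff] at h2 h3 h4
    rw [SetLike.mem_coe, Finset.mem_product, mem_incTriples, mem_incTriples]
    exact ⟨⟨h2.1, h3.1, h4.1, h1.1⟩, h4.2, h3.2, h2.2, h1.2⟩
  · rintro ⟨α, β, γ⟩ ⟨α', β', γ'⟩ - - e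
    simp only [Prod.mk.injEq] at e ⊢
    exact ⟨c.ext' e.1.1 e.2.2.2, c.ext' e.1.2.1 e.2.2.1, c.ext' e.1.2.2 e.2.1⟩
  · rintro ⟨⟨x, y, z⟩, u, v, w⟩ ht
    rw [SetLike.mem_coe, Finset.mem_product, mem_incTriples, mem_incTriples] at ht
    obtain ⟨⟨hx, hy, hz, hxy⟩, hu, hv, hw, huv⟩ := ht
    obtain ⟨α, rfl, rfl⟩ := h.exists_of_mem x hx w hw
    obtain ⟨β, rfl, rfl⟩ := h.exists_of_mem y hy v hv
    obtain ⟨γ, rfl, rfl⟩ := h.exists_of_mem z hz u hu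
    exact ⟨(α, β, γ), ⟨⟨hxy, huv⟩, (h.mem_iff _).2 ⟨hx, hw⟩,
      (h.mem_iff _).2 ⟨hy, hv⟩, (h.mem_iff _).2 ⟨hz, hu⟩⟩, rfl⟩

theorem IsGrid.ncard_leftLShape (h : c.IsGrid R X Y) :
    (triplesIn R c.LeftLShape).ncard = X.card.choose 3 * Y.card.choose 3 := by
  rw [← card_incTriples, ← card_incTriples, ← Finset.card_product, ← Set.ncard_coe_finset]
  refine Set.ncard_congr (fun t _ => ((c.cx t.1, c.cx t.2.1, c.cx t.2.2),
    (c.cy t.2.1, c.cy t.2.2, c.cy t.1))) ?_ ?_ ?_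
  · rintro ⟨α, β, γ⟩ ⟨h1, h2, h3, h4⟩
    simp only [h.mem_iff] at h2 h3 h4
    rw [SetLike.mem_coe, Finset.mem_product, mem_incTriples, mem_incTriples]
    exact ⟨⟨h2.1, h3.1, h4.1, h1.1⟩, h3.2, h4.2, h2.2, h1.2⟩
  · rintro ⟨α, β, γ⟩ ⟨α', β', γ'⟩ - - e
    simp only [Prod.mk.injEq] at e ⊢
    exact ⟨c.ext' e.1.1 e.2.2.2, c.ext' e.1.2.1 e.2.1, c.ext' e.1.2.2 e.2.2.1⟩
  · rintro ⟨⟨x, y, z⟩, u, v, w⟩ ht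
    rw [SetLike.mem_coe, Finset.mem_product, mem_incTriples, mem_incTriples] at ht
    obtain ⟨⟨hx, hy, hz, hxy⟩, hu, hv, hw, huv⟩ := ht
    obtain ⟨α, rfl, rfl⟩ := h.exists_of_mem x hx w hw
    obtain ⟨β, rfl, rfl⟩ := h.exists_of_mem y hy u hu
    obtain ⟨γ, rfl, rfl⟩ := h.exists_of_mem z hz v hv
    exact ⟨(α, β, γ), ⟨⟨hxy, huv⟩, (h.mem_iff _).2 ⟨hx, hw⟩,
      (h.mem_iff _).2 ⟨hy, hu⟩, (h.mem_iff _).2 ⟨hz, hv⟩⟩, rfl⟩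

variable [Finite L]

theorem IsGrid.ncard_isStrip (h : c.IsGrid R X Y) : (triplesIn R IsStrip).ncard =
    X.card.choose 3 * Y.card.choose 2 + Y.card.choose 3 * X.card.choose 2 := by
  rw [← h.ncard_leftStrip, ← h.swap.ncard_leftStrip]
  refine ncard_triplesIn_or (fun _ _ _ => c.isStrip_iff_left) (fun α β γ h1 h2 => ?_) R
  simp only [LeftStrip, PlanarCoords.swap] at h1 h2
  omega

theorem IsGrid.ncard_isBox (h : c.IsGrid R X Y) : (triplesIn R IsBox).ncard =
    X.card.choose 3 * Y.card.choose 3 + Y.card.choose 3 * X.card.choose 3 := by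
  rw [← h.ncard_leftBox, ← h.swap.ncard_leftBox]
  refine ncard_triplesIn_or (fun _ _ _ => c.isBox_iff_left) (fun α β γ h1 h2 => ?_) R
  simp only [LeftBox, PlanarCoords.swap] at h1 h2
  omega

theorem IsGrid.ncard_isLShape (h : c.IsGrid R X Y) : (triplesIn R IsLShape).ncard =
    X.card.choose 3 * Y.card.choose 3 + Y.card.choose 3 * X.card.choose 3 := by
  rw [← h.ncard_leftLShape, ← h.swap.ncard_leftLShape]
  refine ncard_triplesIn_or (fun _ _ _ => c.isLShape_iff_left) (fun α β γ h1 h2 => ?_) R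
  simp only [LeftLShape, PlanarCoords.swap] at h1 h2
  omega

end

/-! ### Intervals of incomparable elements are grids -/

section
variable {L : Type*} [Lattice L] [Finite L] (c : PlanarCoords L)

/-- The first coordinates of the elements of an interval. -/
noncomputable def xs (u v : L) : Finset ℕ := (Set.toFinite (Set.Icc u v)).toFinset.image c.cx

theorem mem_xs {u v : L} {a : ℕ} : a ∈ c.xs u v ↔ ∃ z, (u ≤ z ∧ z ≤ v) ∧ c.cx z = a := by
  simp [xs]

/-- An interval within one row is a chain, so its number of columns is a difference of heights plus
one. Coordinates of the embedding may have gaps; heights do not. -/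
theorem card_xs [IsModularLattice L] {u v : L} (huv : u ≤ v) (h : c.cy u = c.cy v) :
    (c.xs u v).card = ht v - ht u + 1 := by
  have key : ∀ z, u ≤ z → z ≤ v → c.cy z = c.cy v := fun z h1 h2 => by
    rw [c.le_iff] at h1 h2
    omega
  rw [xs, Finset.card_image_of_injOn, ← Set.ncard_eq_toFinset_card, ncard_Icc_of_chain huv]
  · intro y z h1 h2 h3 h4
    simp only [c.le_iff, key y h1 h2, key z h3 h4, le_refl, and_true]
    exact le_total _ _
  · intro y hy z hz e
    simp only [Set.Finite.coe_toFinset, Set.mem_Icc] at hy hz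
    exact c.ext' e ((key y hy.1 hy.2).trans (key z hz.1 hz.2).symm)

variable {c} in
theorem Left.isGrid {x y : L} (h : c.Left x y) :
    c.IsGrid (Set.uIcc x y) (c.xs (x ⊓ y) y) (c.swap.xs (x ⊓ y) x) := by
  have h' := h
  obtain ⟨h1, h2⟩ := h'
  refine ⟨fun z => ?_, fun a ha b hb => ?_⟩
  · rw [c.mem_uIcc h, mem_xs, show c.cy z = c.swap.cx z from rfl, mem_xs]
    constructor
    · rintro ⟨h3, h4⟩
      change (c.cy y ≤ c.cy z ∧ c.cy z ≤ c.cy x) at h4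
      refine ⟨⟨z ⊓ y, ?_⟩, ⟨z ⊓ x, ?_⟩⟩
      · simp only [c.le_iff, c.cx_inf, c.cy_inf]; omega
      · simp only [c.le_iff, c.cx_inf, c.cy_inf, swap]; omega
    · rintro ⟨⟨u, h3, h4⟩, v, h5, h6⟩
      change c.cy v = c.cy z at h6
      change _ ∧ c.cy y ≤ c.cy z ∧ c.cy z ≤ c.cy x
      simp only [c.le_iff, c.cx_inf, c.cy_inf] at h3 h5
      omega
  · rw [mem_xs] at ha hb
    obtain ⟨u, h3, rfl⟩ := ha
    obtain ⟨v, h4, rfl⟩ := hb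
    -- `u` lies on the lower right edge and `v` on the lower left edge, so the join takes its column
    -- from `u` and its row from `v`.
    refine ⟨u ⊔ v, ?_⟩
    simp only [c.le_iff, c.cx_inf, c.cy_inf, swap, c.cx_sup, c.cy_sup] at *
    omega

/-- The heights of opposite edges of a diamond agree. -/
theorem ht_sup_sub [IsModularLattice L] (c : PlanarCoords L) {x y : L} (h : c.Left x y) :
    ht (x ⊔ y) - ht x = ht y - ht (x ⊓ y) := by
  obtain ⟨h1, h2⟩ := h
  have e1 := c.card_xs (u := x) (v := x ⊔ y) le_sup_left (by rw [c.cy_sup]; omega)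
  have e2 := c.card_xs (u := x ⊓ y) (v := y) inf_le_right (by rw [c.cy_inf]; omega)
  have e3 : c.xs x (x ⊔ y) = c.xs (x ⊓ y) y := by
    ext a
    simp only [mem_xs]
    constructor
    · rintro ⟨z, h3, rfl⟩
      refine ⟨z ⊓ y, ?_⟩
      simp only [c.le_iff, c.cx_inf, c.cy_inf, c.cx_sup, c.cy_sup] at *
      omega
    · rintro ⟨z, h3, rfl⟩
      refine ⟨z ⊔ x, ?_⟩
      simp only [c.le_iff, c.cx_inf, c.cy_inf, c.cx_sup, c.cy_sup] at *
      omega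
  rw [e3] at e1
  omega

end

section
variable {L : Type*} [Lattice L] [IsModularLattice L] [Finite L] (c : PlanarCoords L)

theorem ht_sup_sub_of_incomp (c : PlanarCoords L) {x y : L} (h : Incomp x y) :
    ht (x ⊔ y) - ht x = ht y - ht (x ⊓ y) := by
  rcases c.incomp_iff.1 h with h | h
  · exact c.ht_sup_sub h
  · exact c.swap.ht_sup_sub (c.swap_left.2 h)

theorem exists_isGrid (c : PlanarCoords L) {x y : L} (h : Incomp x y) :
    ∃ (c' : PlanarCoords L) (X Y : Finset ℕ), c'.IsGrid (Set.uIcc x y) X Y ∧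
      X.card = ht y - ht (x ⊓ y) + 1 ∧ Y.card = ht x - ht (x ⊓ y) + 1 := by
  have key : ∀ c' : PlanarCoords L, c'.Left x y → _ := fun c' h' =>
    (⟨c', _, _, h'.isGrid, c'.card_xs inf_le_right (by
      have := h'.2; rw [c'.cy_inf]; omega), c'.swap.card_xs inf_le_left (by
      have := h'.1; rw [c'.swap.cy_inf]; simp only [swap]; omega)⟩ :
      ∃ (c' : PlanarCoords L) (X Y : Finset ℕ), c'.IsGrid (Set.uIcc x y) X Y ∧
      X.card = ht y - ht (x ⊓ y) + 1 ∧ Y.card = ht x - ht (x ⊓ y) + 1)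
  rcases c.incomp_iff.1 h with h | h
  · exact key c h
  · exact key c.swap (c.swap_left.2 h)

theorem two_mul_ncard_isStrip (c : PlanarCoords L) {x y : L} (h : Incomp x y) :
    2 * (triplesIn (Set.uIcc x y) IsStrip).ncard = onInterval gridStrip x y := by
  obtain ⟨c', X, Y, hg, hX, hY⟩ := c.exists_isGrid h
  rw [hg.ncard_isStrip, hX, hY, onInterval, gridStrip]
  ring

theorem ncard_isBox_uIcc (c : PlanarCoords L) {x y : L} (h : Incomp x y) :
    (triplesIn (Set.uIcc x y) IsBox).ncard = onInterval gridBox x y := by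
  obtain ⟨c', X, Y, hg, hX, hY⟩ := c.exists_isGrid h
  rw [hg.ncard_isBox, hX, hY, onInterval, gridBox]
  ring

theorem ncard_isLShape_uIcc (c : PlanarCoords L) {x y : L} (h : Incomp x y) :
    (triplesIn (Set.uIcc x y) IsLShape).ncard = onInterval gridLShape x y := by
  obtain ⟨c', X, Y, hg, hX, hY⟩ := c.exists_isGrid h
  rw [hg.ncard_isLShape, hX, hY, onInterval, gridLShape]
  ring

end

end PlanarCoords

/-! ### Pairs and triples of join-meet irreducibles around a diamond -/

open Classical in
/-- The number of strictly increasing pairs of elements of a finite set. -/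
noncomputable def numLT {P : Type*} [Preorder P] (s t : Finset P) : ℕ :=
  {p ∈ s ×ˢ t | p.1 < p.2}.card

theorem numLT_empty_left {P : Type*} [Preorder P] (t : Finset P) : numLT ∅ t = 0 := by
  simp [numLT]

theorem numLT_empty_right {P : Type*} [Preorder P] (t : Finset P) : numLT t ∅ = 0 := by
  simp [numLT]

theorem numLT_self_singleton {P : Type*} [Preorder P] (a : P) : numLT {a} {a} = 0 := by
  simp [numLT]

theorem numLT_singleton {P : Type*} [Preorder P] {a b : P} (h : a < b) : numLT {a} {b} = 1 := by
  simp [numLT, Finset.filter_singleton, h]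

open Classical in
theorem numLT_self_pair {P : Type*} [Preorder P] {a b : P} (h : a < b) :
    numLT {a, b} {a, b} = 1 := by
  rw [numLT, Finset.card_eq_one]
  refine ⟨(a, b), ?_⟩
  ext ⟨x, y⟩
  simp only [Finset.mem_filter, Finset.mem_product, Finset.mem_insert, Finset.mem_singleton,
    Prod.mk.injEq]
  constructor
  · rintro ⟨⟨rfl | rfl, rfl | rfl⟩, h'⟩
    · exact absurd h' (lt_irrefl _)
    · exact ⟨rfl, rfl⟩
    · exact absurd h' h.asymm
    · exact absurd h' (lt_irrefl _)
  · rintro ⟨rfl, rfl⟩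
    exact ⟨⟨.inl rfl, .inr rfl⟩, h⟩

open Classical in
theorem card_eq_numLT_mul {P : Type*} [Preorder P] {A B C : Finset P} {F : Finset (P × P × P)}
    (hF : ∀ i j k, (i, j, k) ∈ F ↔ i < k ∧ i ∈ A ∧ k ∈ B ∧ j ∈ C) :
    F.card = numLT A B * C.card := by
  rw [numLT, ← Finset.card_product]
  refine Finset.card_bij' (fun t _ => ((t.1, t.2.2), t.2.1)) (fun t _ => (t.1.1, t.2, t.1.2))
    ?_ ?_ (fun _ _ => rfl) (fun _ _ => rfl)
  · rintro ⟨i, j, k⟩ h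
    rw [hF] at h
    simp only [Finset.mem_product, Finset.mem_filter]
    tauto
  · rintro ⟨⟨i, k⟩, j⟩ h
    simp only [Finset.mem_product, Finset.mem_filter] at h
    rw [hF]
    tauto

open Classical in
theorem card_eq_numLT_add {P : Type*} [Preorder P] {A B : Finset P} {F : Finset (P × P × P)}
    (hAB : ∀ a ∈ A, a ∉ B)
    (hF : ∀ i j k, (i, j, k) ∈ F ↔ i < k ∧ ((i ∈ A ∧ k ∈ A ∧ j ∈ B) ∨ (i ∈ B ∧ k ∈ B ∧ j ∈ A))) :
    F.card = numLT A A * B.card + numLT B B * A.card := by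
  rw [← Finset.card_filter_add_card_filter_not (fun t : P × P × P => t.1 ∈ A) (s := F)]
  congr 1
  · refine card_eq_numLT_mul fun i j k => ?_
    rw [Finset.mem_filter, hF]
    have := hAB i
    tauto
  · refine card_eq_numLT_mul fun i j k => ?_
    rw [Finset.mem_filter, hF]
    have := hAB i
    tauto

theorem mem_jmTriples {L : Type*} [Lattice L] [Finite L] {i j k : L} :
    (i, j, k) ∈ jmTriples L ↔
      i ∈ JM L ∧ j ∈ JM L ∧ k ∈ JM L ∧ i < k ∧ Incomp i j ∧ Incomp j k := by
  simp [jmTriples]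

namespace PlanarCoords

section
variable {L : Type*} [Lattice L] {c : PlanarCoords L}

/-- The middle of an antichain is `(y ⊓ x) ⊔ (y ⊓ z)`, a join of two smaller elements. -/
theorem Left.not_supIrred {x y z : L} (h : c.Left x y) (h' : c.Left y z) : ¬ SupIrred y := by
  rintro ⟨-, hy⟩
  obtain ⟨h1, h2⟩ := h
  obtain ⟨h3, h4⟩ := h'
  have := hy (b := y ⊓ x) (c := y ⊓ z)
  simp only [c.ext_iff', c.cx_inf, c.cy_inf, c.cx_sup, c.cy_sup] at this
  omega

/-- A finite set of join-meet irreducibles to the left of one join-meet irreducible is a chain. -/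
theorem lt_or_lt_of_left {u u' v : L} (hu : SupIrred u) (hu' : SupIrred u') (h : c.Left u v)
    (h' : c.Left u' v) (hne : u ≠ u') : u < u' ∨ u' < u := by
  by_contra hlt
  simp only [not_or, lt_iff_le_and_ne, hne, hne.symm, ne_eq, not_false_eq_true, and_true] at hlt
  rcases c.incomp_iff.1 hlt with h1 | h1
  · exact h1.not_supIrred h' hu'
  · exact h1.not_supIrred h hu

-- All of `U` is incomparable to all of `V`. At most two neighbours bounds both sizes by two, and
-- the exclusion of four-cycles forbids two on each side.
open Classical in
theorem cases_of_isZigzag (hz : IsZigzag L) {U V : Finset L} (hU : U.Nonempty) (hV : V.Nonempty)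
    (hUJ : ∀ u ∈ U, u ∈ JM L) (hVJ : ∀ v ∈ V, v ∈ JM L) (h : ∀ u ∈ U, ∀ v ∈ V, c.Left u v) :
    (∃ u v, U = {u} ∧ V = {v}) ∨ (∃ u v v', v < v' ∧ U = {u} ∧ V = {v, v'}) ∨
      (∃ u u' v, u < u' ∧ U = {u, u'} ∧ V = {v}) := by
  obtain ⟨u₀, hu₀⟩ := hU
  obtain ⟨v₀, hv₀⟩ := hV
  have hU2 : U.card ≤ 2 := by
    by_contra hc
    obtain ⟨x, hx, y, hy, z, hz', hxy, hxz, hyz⟩ := Finset.two_lt_card.1 (not_le.1 hc)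
    rcases hz.1 v₀ (hVJ _ hv₀) x (hUJ _ hx) y (hUJ _ hy) z (hUJ _ hz') (h _ hx _ hv₀).incomp.symm
      (h _ hy _ hv₀).incomp.symm (h _ hz' _ hv₀).incomp.symm with e | e | e
    exacts [hxy e, hyz e, hxz e]
  have hV2 : V.card ≤ 2 := by
    by_contra hc
    obtain ⟨x, hx, y, hy, z, hz', hxy, hxz, hyz⟩ := Finset.two_lt_card.1 (not_le.1 hc)
    rcases hz.1 u₀ (hUJ _ hu₀) x (hVJ _ hx) y (hVJ _ hy) z (hVJ _ hz') (h _ hu₀ _ hx).incomp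
      (h _ hu₀ _ hy).incomp (h _ hu₀ _ hz').incomp with e | e | e
    exacts [hxy e, hyz e, hxz e]
  have hUV : ¬ (U.card = 2 ∧ V.card = 2) := by
    rintro ⟨h1, h2⟩
    obtain ⟨x, y, hxy, rfl⟩ := Finset.card_eq_two.1 h1
    obtain ⟨z, w, hzw, rfl⟩ := Finset.card_eq_two.1 h2
    simp only [Finset.mem_insert, Finset.mem_singleton, forall_eq_or_imp, forall_eq] at h hUJ hVJ
    exact hzw (hz.2 x hUJ.1 y hUJ.2 z hVJ.1 w hVJ.2 hxy h.1.1.incomp h.2.1.incomp h.1.2.incomp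
      h.2.2.incomp)
  have hU1 := Finset.card_pos.2 ⟨u₀, hu₀⟩
  have hV1 := Finset.card_pos.2 ⟨v₀, hv₀⟩
  rcases (show (U.card = 1 ∧ V.card = 1) ∨ (U.card = 1 ∧ V.card = 2) ∨ (U.card = 2 ∧ V.card = 1) by
    omega) with ⟨h1, h2⟩ | ⟨h1, h2⟩ | ⟨h1, h2⟩
  · obtain ⟨u, rfl⟩ := Finset.card_eq_one.1 h1
    obtain ⟨v, rfl⟩ := Finset.card_eq_one.1 h2
    exact .inl ⟨u, v, rfl, rfl⟩
  · obtain ⟨u, rfl⟩ := Finset.card_eq_one.1 h1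
    obtain ⟨v, v', hne, rfl⟩ := Finset.card_eq_two.1 h2
    simp only [Finset.mem_insert, Finset.mem_singleton, forall_eq_or_imp, forall_eq] at h hUJ hVJ
    refine .inr (.inl ?_)
    rcases lt_or_lt_of_left hVJ.1.1 hVJ.2.1 (c.swap_left.2 h.1) (c.swap_left.2 h.2) hne with hl | hl
    · exact ⟨u, v, v', hl, rfl, rfl⟩
    · exact ⟨u, v', v, hl, rfl, Finset.pair_comm _ _⟩
  · obtain ⟨v, rfl⟩ := Finset.card_eq_one.1 h2
    obtain ⟨u, u', hne, rfl⟩ := Finset.card_eq_two.1 h1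
    simp only [Finset.mem_insert, Finset.mem_singleton, forall_eq_or_imp, forall_eq] at h hUJ hVJ
    refine .inr (.inr ?_)
    rcases lt_or_lt_of_left hUJ.1.1 hUJ.2.1 h.1 h.2 hne with hl | hl
    · exact ⟨u, u', v, hl, rfl, rfl⟩
    · exact ⟨u', u, v, hl, Finset.pair_comm _ _, rfl⟩

end

variable {L : Type*} [Lattice L] [Finite L] (c : PlanarCoords L)

/-- The join-meet irreducibles to the upper left of `α`. -/
noncomputable def ul (α : L) : Finset L :=
  (Set.toFinite {θ | θ ∈ JM L ∧ c.cx θ ≤ c.cx α ∧ c.cy α ≤ c.cy θ}).toFinset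

theorem mem_ul {α θ : L} : θ ∈ c.ul α ↔ θ ∈ JM L ∧ c.cx θ ≤ c.cx α ∧ c.cy α ≤ c.cy θ := by
  simp only [ul, Set.Finite.mem_toFinset, Set.mem_ofPred_eq]

theorem mem_swap_ul {α θ : L} :
    θ ∈ c.swap.ul α ↔ θ ∈ JM L ∧ c.cx α ≤ c.cx θ ∧ c.cy θ ≤ c.cy α := by
  rw [mem_ul, and_comm (a := c.swap.cx θ ≤ _)]
  rfl

variable {c}

/-- Take the extreme element of the upper left quadrant of `α`, maximising `cy - cx`. If it is a
join, the operand with the same row stays in the quadrant and cannot be further left, so it is the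
element itself; meets are dual. The element `β` shows that it is neither least nor greatest. -/
theorem Left.ul_nonempty {α β : L} (h : c.Left α β) : (c.ul α).Nonempty := by
  obtain ⟨h1, h2⟩ := h
  obtain ⟨θ, ⟨h3, h4⟩, h5⟩ := Set.exists_max_image {x | c.cx x ≤ c.cx α ∧ c.cy α ≤ c.cy x}
    (fun x => (c.cy x : ℤ) - c.cx x) (Set.toFinite _) ⟨α, le_rfl, le_rfl⟩
  refine ⟨θ, c.mem_ul.2 ⟨⟨⟨fun hm => ?_, fun a b hab => ?_⟩, fun hm => ?_, fun a b hab => ?_⟩,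
    h3, h4⟩⟩
  · have := hm (inf_le_left : θ ⊓ β ≤ θ)
    simp only [c.le_iff, c.cy_inf] at this
    omega
  · have ha := h5 a
    have hb := h5 b
    simp only [Set.mem_ofPred_eq] at ha hb
    simp only [c.ext_iff', c.cx_sup, c.cy_sup] at hab ⊢
    omega
  · have := hm (le_sup_left : θ ≤ θ ⊔ β)
    simp only [c.le_iff, c.cx_sup] at this
    omega
  · have ha := h5 a
    have hb := h5 b
    simp only [Set.mem_ofPred_eq] at ha hb
    simp only [c.ext_iff', c.cx_inf, c.cy_inf] at hab ⊢
    omega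

open Classical in
theorem card_jmPairs_filter {U V : Finset L} (hUJ : ∀ u ∈ U, u ∈ JM L) (hVJ : ∀ v ∈ V, v ∈ JM L)
    (h : ∀ u ∈ U, ∀ v ∈ V, c.Left u v) (Q : Sym2 L → Prop)
    [DecidablePred Q] (hQ : ∀ a ∈ JM L, ∀ b ∈ JM L, c.Left a b → (Q s(a, b) ↔ a ∈ U ∧ b ∈ V)) :
    {p ∈ jmPairs L | Q p}.card = U.card * V.card := by
  rw [← Finset.card_product]
  have : {p ∈ jmPairs L | Q p} = (U ×ˢ V).image fun p => s(p.1, p.2) := by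
    ext p
    simp only [jmPairs, Finset.mem_filter, Set.Finite.mem_toFinset, Set.mem_ofPred_eq,
      Finset.mem_image, Finset.mem_product, Prod.exists]
    constructor
    · rintro ⟨⟨a, ha, b, hb, hab, rfl⟩, hp⟩
      rcases c.incomp_iff.1 hab with hl | hl
      · exact ⟨a, b, (hQ a ha b hb hl).1 hp, rfl⟩
      · rw [Sym2.eq_swap] at hp
        exact ⟨b, a, (hQ b hb a ha hl).1 hp, Sym2.eq_swap⟩
    · rintro ⟨a, b, ⟨ha, hb⟩, rfl⟩
      exact ⟨⟨a, hUJ a ha, b, hVJ b hb, (h a ha b hb).incomp, rfl⟩,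
        (hQ a (hUJ a ha) b (hVJ b hb) (h a ha b hb)).2 ⟨ha, hb⟩⟩
  rw [this, Finset.card_image_of_injOn]
  rintro ⟨a, b⟩ h1 ⟨a', b'⟩ h2 e
  simp only [SetLike.mem_coe, Finset.mem_product, Sym2.eq_iff] at h1 h2 e
  obtain ⟨rfl, rfl⟩ | ⟨rfl, rfl⟩ := e
  · rfl
  · exact absurd (h _ h1.1 _ h1.2) (h _ h2.1 _ h2.2).asymm

theorem Left.left_of_mem_ul {α γ u v : L} (h : c.Left α γ) (hu : u ∈ c.ul α)
    (hv : v ∈ c.swap.ul γ) : c.Left u v := by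
  rw [mem_ul] at hu
  rw [mem_swap_ul] at hv
  obtain ⟨h1, h2⟩ := h
  exact ⟨by omega, by omega⟩

theorem Left.mem_uIcc_iff {α γ i j : L} (h : c.Left α γ) (h' : c.Left i j) (hi : i ∈ JM L)
    (hj : j ∈ JM L) : (α ∈ Set.uIcc i j ∧ γ ∈ Set.uIcc i j) ↔ i ∈ c.ul α ∧ j ∈ c.swap.ul γ := by
  obtain ⟨h1, h2⟩ := h
  rw [c.mem_uIcc h', c.mem_uIcc h', mem_ul, mem_swap_ul]
  simp only [hi, hj, true_and]
  omega

open Classical in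
/-- Every diamond lies in one more of the intervals spanned by pairs of join-meet irreducibles
than in their intersections belonging to triples. -/
theorem Left.card_filter_jmPairs (hz : IsZigzag L) {α γ : L} (h : c.Left α γ) :
    {p ∈ jmPairs L | α ∈ Set.Icc p.inf p.sup ∧ γ ∈ Set.Icc p.inf p.sup}.card =
      {t ∈ jmTriples L | (α ∈ Set.uIcc t.1 t.2.1 ∧ γ ∈ Set.uIcc t.1 t.2.1) ∧
        α ∈ Set.uIcc t.2.1 t.2.2 ∧ γ ∈ Set.uIcc t.2.1 t.2.2}.card + 1 := by
  have hU : ∀ u ∈ c.ul α, u ∈ JM L := fun u hu => (c.mem_ul.1 hu).1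
  have hV : ∀ v ∈ c.swap.ul γ, v ∈ JM L := fun v hv => (c.swap.mem_ul.1 hv).1
  have hUV : ∀ u ∈ c.ul α, ∀ v ∈ c.swap.ul γ, c.Left u v := fun u hu v hv => h.left_of_mem_ul hu hv
  rw [card_jmPairs_filter hU hV hUV _ fun a ha b hb hab => h.mem_uIcc_iff hab ha hb,
    card_eq_numLT_add (A := c.ul α) (B := c.swap.ul γ)]
  -- Pairs against triples: `1 = 0 + 1` if both sets are singletons, and `2 = 1 + 1` if one of them
  -- has two elements.
  · rcases cases_of_isZigzag hz h.ul_nonempty (c.swap_left.2 h).ul_nonempty hU hV hUV with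
      ⟨u, v, e1, e2⟩ | ⟨u, v, v', hv, e1, e2⟩ | ⟨u, u', v, hu, e1, e2⟩ <;> rw [e1, e2]
    · simp [numLT_self_singleton]
    · simp [numLT_self_singleton, numLT_self_pair hv, Finset.card_pair hv.ne]
    · simp [numLT_self_singleton, numLT_self_pair hu, Finset.card_pair hu.ne]
  · exact fun a ha ha' => (hUV a ha a ha').incomp.ne rfl
  · intro i j k
    rw [Finset.mem_filter, mem_jmTriples]
    constructor
    · rintro ⟨⟨hi, hj, hk, hik, hij, hjk⟩, h1, h2⟩
      refine ⟨hik, ?_⟩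
      rcases c.incomp_iff.1 hij with hl | hl
      · rw [h.mem_uIcc_iff hl hi hj] at h1
        rcases c.incomp_iff.1 hjk with hl' | hl'
        · rw [h.mem_uIcc_iff hl' hj hk] at h2
          exact absurd rfl (hUV j h2.1 j h1.2).incomp.ne
        · rw [Set.uIcc_comm, h.mem_uIcc_iff hl' hk hj] at h2
          exact .inl ⟨h1.1, h2⟩
      · rw [Set.uIcc_comm, h.mem_uIcc_iff hl hj hi] at h1
        rcases c.incomp_iff.1 hjk with hl' | hl'
        · rw [h.mem_uIcc_iff hl' hj hk] at h2
          exact .inr ⟨h1.2, h2.2, h2.1⟩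
        · rw [Set.uIcc_comm, h.mem_uIcc_iff hl' hk hj] at h2
          exact absurd rfl (hUV j h1.1 j h2.2).incomp.ne
    · rintro ⟨hik, ⟨hi, hk, hj⟩ | ⟨hi, hk, hj⟩⟩
      · have h1 := hUV i hi j hj
        have h2 := hUV k hk j hj
        refine ⟨⟨hU _ hi, hV _ hj, hU _ hk, hik, h1.incomp, h2.incomp.symm⟩,
          (h.mem_uIcc_iff h1 (hU _ hi) (hV _ hj)).2 ⟨hi, hj⟩, ?_⟩
        rw [Set.uIcc_comm]
        exact (h.mem_uIcc_iff h2 (hU _ hk) (hV _ hj)).2 ⟨hk, hj⟩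
      · have h1 := hUV j hj i hi
        have h2 := hUV j hj k hk
        refine ⟨⟨hV _ hi, hU _ hj, hV _ hk, hik, h1.incomp.symm, h2.incomp⟩, ?_,
          (h.mem_uIcc_iff h2 (hU _ hj) (hV _ hk)).2 ⟨hj, hk⟩⟩
        rw [Set.uIcc_comm]
        exact (h.mem_uIcc_iff h1 (hU _ hj) (hV _ hi)).2 ⟨hj, hi⟩

end PlanarCoords

/-! ### Pairs and triples of join-meet irreducibles around an L-shape -/

namespace PlanarCoords

variable {L : Type*} [Lattice L]

/-- The L-shape with corner `α` lies in neither of the two intervals of a triple, but in their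
union, with `α` in the intersection. -/
def Straddles (α β γ : L) (t : L × L × L) : Prop :=
  (α ∈ Set.uIcc t.1 t.2.1 ∧ α ∈ Set.uIcc t.2.1 t.2.2) ∧
    (β ∈ Set.uIcc t.1 t.2.1 ∧ β ∉ Set.uIcc t.2.1 t.2.2) ∧
    γ ∈ Set.uIcc t.2.1 t.2.2 ∧ γ ∉ Set.uIcc t.1 t.2.1

-- `V₁` and `V₂` are the partners available for `β` and for `γ`. If they meet, the common partners
-- behave as for a single diamond. If they are disjoint, then `V₁ = {v}` and `V₂ = {v'}` with `v <
-- v'`, and one straddling triple takes the place of a pair.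
open Classical in
theorem card_mul_inter_add_numLT (U V₁ V₂ : Finset L) (h1 : V₁.Nonempty) (h2 : V₂.Nonempty)
    (hlt : ∀ i ∈ V₁, ∀ k ∈ V₂, k < i → k ∈ V₁)
    (hUV : (∃ u v, U = {u} ∧ V₁ ∪ V₂ = {v}) ∨ (∃ u v v', v < v' ∧ U = {u} ∧ V₁ ∪ V₂ = {v, v'}) ∨
      (∃ u u' v, u < u' ∧ U = {u, u'} ∧ V₁ ∪ V₂ = {v})) :
    U.card * (V₁ ∩ V₂).card + numLT (V₁ \ V₂) (V₂ \ V₁) * U.card =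
      numLT U U * (V₁ ∩ V₂).card + numLT (V₁ ∩ V₂) (V₁ ∩ V₂) * U.card + 1 := by
  have hsingle : ∀ v, V₁ ∪ V₂ = {v} → V₁ = {v} ∧ V₂ = {v} := fun v e =>
    ⟨(Finset.subset_singleton_iff.1 (e ▸ Finset.subset_union_left)).resolve_left h1.ne_empty,
      (Finset.subset_singleton_iff.1 (e ▸ Finset.subset_union_right)).resolve_left h2.ne_empty⟩
  rcases hUV with ⟨u, v, rfl, e⟩ | ⟨u, v, v', hv, rfl, e⟩ | ⟨u, u', v, hu, rfl, e⟩
  · obtain ⟨rfl, rfl⟩ := hsingle v e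
    simp [numLT_self_singleton, numLT_empty_left]
  · have hsub : ∀ {V : Finset L}, V ⊆ {v, v'} → V.Nonempty → V = {v} ∨ V = {v'} ∨ V = {v, v'} := by
      intro V hV hn
      rw [← Finset.coe_subset, Finset.coe_pair, Set.subset_pair_iff_eq] at hV
      rcases hV with h | h | h | h
      · exact absurd (Finset.coe_eq_empty.1 h) hn.ne_empty
      · exact .inl (Finset.coe_eq_singleton.1 h)
      · exact .inr (.inl (Finset.coe_eq_singleton.1 h))
      · exact .inr (.inr (Finset.coe_injective (h.trans (Finset.coe_pair).symm)))
    have hne := hv.ne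
    have hne' := hv.ne'
    rcases hsub (e ▸ Finset.subset_union_left) h1 with rfl | rfl | rfl <;>
      rcases hsub (e ▸ Finset.subset_union_right) h2 with rfl | rfl | rfl
    · simp only [Finset.union_self] at e
      simp [numLT_self_singleton, numLT_empty_left]
    · have : ({v} : Finset L) ∩ {v'} = ∅ := by simp [hne']
      have h3 : ({v} : Finset L) \ {v'} = {v} := by simp [hne]
      have h4 : ({v'} : Finset L) \ {v} = {v'} := by simp [hne']
      rw [this, h3, h4, numLT_singleton hv]
      simp [numLT_self_singleton, numLT_empty_left]
    · have : ({v} : Finset L) ∩ {v, v'} = {v} := Finset.singleton_inter_of_mem (by simp)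
      have h3 : ({v} : Finset L) \ {v, v'} = ∅ := by simp
      rw [this, h3]
      simp [numLT_self_singleton, numLT_empty_left]
    -- The only place for `hlt`: it excludes disjoint partner sets in the reverse order.
    · have := hlt v' (by simp) v (by simp) hv
      simp [hne] at this
    · simp [numLT_self_singleton, numLT_empty_left]
    · have : ({v'} : Finset L) ∩ {v, v'} = {v'} := by simp
      have h3 : ({v'} : Finset L) \ {v, v'} = ∅ := by simp
      rw [this, h3]
      simp [numLT_self_singleton, numLT_empty_left]
    · have : ({v, v'} : Finset L) ∩ {v} = {v} := by simp
      have h3 : ({v} : Finset L) \ {v, v'} = ∅ := by simp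
      rw [this, h3]
      simp [numLT_self_singleton, numLT_empty_right]
    · have : ({v, v'} : Finset L) ∩ {v'} = {v'} := by simp
      have h3 : ({v'} : Finset L) \ {v, v'} = ∅ := by simp
      rw [this, h3]
      simp [numLT_self_singleton, numLT_empty_right]
    · simp [numLT_self_singleton, numLT_empty_right, numLT_self_pair hv, Finset.card_pair hne]
  · obtain ⟨rfl, rfl⟩ := hsingle v e
    simp [numLT_self_singleton, numLT_empty_left, numLT_self_pair hu, Finset.card_pair hu.ne]

variable [Finite L] {c : PlanarCoords L}

theorem LeftLShape.mem_uIcc_iff {α β γ i j : L} (h : c.LeftLShape α β γ) (h' : c.Left i j)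
    (hi : i ∈ JM L) (hj : j ∈ JM L) :
    (α ∈ Set.uIcc i j ∧ β ∈ Set.uIcc i j ∧ γ ∈ Set.uIcc i j) ↔
      i ∈ c.ul α ∧ j ∈ c.swap.ul β ∧ j ∈ c.swap.ul γ := by
  obtain ⟨h1, h2⟩ := h
  rw [c.mem_uIcc h', c.mem_uIcc h', c.mem_uIcc h', mem_ul, mem_swap_ul, mem_swap_ul]
  simp only [hi, hj, true_and]
  omega

/-- Since `i < k` are both incomparable to `j`, they lie on the same side of it. As `β` is below
`γ`, straddling is possible only with `j` to the upper left of `α`. -/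
theorem LeftLShape.straddles_iff {α β γ i j k : L} (h : c.LeftLShape α β γ)
    (ht : (i, j, k) ∈ jmTriples L) :
    Straddles α β γ (i, j, k) ↔ (i ∈ c.swap.ul β ∧ i ∉ c.swap.ul γ) ∧
      (k ∈ c.swap.ul γ ∧ k ∉ c.swap.ul β) ∧ j ∈ c.ul α := by
  rw [mem_jmTriples, lt_iff_le_not_ge, c.le_iff, c.le_iff] at ht
  obtain ⟨hi, hj, hk, hik, hij, hjk⟩ := ht
  obtain ⟨h1, h2⟩ := h
  simp only [Straddles, mem_swap_ul, hi, hk, true_and]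
  simp only [mem_ul, hj, true_and]
  rcases c.incomp_iff.1 hij with hl | hl <;> rcases c.incomp_iff.1 hjk with hl' | hl'
  · unfold Left at hl hl'
    omega
  · rw [c.mem_uIcc hl, c.mem_uIcc hl, c.mem_uIcc hl, Set.uIcc_comm, c.mem_uIcc hl',
      c.mem_uIcc hl', c.mem_uIcc hl']
    unfold Left at hl hl'
    omega
  · rw [c.mem_uIcc hl', c.mem_uIcc hl', c.mem_uIcc hl', Set.uIcc_comm, c.mem_uIcc hl,
      c.mem_uIcc hl, c.mem_uIcc hl]
    unfold Left at hl hl'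
    omega
  · unfold Left at hl hl'
    omega

open Classical in
theorem LeftLShape.card_filter_jmPairs (hz : IsZigzag L) {α β γ : L} (h : c.LeftLShape α β γ) :
    {p ∈ jmPairs L | α ∈ Set.Icc p.inf p.sup ∧ β ∈ Set.Icc p.inf p.sup ∧
      γ ∈ Set.Icc p.inf p.sup}.card + {t ∈ jmTriples L | Straddles α β γ t}.card =
      {t ∈ jmTriples L |
        (α ∈ Set.uIcc t.1 t.2.1 ∧ β ∈ Set.uIcc t.1 t.2.1 ∧ γ ∈ Set.uIcc t.1 t.2.1) ∧
        α ∈ Set.uIcc t.2.1 t.2.2 ∧ β ∈ Set.uIcc t.2.1 t.2.2 ∧ γ ∈ Set.uIcc t.2.1 t.2.2}.card +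
        1 := by
  have h1 : c.Left α β := by have := h.1; have := h.2; exact ⟨by omega, by omega⟩
  have h2 : c.Left α γ := by have := h.1; have := h.2; exact ⟨by omega, by omega⟩
  have hU : ∀ u ∈ c.ul α, u ∈ JM L := fun u hu => (c.mem_ul.1 hu).1
  have hVβ : ∀ v ∈ c.swap.ul β, v ∈ JM L := fun v hv => (c.swap.mem_ul.1 hv).1
  have hVγ : ∀ v ∈ c.swap.ul γ, v ∈ JM L := fun v hv => (c.swap.mem_ul.1 hv).1
  have hV : ∀ v ∈ c.swap.ul β ∪ c.swap.ul γ, v ∈ JM L := fun v hv =>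
    (Finset.mem_union.1 hv).elim (hVβ v) (hVγ v)
  have hV' : ∀ v ∈ c.swap.ul β ∩ c.swap.ul γ, v ∈ JM L := fun v hv =>
    hVβ v (Finset.mem_inter.1 hv).1
  have hUV : ∀ u ∈ c.ul α, ∀ v ∈ c.swap.ul β ∪ c.swap.ul γ, c.Left u v := fun u hu v hv =>
    (Finset.mem_union.1 hv).elim (h1.left_of_mem_ul hu) (h2.left_of_mem_ul hu)
  have hUV' : ∀ u ∈ c.ul α, ∀ v ∈ c.swap.ul β ∩ c.swap.ul γ, c.Left u v := fun u hu v hv =>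
    h1.left_of_mem_ul hu (Finset.mem_inter.1 hv).1
  rw [card_jmPairs_filter hU hV' hUV' _ fun a ha b hb hab => by
      rw [Finset.mem_inter]; exact h.mem_uIcc_iff hab ha hb,
    card_eq_numLT_mul (A := c.swap.ul β \ c.swap.ul γ) (B := c.swap.ul γ \ c.swap.ul β)
      (C := c.ul α),
    card_eq_numLT_add (A := c.ul α) (B := c.swap.ul β ∩ c.swap.ul γ)]
  · refine card_mul_inter_add_numLT _ _ _ (c.swap_left.2 h1).ul_nonempty
      (c.swap_left.2 h2).ul_nonempty (fun i hi k hk hki => ?_)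
      (cases_of_isZigzag hz h2.ul_nonempty ((c.swap_left.2 h2).ul_nonempty.mono
        Finset.subset_union_right) hU hV hUV)
    rw [mem_swap_ul] at hi hk ⊢
    have := (c.le_iff _ _).1 hki.le
    have h3 := h.1
    exact ⟨hk.1, by omega, by omega⟩
  · exact fun a ha ha' => (hUV' a ha a ha').incomp.ne rfl
  · intro i j k
    rw [Finset.mem_filter, mem_jmTriples]
    simp only [Finset.mem_inter]
    constructor
    · rintro ⟨⟨hi, hj, hk, hik, hij, hjk⟩, h3, h4⟩
      refine ⟨hik, ?_⟩
      rcases c.incomp_iff.1 hij with hl | hl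
      · rw [h.mem_uIcc_iff hl hi hj] at h3
        rcases c.incomp_iff.1 hjk with hl' | hl'
        · rw [h.mem_uIcc_iff hl' hj hk] at h4
          exact absurd rfl (h1.left_of_mem_ul h4.1 h3.2.1).incomp.ne
        · rw [Set.uIcc_comm, h.mem_uIcc_iff hl' hk hj] at h4
          exact .inl ⟨h3.1, h4⟩
      · rw [Set.uIcc_comm, h.mem_uIcc_iff hl hj hi] at h3
        rcases c.incomp_iff.1 hjk with hl' | hl'
        · rw [h.mem_uIcc_iff hl' hj hk] at h4
          exact .inr ⟨h3.2, h4.2, h4.1⟩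
        · rw [Set.uIcc_comm, h.mem_uIcc_iff hl' hk hj] at h4
          exact absurd rfl (h1.left_of_mem_ul h3.1 h4.2.1).incomp.ne
    · rintro ⟨hik, ⟨hi, hk, hj⟩ | ⟨hi, hk, hj⟩⟩
      · have h3 := h1.left_of_mem_ul hi hj.1
        have h4 := h1.left_of_mem_ul hk hj.1
        refine ⟨⟨hU _ hi, hVβ _ hj.1, hU _ hk, hik, h3.incomp, h4.incomp.symm⟩,
          (h.mem_uIcc_iff h3 (hU _ hi) (hVβ _ hj.1)).2 ⟨hi, hj⟩, ?_⟩
        rw [Set.uIcc_comm]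
        exact (h.mem_uIcc_iff h4 (hU _ hk) (hVβ _ hj.1)).2 ⟨hk, hj⟩
      · have h3 := h1.left_of_mem_ul hj hi.1
        have h4 := h1.left_of_mem_ul hj hk.1
        refine ⟨⟨hVβ _ hi.1, hU _ hj, hVβ _ hk.1, hik, h3.incomp.symm, h4.incomp⟩, ?_,
          (h.mem_uIcc_iff h4 (hU _ hj) (hVβ _ hk.1)).2 ⟨hj, hk⟩⟩
        rw [Set.uIcc_comm]
        exact (h.mem_uIcc_iff h3 (hU _ hj) (hVβ _ hi.1)).2 ⟨hj, hi⟩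
  · intro i j k
    rw [Finset.mem_filter]
    simp only [Finset.mem_sdiff]
    constructor
    · rintro ⟨ht, hs⟩
      exact ⟨(mem_jmTriples.1 ht).2.2.2.1, (h.straddles_iff ht).1 hs⟩
    · rintro ⟨hik, hs⟩
      have ht : (i, j, k) ∈ jmTriples L := mem_jmTriples.2 ⟨hVβ _ hs.1.1, hU _ hs.2.2,
        hVγ _ hs.2.1.1, hik, (h1.left_of_mem_ul hs.2.2 hs.1.1).incomp.symm,
        (h2.left_of_mem_ul hs.2.2 hs.2.1.1).incomp⟩
      exact ⟨ht, (h.straddles_iff ht).2 hs⟩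

end PlanarCoords

/-! ### Counting in the intervals of a triple -/

namespace PlanarCoords

variable {L : Type*} [Lattice L]

section
variable {c : PlanarCoords L} {i j k : L}

/-- The two rectangles share the corner `j`. Their intersection has the column of `i` and the row of
`k` as its opposite sides, and these meet in `i ⊔ (j ⊓ k)`. -/
theorem Left.uIcc_inter_uIcc (h : c.Left j i) (h' : c.Left j k) (hik : i < k) :
    Set.uIcc i j ∩ Set.uIcc j k = Set.uIcc (i ⊔ (j ⊓ k)) j ∧ c.Left j (i ⊔ (j ⊓ k)) ∧
      (i ⊔ (j ⊓ k)) ⊔ j = i ⊔ j ∧ (i ⊔ (j ⊓ k)) ⊓ j = j ⊓ k := by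
  have h1 := (c.le_iff _ _).1 hik.le
  have hl : c.Left j (i ⊔ (j ⊓ k)) := by
    simp only [Left, c.cx_sup, c.cy_sup, c.cx_inf, c.cy_inf] at *
    omega
  refine ⟨?_, hl, ?_, ?_⟩
  · ext z
    rw [Set.mem_inter_iff, Set.uIcc_comm i, Set.uIcc_comm _ j, c.mem_uIcc h, c.mem_uIcc h',
      c.mem_uIcc hl]
    simp only [Left, c.cx_sup, c.cy_sup, c.cx_inf, c.cy_inf] at *
    omega
  · simp only [Left, c.ext_iff', c.cx_sup, c.cy_sup, c.cx_inf, c.cy_inf] at *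
    omega
  · simp only [Left, c.ext_iff', c.cx_sup, c.cy_sup, c.cx_inf, c.cy_inf] at *
    omega

theorem uIcc_inter_uIcc (c : PlanarCoords L) (h : Incomp i j) (h' : Incomp j k) (hik : i < k) :
    Set.uIcc i j ∩ Set.uIcc j k = Set.uIcc (i ⊔ (j ⊓ k)) j ∧ Incomp (i ⊔ (j ⊓ k)) j ∧
      (i ⊔ (j ⊓ k)) ⊔ j = i ⊔ j ∧ (i ⊔ (j ⊓ k)) ⊓ j = j ⊓ k := by
  have h1 := (c.le_iff _ _).1 hik.le
  rcases c.incomp_iff.1 h with hl | hl <;> rcases c.incomp_iff.1 h' with hl' | hl'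
  · unfold Left at hl hl'
    omega
  · have := Left.uIcc_inter_uIcc (c.swap_left.2 hl) (c.swap_left.2 hl') hik
    exact ⟨this.1, this.2.1.incomp.symm, this.2.2⟩
  · have := hl.uIcc_inter_uIcc hl' hik
    exact ⟨this.1, this.2.1.incomp.symm, this.2.2⟩
  · unfold Left at hl hl'
    omega

theorem Left.exists_point (h : c.Left j i) {p q : L} (hp : c.cy p = c.cy j)
    (hp' : c.cx j ≤ c.cx p ∧ c.cx p ≤ c.cx i) (hq : c.cx q = c.cx j) (hq' : c.cy i ≤ c.cy q) :
    ∃ z, c.cx z = c.cx p ∧ c.cy z = c.cy q := by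
  -- Meeting with `i` pushes `p` down its column to the row of `i`, below `q`; joining with `q`
  -- lifts it to the row of `q`.
  refine ⟨q ⊔ (p ⊓ i), ?_⟩
  simp only [Left, c.cx_sup, c.cy_sup, c.cx_inf, c.cy_inf] at *
  omega

end

variable [Finite L]

theorem mem_xs_iff (c : PlanarCoords L) {u v : L} (h : c.cy u = c.cy v) {a : ℕ} :
    a ∈ c.xs u v ↔ ∃ z, c.cx z = a ∧ c.cy z = c.cy v ∧ c.cx u ≤ c.cx z ∧ c.cx z ≤ c.cx v := by
  rw [mem_xs]
  refine exists_congr fun z => ?_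
  rw [c.le_iff, c.le_iff]
  omega

theorem mem_swap_xs_iff (c : PlanarCoords L) {u v : L} (h : c.cx u = c.cx v) {a : ℕ} :
    a ∈ c.swap.xs u v ↔
      ∃ z, c.cy z = a ∧ c.cx z = c.cx v ∧ c.cy u ≤ c.cy z ∧ c.cy z ≤ c.cy v :=
  c.swap.mem_xs_iff h

variable [IsModularLattice L]

theorem onInterval_gridLShape (c : PlanarCoords L) {i j k : L} (h : Incomp i j) (h' : Incomp j k)
    (hik : i < k) : onInterval gridLShape (i ⊔ (j ⊓ k)) j =
      gridLShape (ht (i ⊔ j) - ht j) (ht j - ht (j ⊓ k)) := by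
  obtain ⟨-, h2, h3, h4⟩ := c.uIcc_inter_uIcc h h' hik
  have := c.ht_sup_sub_of_incomp h2.symm
  rw [sup_comm j, h3, inf_comm j (i ⊔ _)] at this
  rw [onInterval, this, h4]

/-- The six coordinates are independent apart from two inequalities: the column of `γ` is beyond
`i`, the row of `β` is below `k`, and the columns of `α`, `β` and the rows of `γ`, `α` are
increasing pairs in the overlap. This gives the four factors. -/
theorem Left.ncard_straddles {c : PlanarCoords L} {i j k : L} (h : c.Left j i) (h' : c.Left j k)
    (hik : i < k) :
    {t : L × L × L | IsLShape t.1 t.2.1 t.2.2 ∧ Straddles t.1 t.2.1 t.2.2 (i, j, k)}.ncard =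
      (ht (j ⊔ k) - ht (i ⊔ j)) * (ht (j ⊓ k) - ht (i ⊓ j)) *
        (ht (i ⊔ j) - ht j + 1).choose 2 * (ht j - ht (j ⊓ k) + 1).choose 2 := by
  have hle := (c.le_iff _ _).1 hik.le
  have hh := h
  have hh' := h'
  obtain ⟨a1, a2⟩ := hh
  obtain ⟨b1, b2⟩ := hh'
  have e1 : c.cy j = c.cy (i ⊔ j) := by rw [c.cy_sup]; omega
  have e2 : c.cx (j ⊓ k) = c.cx j := by rw [c.cx_inf]; omega
  have e3 : c.cx (i ⊓ j) = c.cx (j ⊓ k) := by rw [c.cx_inf, c.cx_inf]; omega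
  have e4 : c.cy (i ⊔ j) = c.cy (j ⊔ k) := by rw [c.cy_sup, c.cy_sup]; omega
  have f1 : c.cx (i ⊔ j) = c.cx i := by rw [c.cx_sup]; omega
  have f2 : c.cx (j ⊔ k) = c.cx k := by rw [c.cx_sup]; omega
  have f3 : c.cy (i ⊓ j) = c.cy i := by rw [c.cy_inf]; omega
  have f4 : c.cy (j ⊓ k) = c.cy k := by rw [c.cy_inf]; omega
  have l1 : i ⊔ j ≤ j ⊔ k := sup_le (hik.le.trans le_sup_right) le_sup_left
  have l2 : i ⊓ j ≤ j ⊓ k := le_inf inf_le_right (inf_le_left.trans hik.le)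
  have hX := c.card_xs le_sup_right e1
  have hY := c.swap.card_xs inf_le_left e2
  have hX2 := c.card_xs l1 e4
  have hY0 := c.swap.card_xs l2 e3
  -- The end shared with the overlap is removed from either range, which turns height difference
  -- plus one into the height difference.
  have mX2 : c.cx (i ⊔ j) ∈ c.xs (i ⊔ j) (j ⊔ k) := c.mem_xs.2 ⟨_, ⟨le_rfl, l1⟩, rfl⟩
  have mY0 : c.cy (j ⊓ k) ∈ c.swap.xs (i ⊓ j) (j ⊓ k) := c.swap.mem_xs.2 ⟨_, ⟨l2, le_rfl⟩, rfl⟩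
  have hX2' := Finset.card_erase_of_mem mX2
  have hY0' := Finset.card_erase_of_mem mY0
  rw [hX2, Nat.add_sub_cancel] at hX2'
  rw [hY0, Nat.add_sub_cancel] at hY0'
  rw [← hX, ← hY, ← hX2', ← hY0', ← card_incPairs, ← card_incPairs, ← Finset.card_product,
    ← Finset.card_product, ← Finset.card_product, ← Set.ncard_coe_finset]
  have memX := fun a => c.mem_xs_iff e1 (a := a)
  have memY := fun a => c.mem_swap_xs_iff e2 (a := a)
  have memX2 := fun a => c.mem_xs_iff e4 (a := a)
  have memY0 := fun a => c.mem_swap_xs_iff e3 (a := a)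
  simp only [← e4, ← e1, e2, f1, f2, f3, f4] at memX memY memX2 memY0
  have hS : ∀ α β γ, (IsLShape α β γ ∧ Straddles α β γ (i, j, k)) ↔ c.LeftLShape α β γ ∧
      (c.cx j ≤ c.cx α ∧ c.cy α ≤ c.cy j) ∧ (c.cx β ≤ c.cx i ∧ c.cy i ≤ c.cy β ∧ c.cy β < c.cy k) ∧
      (c.cx γ ≤ c.cx k ∧ c.cx i < c.cx γ ∧ c.cy k ≤ c.cy γ) := by
    intro α β γ
    rw [c.isLShape_iff_left]
    simp only [Straddles]
    rw [Set.uIcc_comm i j, c.mem_uIcc h, c.mem_uIcc h', c.mem_uIcc h, c.mem_uIcc h', c.mem_uIcc h,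
      c.mem_uIcc h']
    simp only [LeftLShape, swap]
    constructor
    · rintro ⟨h1 | h1, h2⟩
      · refine ⟨h1, ?_⟩
        omega
      · omega
    · rintro ⟨h1, h2⟩
      refine ⟨.inl h1, ?_⟩
      omega
  simp only [hS]
  refine Set.ncard_congr (fun t _ => (((c.cx t.2.2, c.cy t.2.1), (c.cx t.1, c.cx t.2.1)),
    (c.cy t.2.2, c.cy t.1))) ?_ ?_ ?_
  · rintro ⟨α, β, γ⟩ ⟨h1, h2, h3, h4⟩
    simp only [LeftLShape] at h1 h2 h3 h4
    rw [SetLike.mem_coe, Finset.mem_product, Finset.mem_product, Finset.mem_product,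
      mem_incPairs, mem_incPairs, Finset.mem_erase, Finset.mem_erase, memX, memX, memY, memY,
      memX2, memY0]
    refine ⟨⟨⟨⟨?_, γ ⊔ j, ?_⟩, ⟨?_, β ⊓ j, ?_⟩⟩, ⟨α ⊔ j, ?_⟩, ⟨β ⊔ j, ?_⟩, h1.1.1⟩,
      ⟨γ ⊓ j, ?_⟩, ⟨α ⊓ j, ?_⟩, h1.2.2⟩ <;>
    simp only [c.cx_sup, c.cy_sup, c.cx_inf, c.cy_inf] <;> omega
  · rintro ⟨α, β, γ⟩ ⟨α', β', γ'⟩ - - e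
    simp only [Prod.mk.injEq] at e ⊢
    exact ⟨c.ext' e.1.2.1 e.2.2, c.ext' e.1.2.2 e.1.1.2, c.ext' e.1.1.1 e.2.1⟩
  · rintro ⟨⟨⟨x₂, y₀⟩, x₀, x₁⟩, y₁, y₂⟩ ht
    rw [SetLike.mem_coe, Finset.mem_product, Finset.mem_product, Finset.mem_product,
      mem_incPairs, mem_incPairs, Finset.mem_erase, Finset.mem_erase, memX, memX, memY, memY,
      memX2, memY0] at ht
    obtain ⟨⟨⟨⟨g1, p₂, rfl, k1⟩, ⟨g2, q₀, rfl, k2⟩⟩, ⟨p₀, rfl, k3⟩, ⟨p₁, rfl, k4⟩, g3⟩,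
      ⟨q₁, rfl, k5⟩, ⟨q₂, rfl, k6⟩, g4⟩ := ht
    change c.cx p₂ ≠ _ at g1
    change c.cy q₀ ≠ _ at g2
    obtain ⟨α, z1, z2⟩ := h.exists_point (p := p₀) (q := q₂) (by omega) (by omega) (by omega)
      (by omega)
    obtain ⟨β, z3, z4⟩ := h.exists_point (p := p₁) (q := q₀) (by omega) (by omega) (by omega)
      (by omega)
    obtain ⟨γ, z5, z6⟩ := h'.exists_point (p := p₂) (q := q₁) (by omega) (by omega) (by omega)
      (by omega)
    refine ⟨(α, β, γ), ⟨⟨⟨?_, ?_⟩, ?_, ?_⟩, ⟨?_, ?_⟩, ⟨?_, ?_, ?_⟩, ?_, ?_, ?_⟩, ?_⟩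
    all_goals simp only [Prod.mk.injEq]
    all_goals omega

theorem ncard_straddles (c : PlanarCoords L) {i j k : L} (h : Incomp i j) (h' : Incomp j k)
    (hik : i < k) :
    {t : L × L × L | IsLShape t.1 t.2.1 t.2.2 ∧ Straddles t.1 t.2.1 t.2.2 (i, j, k)}.ncard =
      (ht (j ⊔ k) - ht (i ⊔ j)) * (ht (j ⊓ k) - ht (i ⊓ j)) *
        (ht (i ⊔ j) - ht j + 1).choose 2 * (ht j - ht (j ⊓ k) + 1).choose 2 := by
  have h1 := (c.le_iff _ _).1 hik.le
  rcases c.incomp_iff.1 h with hl | hl <;> rcases c.incomp_iff.1 h' with hl' | hl'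
  · unfold Left at hl hl'
    omega
  · exact Left.ncard_straddles (c.swap_left.2 hl) (c.swap_left.2 hl') hik
  · exact hl.ncard_straddles hl' hik
  · unfold Left at hl hl'
    omega

end PlanarCoords

/-! ### Inclusion and exclusion over pairs and triples -/

theorem sum_ncard_eq {τ ι : Type*} [Finite τ] (T : Set τ) (P : Finset ι) (In : τ → ι → Prop)
    [∀ t, DecidablePred (In t)] :
    ∑ p ∈ P, {t | t ∈ T ∧ In t p}.ncard =
      ∑ t ∈ (Set.toFinite T).toFinset, {p ∈ P | In t p}.card := by
  refine Eq.trans ?_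
    (Finset.sum_card_bipartiteAbove_eq_sum_card_bipartiteBelow In (s := (Set.toFinite T).toFinset)
      (t := P)).symm
  refine Finset.sum_congr rfl fun p _ => ?_
  rw [← Set.ncard_coe_finset]
  congr 1
  ext t
  simp

/-- Double counting of incidences: a local identity at every configuration becomes the global one.
-/
theorem sum_ncard_add_sum_ncard {τ ι κ : Type*} [Finite τ] (T : Set τ) (P : Finset ι)
    (Q : Finset κ) (In : τ → ι → Prop) (In₂ Ex : τ → κ → Prop) [∀ t, DecidablePred (In t)]
    [∀ t, DecidablePred (In₂ t)] [∀ t, DecidablePred (Ex t)]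
    (h : ∀ t ∈ T, {p ∈ P | In t p}.card + {q ∈ Q | Ex t q}.card = {q ∈ Q | In₂ t q}.card + 1) :
    ∑ p ∈ P, {t | t ∈ T ∧ In t p}.ncard + ∑ q ∈ Q, {t | t ∈ T ∧ Ex t q}.ncard =
      ∑ q ∈ Q, {t | t ∈ T ∧ In₂ t q}.ncard + T.ncard := by
  rw [sum_ncard_eq, sum_ncard_eq, sum_ncard_eq, ← Finset.sum_add_distrib,
    Set.ncard_eq_toFinset_card T, Finset.card_eq_sum_ones, ← Finset.sum_add_distrib]
  exact Finset.sum_congr rfl fun t ht => h t ((Set.Finite.mem_toFinset _).1 ht)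

namespace PlanarCoords

variable {L : Type*} [Lattice L] [Finite L]

open Classical in
theorem card_filter_of_incomp (c : PlanarCoords L) (hz : IsZigzag L) {α β γ : L}
    (h : Incomp α γ) (h1 : α ⊓ γ ≤ β) (h2 : β ≤ α ⊔ γ) :
    {p ∈ jmPairs L | α ∈ Set.Icc p.inf p.sup ∧ β ∈ Set.Icc p.inf p.sup ∧
      γ ∈ Set.Icc p.inf p.sup}.card =
      {t ∈ jmTriples L | α ∈ Set.uIcc t.1 t.2.1 ∩ Set.uIcc t.2.1 t.2.2 ∧
        β ∈ Set.uIcc t.1 t.2.1 ∩ Set.uIcc t.2.1 t.2.2 ∧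
        γ ∈ Set.uIcc t.1 t.2.1 ∩ Set.uIcc t.2.1 t.2.2}.card + 1 := by
  have hβ : ∀ u v : L, α ∈ Set.Icc u v → γ ∈ Set.Icc u v → β ∈ Set.Icc u v := fun u v h3 h4 =>
    ⟨(le_inf h3.1 h4.1).trans h1, h2.trans (sup_le h3.2 h4.2)⟩
  have key : {p ∈ jmPairs L | α ∈ Set.Icc p.inf p.sup ∧ γ ∈ Set.Icc p.inf p.sup}.card =
      {t ∈ jmTriples L | (α ∈ Set.uIcc t.1 t.2.1 ∧ γ ∈ Set.uIcc t.1 t.2.1) ∧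
        α ∈ Set.uIcc t.2.1 t.2.2 ∧ γ ∈ Set.uIcc t.2.1 t.2.2}.card + 1 := by
    rcases c.incomp_iff.1 h with h | h
    · exact h.card_filter_jmPairs hz
    · exact (c.swap_left.2 h).card_filter_jmPairs hz
  have e1 : ∀ u v : L, (α ∈ Set.Icc u v ∧ β ∈ Set.Icc u v ∧ γ ∈ Set.Icc u v) ↔
      α ∈ Set.Icc u v ∧ γ ∈ Set.Icc u v := fun u v =>
    ⟨fun h => ⟨h.1, h.2.2⟩, fun h => ⟨h.1, hβ u v h.1 h.2, h.2⟩⟩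
  simp only [e1]
  convert key using 4 with t
  have h3 := hβ (t.1 ⊓ t.2.1) (t.1 ⊔ t.2.1)
  have h4 := hβ (t.2.1 ⊓ t.2.2) (t.2.1 ⊔ t.2.2)
  simp only [Set.mem_inter_iff, Set.uIcc] at h3 h4 ⊢
  tauto

open Classical in
theorem card_filter_of_isLShape (c : PlanarCoords L) (hz : IsZigzag L) {α β γ : L}
    (h : IsLShape α β γ) :
    {p ∈ jmPairs L | α ∈ Set.Icc p.inf p.sup ∧ β ∈ Set.Icc p.inf p.sup ∧
      γ ∈ Set.Icc p.inf p.sup}.card + {t ∈ jmTriples L | Straddles α β γ t}.card =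
      {t ∈ jmTriples L | α ∈ Set.uIcc t.1 t.2.1 ∩ Set.uIcc t.2.1 t.2.2 ∧
        β ∈ Set.uIcc t.1 t.2.1 ∩ Set.uIcc t.2.1 t.2.2 ∧
        γ ∈ Set.uIcc t.1 t.2.1 ∩ Set.uIcc t.2.1 t.2.2}.card + 1 := by
  have key := (c.isLShape_iff_left.1 h).elim (fun h => h.card_filter_jmPairs hz)
    fun h => h.card_filter_jmPairs hz
  convert key using 4
  simp only [Set.mem_inter_iff]
  tauto

theorem sum_jmPairs (P : L → L → L → Prop) (F : ℕ → ℕ → ℕ) (hF : ∀ m n, F m n = F n m) (a : ℕ)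
    (h : ∀ x y : L, Incomp x y → a * (triplesIn (Set.uIcc x y) P).ncard = onInterval F x y) :
    a * ∑ p ∈ jmPairs L, {t : L × L × L | t ∈ {t : L × L × L | P t.1 t.2.1 t.2.2} ∧
      t.1 ∈ Set.Icc p.inf p.sup ∧ t.2.1 ∈ Set.Icc p.inf p.sup ∧
      t.2.2 ∈ Set.Icc p.inf p.sup}.ncard = ∑ p ∈ jmPairs L, onPair F hF p := by
  rw [Finset.mul_sum]
  refine Finset.sum_congr rfl fun p hp => ?_
  simp only [jmPairs, Set.Finite.mem_toFinset, Set.mem_ofPred_eq] at hp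
  obtain ⟨x, -, y, -, hxy, rfl⟩ := hp
  exact h x y hxy

theorem sum_jmTriples (c : PlanarCoords L) (P : L → L → L → Prop) (F : ℕ → ℕ → ℕ) (a : ℕ)
    (h : ∀ x y : L, Incomp x y → a * (triplesIn (Set.uIcc x y) P).ncard = onInterval F x y) :
    a * ∑ q ∈ jmTriples L, {t : L × L × L | t ∈ {t : L × L × L | P t.1 t.2.1 t.2.2} ∧
      t.1 ∈ Set.uIcc q.1 q.2.1 ∩ Set.uIcc q.2.1 q.2.2 ∧
      t.2.1 ∈ Set.uIcc q.1 q.2.1 ∩ Set.uIcc q.2.1 q.2.2 ∧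
      t.2.2 ∈ Set.uIcc q.1 q.2.1 ∩ Set.uIcc q.2.1 q.2.2}.ncard =
    ∑ q ∈ jmTriples L, onInterval F (q.1 ⊔ (q.2.1 ⊓ q.2.2)) q.2.1 := by
  rw [Finset.mul_sum]
  refine Finset.sum_congr rfl ?_
  rintro ⟨i, j, k⟩ hq
  obtain ⟨-, -, -, hik, hij, hjk⟩ := mem_jmTriples.1 hq
  obtain ⟨h1, h2, -⟩ := c.uIcc_inter_uIcc hij hjk hik
  rw [← h _ _ h2, ← h1]
  rfl

/-- By `hP` an interval containing `α` and `γ` contains `β`, so a configuration is counted like the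
single diamond `(α, γ)`. This covers strips and boxes, but not L-shapes, where `α ⊓ γ ≤ β` fails. -/
theorem sum_ncard_of_incomp (c : PlanarCoords L) (hz : IsZigzag L) (P : L → L → L → Prop)
    (F : ℕ → ℕ → ℕ) (hF : ∀ m n, F m n = F n m) (a : ℕ)
    (h : ∀ x y : L, Incomp x y → a * (triplesIn (Set.uIcc x y) P).ncard = onInterval F x y)
    (hP : ∀ α β γ, P α β γ → Incomp α γ ∧ α ⊓ γ ≤ β ∧ β ≤ α ⊔ γ) :
    ∑ p ∈ jmPairs L, onPair F hF p =
      ∑ q ∈ jmTriples L, onInterval F (q.1 ⊔ (q.2.1 ⊓ q.2.2)) q.2.1 +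
        a * {t : L × L × L | P t.1 t.2.1 t.2.2}.ncard := by
  classical
  have := sum_ncard_add_sum_ncard {t : L × L × L | P t.1 t.2.1 t.2.2} (jmPairs L) (jmTriples L)
    (fun t p => t.1 ∈ Set.Icc p.inf p.sup ∧ t.2.1 ∈ Set.Icc p.inf p.sup ∧
      t.2.2 ∈ Set.Icc p.inf p.sup)
    (fun t q => t.1 ∈ Set.uIcc q.1 q.2.1 ∩ Set.uIcc q.2.1 q.2.2 ∧
      t.2.1 ∈ Set.uIcc q.1 q.2.1 ∩ Set.uIcc q.2.1 q.2.2 ∧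
      t.2.2 ∈ Set.uIcc q.1 q.2.1 ∩ Set.uIcc q.2.1 q.2.2) (fun _ _ => False) (fun t ht => by
      obtain ⟨h1, h2, h3⟩ := hP _ _ _ ht
      rw [Finset.filter_false, Finset.card_empty, add_zero]
      convert c.card_filter_of_incomp hz h1 h2 h3)
  simp only [and_false, Set.ofPred_false, Set.ncard_empty, Finset.sum_const_zero, add_zero] at this
  rw [← sum_jmPairs P F hF a h, ← c.sum_jmTriples P F a h, ← mul_add, ← this]

/-! ### The three counting formulas and the theorem -/

variable [IsModularLattice L]

theorem numStrip_eq (c : PlanarCoords L) (hz : IsZigzag L) :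
    (numStrip L : ℤ) = stripFormula L := by
  have := c.sum_ncard_of_incomp hz IsStrip gridStrip gridStrip_comm 2
    (fun x y h => c.two_mul_ncard_isStrip h)
    (fun α β γ h => ⟨h.2.1, h.2.2.2.2.2.2.1, h.2.2.2.2.2.1⟩)
  rw [stripFormula, numStrip, ← Nat.cast_sum, ← Nat.cast_sum, this]
  push_cast
  ring

theorem numBox_eq (c : PlanarCoords L) (hz : IsZigzag L) : (numBox L : ℤ) = boxFormula L := by
  have := c.sum_ncard_of_incomp hz IsBox gridBox gridBox_comm 1
    (fun x y h => (one_mul _).trans (c.ncard_isBox_uIcc h))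
    (fun α β γ h => ⟨h.2.1, h.2.2.2.2.2.2.1, h.2.2.2.2.2.1⟩)
  rw [boxFormula, ← c.ncard_isBox, ← Nat.cast_sum, ← Nat.cast_sum, this]
  push_cast
  ring

theorem numLShape_eq (c : PlanarCoords L) (hz : IsZigzag L) :
    (numLShape L : ℤ) = lShapeFormula L := by
  classical
  have := sum_ncard_add_sum_ncard {t : L × L × L | IsLShape t.1 t.2.1 t.2.2} (jmPairs L)
    (jmTriples L)
    (fun t p => t.1 ∈ Set.Icc p.inf p.sup ∧ t.2.1 ∈ Set.Icc p.inf p.sup ∧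
      t.2.2 ∈ Set.Icc p.inf p.sup)
    (fun t q => t.1 ∈ Set.uIcc q.1 q.2.1 ∩ Set.uIcc q.2.1 q.2.2 ∧
      t.2.1 ∈ Set.uIcc q.1 q.2.1 ∩ Set.uIcc q.2.1 q.2.2 ∧
      t.2.2 ∈ Set.uIcc q.1 q.2.1 ∩ Set.uIcc q.2.1 q.2.2)
    (fun t q => Straddles t.1 t.2.1 t.2.2 q) (fun t ht => by
      convert c.card_filter_of_isLShape hz ht)
  have hgrid : ∀ x y : L, Incomp x y →
      1 * (triplesIn (Set.uIcc x y) IsLShape).ncard = onInterval gridLShape x y :=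
    fun x y h => (one_mul _).trans (c.ncard_isLShape_uIcc h)
  have h1 := sum_jmPairs IsLShape gridLShape gridLShape_comm 1 hgrid
  have h2 := c.sum_jmTriples IsLShape gridLShape 1 hgrid
  have h3 : ∑ q ∈ jmTriples L, onInterval gridLShape (q.1 ⊔ (q.2.1 ⊓ q.2.2)) q.2.1 =
      ∑ t ∈ jmTriples L,
        gridLShape (ht (t.1 ⊔ t.2.1) - ht t.2.1) (ht t.2.1 - ht (t.2.1 ⊓ t.2.2)) := by
    refine Finset.sum_congr rfl ?_
    rintro ⟨i, j, k⟩ hq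
    obtain ⟨-, -, -, hik, hij, hjk⟩ := mem_jmTriples.1 hq
    exact c.onInterval_gridLShape hij hjk hik
  have h4 : ∑ q ∈ jmTriples L, {t : L × L × L | t ∈ {t : L × L × L | IsLShape t.1 t.2.1 t.2.2} ∧
      Straddles t.1 t.2.1 t.2.2 q}.ncard = ∑ t ∈ jmTriples L,
      ((ht (t.2.1 ⊔ t.2.2) - ht (t.1 ⊔ t.2.1)) * (ht (t.2.1 ⊓ t.2.2) - ht (t.1 ⊓ t.2.1)) *
        (ht (t.1 ⊔ t.2.1) - ht t.2.1 + 1).choose 2 *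
        (ht t.2.1 - ht (t.2.1 ⊓ t.2.2) + 1).choose 2) := by
    refine Finset.sum_congr rfl ?_
    rintro ⟨i, j, k⟩ hq
    obtain ⟨-, -, -, hik, hij, hjk⟩ := mem_jmTriples.1 hq
    exact c.ncard_straddles hij hjk hik
  rw [one_mul] at h1 h2
  rw [h1, h2, h3, h4] at this
  rw [lShapeFormula, numLShape, ← Nat.cast_sum, ← Nat.cast_sum, ← Nat.cast_sum]
  have h5 := congrArg (Nat.cast : ℕ → ℤ) this
  rw [Nat.cast_add, Nat.cast_add] at h5
  linarith

end PlanarCoords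

theorem mainTheorem2 {K : Type*} [Field K] {L : Type*} [DistribLattice L] [Finite L]
    (hL : IsPlanarLattice L) :
    firstBetti K L = numStrip L + numLShape L + numBox L + numDiamond L ∧
    (IsZigzag L →
      (numStrip L : ℤ) = stripFormula L ∧
      (numLShape L : ℤ) = lShapeFormula L ∧
      (numBox L : ℤ) = boxFormula L) := by
  obtain ⟨c⟩ := hL.exists_coords
  exact ⟨c.firstBetti_eq_count K, fun hz => ⟨c.numStrip_eq hz, c.numLShape_eq hz, c.numBox_eq hz⟩⟩
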